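/- Let $S$ be an inverse semigroup with zero. Homomorphisms between inverse semigroups with zero preserve $0$; $s\le t$ is the natural partial order ($s=te$ for some idempotent $e$); elements $s,t$ are compatible if $s^{-1}t$ and $st^{-1}$ are idempotents and orthogonal if $s^{-1}t=0=st^{-1}$. A Boolean inverse semigroup is an inverse semigroup with zero in which any two compatible elements have a join, multiplication distributes over such joins, and the idempotents form a (generalized) Boolean algebra; a morphism between such semigroups is a homomorphism that preserves binary compatible joins. *The Booleanization $\mathsf{B}(S)$.* A proper filter of $S$ is a nonempty, upward closed, downward directed subset not containing $0$. Put $\mathbf{d}(A)=(A^{-1}A)^{\uparrow}$ and $\mathbf{r}(A)=(AA^{-1})^{\uparrow}$. The proper filters form a groupoid, with $A\cdot B=(AB)^{\uparrow}$ defined if and only if $\mathbf{d}(A)=\mathbf{r}(B)$. A set of proper filters is a partial bisection if $\mathbf{d}$ and $\mathbf{r}$ are injective on it; under multiplication of subsets the partial bisections form an inverse semigroup, ordered by inclusion. For $a_1,\dots,a_m\le a$ in $S$ let $U_{a;a_1,\dots,a_m}$ be the set of proper filters that contain $a$ and omit $a_1,\dots,a_m$, and $U_a$ the set of those that contain $a$.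 Then $\mathsf{B}(S)$ is the semigroup of all finite compatible joins (that is, unions) of sets $U_{a;a_1,\dots,a_m}$, and $\upsilon\colon S\to\mathsf{B}(S)$ is the map $a\mapsto U_a$. *The Booleanization in a ring.* Let $S_0$ be an inverse subsemigroup of the multiplicative semigroup of a (not necessarily unital) ring $R$. Let $E'$ be the set of all elements $e(1-e_1)\cdots(1-e_n)$ with $n\ge 0$ and $e,e_1,\dots,e_n$ idempotents of $S_0$ (where $x(1-f)$ means $x-xf$), let $S'=S_0E'$, which is an inverse semigroup, and let $\mathsf{B}_R(S_0)=S''$ be the set of all finite sums of pairwise orthogonal elements of $S'$, a multiplicative subsemigroup of $R$. Let $\mathbb{C}_0S$ be the contracted semigroup algebra of $S$, that is, the quotient of the semigroup algebra $\mathbb{C}S$ by the ideal generated by the zero of $S$, and let $\iota\colon S\to\mathbb{C}_0S$ be the canonical map; write $\mathsf{B}_{\mathbb{C}_0S}(S)$ for $\mathsf{B}_{\mathbb{C}_0S}(\iota(S))$. **Theorem.** Let $S$ be an inverse semigroup with zero. 1. $\upsilon\colon S\to\mathsf{B}(S)$ is the Booleanization of $S$: $\mathsf{B}(S)$ is a Boolean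 inverse semigroup, $\upsilon$ is an injective homomorphism, and for every homomorphism $\theta$ from $S$ to a Boolean inverse semigroup $T$ there is a unique morphism $\gamma\colon\mathsf{B}(S)\to T$ with $\gamma(\upsilon(s))=\theta(s)$ for all $s\in S$. 2. $\mathsf{B}_{\mathbb{C}_0S}(S)$ is a Boolean inverse semigroup under the multiplication of $\mathbb{C}_0S$; if $S$ is a monoid, then it is a monoid whose identity is the image of the identity of $S$. 3. $\mathsf{B}(S)\cong\mathsf{B}_{\mathbb{C}_0S}(S)$: there is an isomorphism of semigroups $\Phi\colon\mathsf{B}(S)\to\mathsf{B}_{\mathbb{C}_0S}(S)$ with $\Phi(\upsilon(s))=\iota(s)$ for all $s\in S$. -/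

import Mathlib

universe u w v

namespace InvSemigroup

section Basic

variable {S : Type u} [Semigroup S]

/-- `t` is an inverse of `s` in the sense of semigroup theory. -/
def IsInverseOf (s t : S) : Prop := s * t * s = s ∧ t * s * t = t

/-- An inverse semigroup is a semigroup in which every element has exactly one inverse. -/
class IsInverseSemigroup (S : Type u) [Semigroup S] : Prop where
  existsUnique_inverse : ∀ s : S, ∃! t : S, IsInverseOf s t

open Classical in
/-- The inverse `s⁻¹` in an inverse semigroup (with the irrelevant value `s` if there is none). -/
noncomputable def sinv (s : S) : S := if h : ∃ t, IsInverseOf s t then h.choose else s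

/-- The natural partial order: `s ≤ t` iff `s = t * e` for some idempotent `e`. -/
def NatLE (s t : S) : Prop := ∃ e : S, IsIdempotentElem e ∧ s = t * e

/-- The compatibility relation `s ∼ t`. -/
def Compat (s t : S) : Prop := IsIdempotentElem (sinv s * t) ∧ IsIdempotentElem (s * sinv t)

/-- `c` is the join (least upper bound) of `a` and `b` in the natural partial order. -/
def IsJoin (a b c : S) : Prop :=
  NatLE a c ∧ NatLE b c ∧ ∀ d : S, NatLE a d → NatLE b d → NatLE c d

end Basic

/-- A distributive inverse semigroup: an inverse semigroup with zero in which any two compatible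
elements have a join, and in which multiplication distributes over such joins. -/
structure IsDistributiveInverse (T : Type v) [SemigroupWithZero T] : Prop where
  isInverse : IsInverseSemigroup T
  exists_join : ∀ a b : T, Compat a b → ∃ c, IsJoin a b c
  mul_join : ∀ a b c x : T, Compat a b → IsJoin a b c → IsJoin (x * a) (x * b) (x * c)
  join_mul : ∀ a b c x : T, Compat a b → IsJoin a b c → IsJoin (a * x) (b * x) (c * x)

/-- A Boolean inverse semigroup: a distributive inverse semigroup whose idempotents form a
(generalized) Boolean algebra.  In a distributive inverse semigroup the idempotents form a
distributive lattice with bottom `0`, meet `e * f`, and join the compatible join; so what remains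
to be asked is that each principal order ideal of idempotents is complemented. -/
structure IsBooleanInverse (T : Type v) [SemigroupWithZero T] : Prop
    extends IsDistributiveInverse T where
  exists_compl : ∀ e f : T, IsIdempotentElem e → IsIdempotentElem f → NatLE f e →
    ∃ g : T, IsIdempotentElem g ∧ f * g = 0 ∧ IsJoin f g e

/-- A morphism between distributive inverse semigroups: a zero preserving homomorphism that
preserves binary compatible joins. -/
def IsMorphism {B : Type w} {T : Type v} [SemigroupWithZero B] [SemigroupWithZero T]
    (γ : B →ₙ* T) : Prop :=
  γ 0 = 0 ∧ ∀ a b c : B, Compat a b → IsJoin a b c → IsJoin (γ a) (γ b) (γ c)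

/-- `β : S → B` is a Booleanization of the inverse semigroup with zero `S`: `B` is a Boolean
inverse semigroup, `β` is an embedding, and every homomorphism from `S` to a Boolean
inverse semigroup factors through `β` by a unique morphism. -/
structure IsBooleanization {S : Type u} {B : Type w} [SemigroupWithZero S] [SemigroupWithZero B]
    (β : S →ₙ* B) : Prop where
  isBoolean : IsBooleanInverse B
  map_zero : β 0 = 0
  injective : Function.Injective β
  existsUnique_lift : ∀ (T : Type v) [SemigroupWithZero T], IsBooleanInverse T →
    ∀ θ : S →ₙ* T, θ 0 = 0 → ∃! γ : B →ₙ* T, IsMorphism γ ∧ ∀ s : S, γ (β s) = θ s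

/-! ### Elementary facts on inverse semigroups -/

section Facts

variable {S : Type u} [Semigroup S]

theorem IsInverseOf.symm {s t : S} (h : IsInverseOf s t) : IsInverseOf t s := ⟨h.2, h.1⟩

theorem IsInverseOf.idem_left {s t : S} (h : IsInverseOf s t) : IsIdempotentElem (t * s) := by
  show t * s * (t * s) = t * s
  rw [← mul_assoc, h.2]

theorem IsInverseOf.idem_right {s t : S} (h : IsInverseOf s t) : IsIdempotentElem (s * t) :=
  h.symm.idem_left

/-- Inverses are unique where the idempotents `t * s`, `s * t`, `u * s`, `s * u` commute. -/
theorem inverse_unique_of_comm {s t u : S} (ht : IsInverseOf s t) (hu : IsInverseOf s u)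
    (h1 : t * s * (u * s) = u * s * (t * s)) (h2 : s * t * (s * u) = s * u * (s * t)) :
    t = u := by
  have e1 : t * s = u * s := by
    have a1 : t * s * (u * s) = t * s := by
      rw [mul_assoc, ← mul_assoc s u s, hu.1]
    have a2 : u * s * (t * s) = u * s := by
      rw [mul_assoc, ← mul_assoc s t s, ht.1]
    rw [← a1, h1, a2]
  have e2 : s * t = s * u := by
    have a1 : s * t * (s * u) = s * u := by
      rw [← mul_assoc, ht.1]
    have a2 : s * u * (s * t) = s * t := by
      rw [← mul_assoc, hu.1]
    rw [← a1, h2, a2]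
  calc t = t * s * t := ht.2.symm
    _ = u * s * t := by rw [e1]
    _ = u * (s * t) := mul_assoc _ _ _
    _ = u * s * u := by rw [e2, mul_assoc]
    _ = u := hu.2

variable [IsInverseSemigroup S]

theorem isInverseOf_sinv (s : S) : IsInverseOf s (sinv s) := by
  have h : ∃ t, IsInverseOf s t := (IsInverseSemigroup.existsUnique_inverse s).exists
  unfold sinv
  rw [dif_pos h]
  exact h.choose_spec

theorem inverse_unique {s t u : S} (ht : IsInverseOf s t) (hu : IsInverseOf s u) : t = u :=
  (IsInverseSemigroup.existsUnique_inverse s).unique ht hu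

theorem sinv_eq {s t : S} (h : IsInverseOf s t) : sinv s = t :=
  inverse_unique (isInverseOf_sinv s) h

theorem sinv_sinv (s : S) : sinv (sinv s) = s := sinv_eq (isInverseOf_sinv s).symm

theorem mul_sinv_mul (s : S) : s * (sinv s * s) = s := by
  rw [← mul_assoc]; exact (isInverseOf_sinv s).1

theorem sinv_mul_sinv (s : S) : sinv s * (s * sinv s) = sinv s := by
  rw [← mul_assoc]; exact (isInverseOf_sinv s).2

theorem idem_sinv_mul (s : S) : IsIdempotentElem (sinv s * s) := (isInverseOf_sinv s).idem_left

theorem idem_mul_sinv (s : S) : IsIdempotentElem (s * sinv s) := (isInverseOf_sinv s).idem_right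

theorem idem_mul {e f : S} (he : IsIdempotentElem e) (hf : IsIdempotentElem f) :
    IsIdempotentElem (e * f) := by
  have h := isInverseOf_sinv (e * f)
  generalize sinv (e * f) = x at h
  have he' : ∀ y, e * (e * y) = e * y := fun y => by rw [← mul_assoc, he]
  have hf' : ∀ y, f * (f * y) = f * y := fun y => by rw [← mul_assoc, hf]
  obtain ⟨h1, h2⟩ := h
  simp only [mul_assoc] at h1 h2
  have h3 : IsInverseOf (e * f) (f * (x * e)) := by
    constructor
    · simp only [mul_assoc, he', hf', h1]
    · simp only [mul_assoc, he', hf']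
      rw [show f * (x * (e * (f * (x * e)))) = f * ((x * (e * (f * x))) * e) by
        simp only [mul_assoc], h2]
  have h4 : x = f * (x * e) :=
    inverse_unique (s := e * f) ⟨by simp only [mul_assoc, h1], by simp only [mul_assoc, h2]⟩ h3
  have h5 : x * x = x := by
    conv_lhs => rw [h4]
    rw [show f * (x * e) * (f * (x * e)) = f * ((x * (e * (f * x))) * e) by
      simp only [mul_assoc], h2, ← h4]
  have h6 : IsInverseOf x (e * f) := ⟨by simp only [mul_assoc, h2], by simp only [mul_assoc, h1]⟩
  have h7 : IsInverseOf x x := ⟨by rw [h5, h5], by rw [h5, h5]⟩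
  rw [inverse_unique h6 h7]
  exact h5

theorem idem_comm {e f : S} (he : IsIdempotentElem e) (hf : IsIdempotentElem f) :
    e * f = f * e := by
  have he' : ∀ y, e * (e * y) = e * y := fun y => by rw [← mul_assoc, he]
  have hf' : ∀ y, f * (f * y) = f * y := fun y => by rw [← mul_assoc, hf]
  have h1 : e * (f * (e * f)) = e * f := by
    have h : e * f * (e * f) = e * f := idem_mul he hf
    rwa [mul_assoc] at h
  have h2 : f * (e * (f * e)) = f * e := by
    have h : f * e * (f * e) = f * e := idem_mul hf he
    rwa [mul_assoc] at h
  refine inverse_unique (s := e * f) ⟨?_, ?_⟩ ⟨?_, ?_⟩ <;>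
    simp only [mul_assoc, he', hf', h1, h2]

theorem sinv_mul (s t : S) : sinv (s * t) = sinv t * sinv s := by
  have key : ∀ y, t * (sinv t * (sinv s * (s * y))) = sinv s * (s * (t * (sinv t * y))) := by
    intro y
    have := idem_comm (idem_mul_sinv t) (idem_sinv_mul s)
    calc t * (sinv t * (sinv s * (s * y))) = (t * sinv t * (sinv s * s)) * y := by
          simp only [mul_assoc]
      _ = _ := by rw [this]; simp only [mul_assoc]
  have ht := (isInverseOf_sinv t).1
  have hs := (isInverseOf_sinv s).2
  have hs1 := (isInverseOf_sinv s).1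
  have ht2 := (isInverseOf_sinv t).2
  simp only [mul_assoc] at hs ht hs1 ht2
  have hs' : ∀ y, s * (sinv s * (s * y)) = s * y := fun y => by
    rw [← mul_assoc (sinv s), ← mul_assoc s, hs1]
  have ht' : ∀ y, sinv t * (t * (sinv t * y)) = sinv t * y := fun y => by
    rw [← mul_assoc t, ← mul_assoc (sinv t), ht2]
  refine sinv_eq ⟨?_, ?_⟩
  · simp only [mul_assoc, key, hs', ht]
  · have key2 : sinv s * (s * (t * (sinv t * sinv s))) = t * (sinv t * sinv s) := by
      rw [← key, hs]
    simp only [mul_assoc, key2, ht']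

theorem sinv_idem {e : S} (he : IsIdempotentElem e) : sinv e = e :=
  sinv_eq ⟨by rw [he, he], by rw [he, he]⟩

theorem idem_conj {e : S} (he : IsIdempotentElem e) (s : S) :
    IsIdempotentElem (sinv s * e * s) := by
  show sinv s * e * s * (sinv s * e * s) = sinv s * e * s
  have h1 := idem_comm he (idem_mul_sinv s)
  calc sinv s * e * s * (sinv s * e * s) = sinv s * (e * (s * sinv s)) * e * s := by
        simp only [mul_assoc]
    _ = sinv s * (s * sinv s) * (e * e) * s := by rw [h1]; simp only [mul_assoc]
    _ = sinv s * e * s := by rw [sinv_mul_sinv, he.eq]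

/-- An idempotent may be moved from the right to the left. -/
theorem mul_idem_eq {e : S} (he : IsIdempotentElem e) (s : S) :
    s * e = s * e * sinv s * s := by
  have h1 := idem_comm he (idem_sinv_mul s)
  calc s * e = s * (sinv s * s) * e := by rw [mul_sinv_mul]
    _ = s * (e * (sinv s * s)) := by rw [h1]; simp only [mul_assoc]
    _ = _ := by simp only [mul_assoc]

theorem idem_mul_eq {e : S} (he : IsIdempotentElem e) (s : S) :
    e * s = s * (sinv s * e * s) := by
  have h1 := idem_comm he (idem_mul_sinv s)
  calc e * s = e * (s * sinv s) * s := by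
        rw [mul_assoc, mul_assoc, mul_sinv_mul]
    _ = _ := by rw [h1]; simp only [mul_assoc]

theorem natLE_refl (s : S) : NatLE s s := ⟨sinv s * s, idem_sinv_mul s, (mul_sinv_mul s).symm⟩

theorem NatLE.trans {s t r : S} (h1 : NatLE s t) (h2 : NatLE t r) : NatLE s r := by
  obtain ⟨e, he, rfl⟩ := h1
  obtain ⟨f, hf, rfl⟩ := h2
  exact ⟨f * e, idem_mul hf he, mul_assoc _ _ _⟩

theorem natLE_mul_idem {S : Type u} [Semigroup S] (s : S) {e : S} (he : IsIdempotentElem e) : NatLE (s * e) s := ⟨e, he, rfl⟩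

theorem natLE_idem_mul (s : S) {e : S} (he : IsIdempotentElem e) : NatLE (e * s) s :=
  ⟨sinv s * e * s, idem_conj he s, idem_mul_eq he s⟩

theorem NatLE.exists_left {s t : S} (h : NatLE s t) : ∃ e, IsIdempotentElem e ∧ s = e * t := by
  obtain ⟨e, he, rfl⟩ := h
  refine ⟨t * e * sinv t, ?_, mul_idem_eq he t⟩
  have := idem_conj he (sinv t)
  rwa [sinv_sinv] at this

theorem NatLE.mul {a b c d : S} (h1 : NatLE a b) (h2 : NatLE c d) : NatLE (a * c) (b * d) := by
  obtain ⟨e, he, rfl⟩ := h1.exists_left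
  obtain ⟨f, hf, rfl⟩ := h2
  have h3 : NatLE (e * (b * d) * f) (b * d) :=
    (natLE_mul_idem _ hf).trans (natLE_idem_mul _ he)
  simpa only [mul_assoc] using h3

theorem NatLE.eq_mul {c a : S} (h : NatLE c a) : a * (sinv c * c) = c := by
  obtain ⟨e, he, rfl⟩ := h
  have h1 := idem_comm (idem_sinv_mul a) he
  rw [sinv_mul, sinv_idem he]
  calc a * (e * sinv a * (a * e)) = a * (e * (sinv a * a) * e) := by simp only [mul_assoc]
    _ = a * (sinv a * a) * (e * e) := by rw [← h1]; simp only [mul_assoc]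
    _ = a * e := by rw [mul_sinv_mul, he.eq]

theorem NatLE.sinv {a b : S} (h : NatLE a b) : NatLE (sinv a) (sinv b) := by
  obtain ⟨e, he, rfl⟩ := h
  rw [sinv_mul, sinv_idem he]
  exact natLE_idem_mul _ he

end Facts


/-! ### Proper filters and the concrete Booleanization -/

section Filters

variable (S : Type u) [SemigroupWithZero S]

/-- A proper filter: a nonempty, upward closed, downward directed subset that omits `0`. -/
@[ext]
structure ProperFilter where
  carrier : Set S
  nonempty : carrier.Nonempty
  upward : ∀ a b : S, a ∈ carrier → NatLE a b → b ∈ carrier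
  directed : ∀ a b : S, a ∈ carrier → b ∈ carrier → ∃ c ∈ carrier, NatLE c a ∧ NatLE c b
  zero_notMem : (0 : S) ∉ carrier

variable {S}

namespace ProperFilter

/-- `d(A) = (A⁻¹A)↑`. -/
def dom (A : ProperFilter S) : Set S :=
  {s | ∃ x ∈ A.carrier, ∃ y ∈ A.carrier, NatLE (sinv x * y) s}

/-- `r(A) = (AA⁻¹)↑`. -/
def ran (A : ProperFilter S) : Set S :=
  {s | ∃ x ∈ A.carrier, ∃ y ∈ A.carrier, NatLE (x * sinv y) s}

/-- `(AB)↑`. -/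
def prod (A B : ProperFilter S) : Set S :=
  {s | ∃ x ∈ A.carrier, ∃ y ∈ B.carrier, NatLE (x * y) s}

/-- `C = A · B` in the groupoid of proper filters: the product `A · B` exists iff `d(A) = r(B)`,
and is then `(AB)↑`. -/
def IsProd (A B C : ProperFilter S) : Prop := A.dom = B.ran ∧ C.carrier = prod A B

end ProperFilter

/-- A partial bisection of the groupoid of proper filters: a set of proper filters on which `d` and
`r` are injective. -/
def IsPartialBisection (X : Set (ProperFilter S)) : Prop :=
  Set.InjOn ProperFilter.dom X ∧ Set.InjOn ProperFilter.ran X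

/-- The product of subsets of the groupoid of proper filters. -/
def setMul (X Y : Set (ProperFilter S)) : Set (ProperFilter S) :=
  {C | ∃ A ∈ X, ∃ B ∈ Y, ProperFilter.IsProd A B C}

/-- `U_{a; L}`: the set of proper filters that contain `a` and omit all elements of `L`. -/
def basic (a : S) (L : Set S) : Set (ProperFilter S) :=
  {A | a ∈ A.carrier ∧ ∀ b ∈ L, b ∉ A.carrier}

/-- The sets `U_{a; a₁, …, aₘ}` with `a₁, …, aₘ ≤ a`. -/
def IsBasic (U : Set (ProperFilter S)) : Prop :=
  ∃ (a : S) (L : Set S), L.Finite ∧ (∀ b ∈ L, NatLE b a) ∧ U = basic a L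

/-- `X` is the join of finitely many pairwise compatible sets `U_{a; a₁, …, aₘ}` in the inverse
semigroup of partial bisections.  The order on partial bisections is inclusion, and partial
bisections are pairwise compatible iff their union, which is then their join, is a partial
bisection. -/
def IsBooleanElement (X : Set (ProperFilter S)) : Prop :=
  IsPartialBisection X ∧
    ∃ F : Set (Set (ProperFilter S)), F.Finite ∧ (∀ U ∈ F, IsBasic U) ∧ X = ⋃₀ F

variable (S) in
/-- The underlying set of the Booleanization `B(S)` of `S`. -/
def Booleanization : Type u := {X : Set (ProperFilter S) // IsBooleanElement X}

theorem natLE_zero {a : S} (h : NatLE a 0) : a = 0 := by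
  obtain ⟨e, -, rfl⟩ := h
  exact zero_mul e

variable [IsInverseSemigroup S]

namespace ProperFilter

theorem mem_dom {A : ProperFilter S} {s : S} :
    s ∈ A.dom ↔ ∃ c ∈ A.carrier, NatLE (sinv c * c) s := by
  constructor
  · rintro ⟨x, hx, y, hy, h⟩
    obtain ⟨c, hc, h1, h2⟩ := A.directed x y hx hy
    exact ⟨c, hc, (h1.sinv.mul h2).trans h⟩
  · rintro ⟨c, hc, h⟩
    exact ⟨c, hc, c, hc, h⟩

theorem mem_ran {A : ProperFilter S} {s : S} :
    s ∈ A.ran ↔ ∃ c ∈ A.carrier, NatLE (c * sinv c) s := by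
  constructor
  · rintro ⟨x, hx, y, hy, h⟩
    obtain ⟨c, hc, h1, h2⟩ := A.directed x y hx hy
    exact ⟨c, hc, (h1.mul h2.sinv).trans h⟩
  · rintro ⟨c, hc, h⟩
    exact ⟨c, hc, c, hc, h⟩

theorem mul_mem_of_dom {A : ProperFilter S} {x e : S} (hx : x ∈ A.carrier) (he : e ∈ A.dom) :
    x * e ∈ A.carrier := by
  obtain ⟨c, hc, h⟩ := mem_dom.1 he
  obtain ⟨z, hz, h1, h2⟩ := A.directed x c hx hc
  refine A.upward z _ hz ?_
  have h3 : NatLE (z * (sinv z * z)) (x * e) := h1.mul ((h2.sinv.mul h2).trans h)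
  rwa [mul_sinv_mul] at h3

theorem mul_mem_of_ran {A : ProperFilter S} {x e : S} (hx : x ∈ A.carrier) (he : e ∈ A.ran) :
    e * x ∈ A.carrier := by
  obtain ⟨c, hc, h⟩ := mem_ran.1 he
  obtain ⟨z, hz, h1, h2⟩ := A.directed x c hx hc
  refine A.upward z _ hz ?_
  have h3 : NatLE (z * sinv z * z) (e * x) := ((h2.mul h2.sinv).trans h).mul h1
  rwa [mul_assoc, mul_sinv_mul] at h3

theorem sinv_mul_mem_dom {A : ProperFilter S} {x : S} (hx : x ∈ A.carrier) :
    sinv x * x ∈ A.dom := mem_dom.2 ⟨x, hx, natLE_refl _⟩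

theorem mul_sinv_mem_ran {A : ProperFilter S} {x : S} (hx : x ∈ A.carrier) :
    x * sinv x ∈ A.ran := mem_ran.2 ⟨x, hx, natLE_refl _⟩

/-- The product of two composable proper filters. -/
def gmul (A B : ProperFilter S) (h : A.dom = B.ran) : ProperFilter S where
  carrier := prod A B
  nonempty := by
    obtain ⟨x, hx⟩ := A.nonempty
    obtain ⟨y, hy⟩ := B.nonempty
    exact ⟨x * y, x, hx, y, hy, natLE_refl _⟩
  upward := by
    rintro a b ⟨x, hx, y, hy, h1⟩ h2
    exact ⟨x, hx, y, hy, h1.trans h2⟩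
  directed := by
    rintro a b ⟨x, hx, y, hy, h1⟩ ⟨x', hx', y', hy', h2⟩
    obtain ⟨z, hz, h3, h4⟩ := A.directed x x' hx hx'
    obtain ⟨w, hw, h5, h6⟩ := B.directed y y' hy hy'
    exact ⟨z * w, ⟨z, hz, w, hw, natLE_refl _⟩, (h3.mul h5).trans h1, (h4.mul h6).trans h2⟩
  zero_notMem := by
    rintro ⟨x, hx, y, hy, h1⟩
    have h2 := mul_mem_of_ran hy (h ▸ sinv_mul_mem_dom hx)
    rw [mul_assoc, natLE_zero h1, mul_zero] at h2
    exact B.zero_notMem h2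

theorem isProd_gmul (A B : ProperFilter S) (h : A.dom = B.ran) : IsProd A B (gmul A B h) :=
  ⟨h, rfl⟩

theorem IsProd.dom_eq {A B C : ProperFilter S} (h : IsProd A B C) : C.dom = B.dom := by
  obtain ⟨h, hC⟩ := h
  ext s
  rw [mem_dom, mem_dom]
  constructor
  · rintro ⟨c, hc, hs⟩
    rw [hC] at hc
    obtain ⟨x, hx, y, hy, hxy⟩ := hc
    refine ⟨_, mul_mem_of_ran hy (h ▸ sinv_mul_mem_dom hx), ?_⟩
    refine NatLE.trans ?_ ((hxy.sinv.mul hxy).trans hs)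
    have e : sinv (sinv x * x * y) * (sinv x * x * y) = sinv (x * y) * (x * y) := by
      rw [sinv_mul (sinv x * x) y, sinv_mul x y, sinv_idem (idem_sinv_mul x)]
      calc sinv y * (sinv x * x) * (sinv x * x * y)
          = sinv y * ((sinv x * x) * (sinv x * x)) * y := by simp only [mul_assoc]
        _ = _ := by rw [(idem_sinv_mul x).eq]; simp only [mul_assoc]
    rw [e]
    exact natLE_refl _
  · rintro ⟨y, hy, hs⟩
    obtain ⟨x, hx⟩ := A.nonempty
    refine ⟨x * y, by rw [hC]; exact ⟨x, hx, y, hy, natLE_refl _⟩, NatLE.trans ?_ hs⟩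
    have e : sinv (x * y) * (x * y) = sinv y * ((sinv x * x) * y) := by
      rw [sinv_mul]; simp only [mul_assoc]
    rw [e]
    exact (natLE_refl _).mul (natLE_idem_mul y (idem_sinv_mul x))

theorem IsProd.ran_eq {A B C : ProperFilter S} (h : IsProd A B C) : C.ran = A.ran := by
  obtain ⟨h, hC⟩ := h
  ext s
  rw [mem_ran, mem_ran]
  constructor
  · rintro ⟨c, hc, hs⟩
    rw [hC] at hc
    obtain ⟨x, hx, y, hy, hxy⟩ := hc
    refine ⟨_, mul_mem_of_dom hx (h.symm ▸ mul_sinv_mem_ran hy), ?_⟩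
    refine NatLE.trans ?_ ((hxy.mul hxy.sinv).trans hs)
    have e : x * (y * sinv y) * sinv (x * (y * sinv y)) = x * y * sinv (x * y) := by
      rw [sinv_mul, sinv_mul x y, sinv_idem (idem_mul_sinv y)]
      calc x * (y * sinv y) * (y * sinv y * sinv x)
          = x * ((y * sinv y) * (y * sinv y)) * sinv x := by simp only [mul_assoc]
        _ = _ := by rw [(idem_mul_sinv y).eq]; simp only [mul_assoc]
    rw [e]
    exact natLE_refl _
  · rintro ⟨x, hx, hs⟩
    obtain ⟨y, hy⟩ := B.nonempty
    refine ⟨x * y, by rw [hC]; exact ⟨x, hx, y, hy, natLE_refl _⟩, NatLE.trans ?_ hs⟩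
    have e : x * y * sinv (x * y) = (x * (y * sinv y)) * sinv x := by
      rw [sinv_mul]; simp only [mul_assoc]
    rw [e]
    exact (natLE_mul_idem x (idem_mul_sinv y)).mul (natLE_refl _)

theorem mem_left_of_mul_mem {A B : ProperFilter S} (h : A.dom = B.ran) {b f : S}
    (hb : b ∈ B.carrier) (hf : f * b ∈ prod A B) : f ∈ A.carrier := by
  obtain ⟨x, hx, y, hy, hxy⟩ := hf
  obtain ⟨z, hz, h1, h2⟩ := B.directed y b hy hb
  have h3 := mul_mem_of_dom hx (h.symm ▸ mul_sinv_mem_ran hz)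
  refine A.upward _ _ h3 ?_
  have h4 : NatLE (x * z * sinv z) (f * b * sinv b) :=
    (((natLE_refl x).mul h1).trans hxy).mul h2.sinv
  rw [mul_assoc, mul_assoc] at h4
  exact h4.trans (natLE_mul_idem f (idem_mul_sinv b))

theorem mem_right_of_mul_mem {A B : ProperFilter S} (h : A.dom = B.ran) {a g : S}
    (ha : a ∈ A.carrier) (hg : a * g ∈ prod A B) : g ∈ B.carrier := by
  obtain ⟨x, hx, y, hy, hxy⟩ := hg
  obtain ⟨z, hz, h1, h2⟩ := A.directed x a hx ha
  have h3 := mul_mem_of_ran hy (h ▸ sinv_mul_mem_dom hz)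
  refine B.upward _ _ h3 ?_
  have h4 : NatLE (sinv z * (z * y)) (sinv a * (a * g)) :=
    h2.sinv.mul ((h1.mul (natLE_refl y)).trans hxy)
  rw [← mul_assoc, ← mul_assoc] at h4
  exact h4.trans (natLE_idem_mul g (idem_sinv_mul a))

end ProperFilter

open ProperFilter

theorem setMul_assoc (X Y Z : Set (ProperFilter S)) :
    setMul (setMul X Y) Z = setMul X (setMul Y Z) := by
  ext D
  constructor
  · rintro ⟨C, ⟨A, hA, B, hB, hC⟩, E, hE, hD⟩
    have h1 : B.dom = E.ran := hC.dom_eq.symm.trans hD.1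
    have h2 := isProd_gmul B E h1
    refine ⟨A, hA, gmul B E h1, ⟨B, hB, E, hE, h2⟩, hC.1.trans h2.ran_eq.symm, ?_⟩
    rw [hD.2]
    ext s
    constructor
    · rintro ⟨c, hc, z, hz, h⟩
      rw [hC.2] at hc
      obtain ⟨x, hx, y, hy, hxy⟩ := hc
      refine ⟨x, hx, y * z, ⟨y, hy, z, hz, natLE_refl _⟩, ?_⟩
      rw [← mul_assoc]
      exact (hxy.mul (natLE_refl z)).trans h
    · rintro ⟨x, hx, c, ⟨y, hy, z, hz, hyz⟩, h⟩
      refine ⟨x * y, ?_, z, hz, ?_⟩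
      · rw [hC.2]; exact ⟨x, hx, y, hy, natLE_refl _⟩
      · rw [mul_assoc]
        exact ((natLE_refl x).mul hyz).trans h
  · rintro ⟨A, hA, C, ⟨B, hB, E, hE, hC⟩, hD⟩
    have h1 : A.dom = B.ran := hD.1.trans hC.ran_eq
    have h2 := isProd_gmul A B h1
    refine ⟨gmul A B h1, ⟨A, hA, B, hB, h2⟩, E, hE, h2.dom_eq.trans hC.1, ?_⟩
    rw [hD.2]
    ext s
    constructor
    · rintro ⟨x, hx, c, hc, h⟩
      rw [hC.2] at hc
      obtain ⟨y, hy, z, hz, hyz⟩ := hc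
      refine ⟨x * y, ⟨x, hx, y, hy, natLE_refl _⟩, z, hz, ?_⟩
      rw [mul_assoc]
      exact ((natLE_refl x).mul hyz).trans h
    · rintro ⟨c, ⟨x, hx, y, hy, hxy⟩, z, hz, h⟩
      refine ⟨x, hx, y * z, ?_, ?_⟩
      · rw [hC.2]; exact ⟨y, hy, z, hz, natLE_refl _⟩
      · rw [← mul_assoc]
        exact (hxy.mul (natLE_refl z)).trans h

theorem IsPartialBisection.setMul {X Y : Set (ProperFilter S)} (hX : IsPartialBisection X)
    (hY : IsPartialBisection Y) : IsPartialBisection (setMul X Y) := by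
  have key : ∀ {A A' B B' C C' : ProperFilter S}, IsProd A B C → IsProd A' B' C' →
      A = A' → B = B' → C = C' := by
    rintro A A' B B' C C' h h' rfl rfl
    exact ProperFilter.ext (h.2.trans h'.2.symm)
  constructor
  · rintro C ⟨A, hA, B, hB, h⟩ C' ⟨A', hA', B', hB', h'⟩ hCC
    have h1 : B = B' := hY.1 hB hB' (h.dom_eq.symm.trans (hCC.trans h'.dom_eq))
    have h2 : A = A' := hX.1 hA hA' (by rw [h.1, h'.1, h1])
    exact key h h' h2 h1
  · rintro C ⟨A, hA, B, hB, h⟩ C' ⟨A', hA', B', hB', h'⟩ hCC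
    have h1 : A = A' := hX.2 hA hA' (h.ran_eq.symm.trans (hCC.trans h'.ran_eq))
    have h2 : B = B' := hY.2 hB hB' (by rw [← h.1, ← h'.1, h1])
    exact key h h' h1 h2

theorem isPartialBisection_basic (a : S) (L : Set S) : IsPartialBisection (basic a L) := by
  have key : ∀ A B : ProperFilter S, a ∈ A.carrier → a ∈ B.carrier → A.dom = B.dom →
      A.carrier ⊆ B.carrier := by
    intro A B hA hB h s hs
    obtain ⟨c, hc, h1, h2⟩ := A.directed s a hs hA
    have h3 := mul_mem_of_dom hB (h ▸ sinv_mul_mem_dom hc)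
    rw [h2.eq_mul] at h3
    exact B.upward _ _ h3 h1
  have key' : ∀ A B : ProperFilter S, a ∈ A.carrier → a ∈ B.carrier → A.ran = B.ran →
      A.carrier ⊆ B.carrier := by
    intro A B hA hB h s hs
    obtain ⟨c, hc, h1, h2⟩ := A.directed s a hs hA
    have h3 := mul_mem_of_ran hB (h ▸ mul_sinv_mem_ran hc)
    have h4 : NatLE (c * sinv c * a) c := by
      obtain ⟨e, he, rfl⟩ := h2
      rw [sinv_mul, sinv_idem he]
      refine ⟨sinv a * a, idem_sinv_mul a, ?_⟩
      calc a * e * (e * sinv a) * a = a * (e * e) * (sinv a * a) := by simp only [mul_assoc]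
        _ = _ := by rw [he.eq]
    exact B.upward _ _ (B.upward _ _ h3 h4) h1
  constructor
  · rintro A hA B hB h
    exact ProperFilter.ext (Set.Subset.antisymm (key A B hA.1 hB.1 h) (key B A hB.1 hA.1 h.symm))
  · rintro A hA B hB h
    exact ProperFilter.ext (Set.Subset.antisymm (key' A B hA.1 hB.1 h) (key' B A hB.1 hA.1 h.symm))

/-- Any proper filter containing `a * b` is a product of one containing `a` and one
containing `b`. -/
theorem exists_isProd {C : ProperFilter S} {a b : S} (hC : a * b ∈ C.carrier) :
    ∃ A B : ProperFilter S, a ∈ A.carrier ∧ b ∈ B.carrier ∧ IsProd A B C := by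
  have low : ∀ c ∈ C.carrier, ∃ z ∈ C.carrier, NatLE z c ∧ NatLE (sinv z * z) (sinv b * b) := by
    intro c hc
    obtain ⟨z, hz, h1, h2⟩ := C.directed c (a * b) hc hC
    refine ⟨z, hz, h1, (h2.sinv.mul h2).trans ?_⟩
    have e : sinv (a * b) * (a * b) = sinv b * ((sinv a * a) * b) := by
      rw [sinv_mul]; simp only [mul_assoc]
    rw [e]
    exact (natLE_refl _).mul (natLE_idem_mul b (idem_sinv_mul a))
  have mono : ∀ {z c : S}, NatLE z c → NatLE (sinv z * z) (sinv c * c) :=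
    fun h => h.sinv.mul h
  let B : ProperFilter S :=
    { carrier := {s | ∃ c ∈ C.carrier, NatLE (b * (sinv c * c)) s}
      nonempty := ⟨_, _, hC, natLE_refl _⟩
      upward := by
        rintro s t ⟨c, hc, h⟩ h'
        exact ⟨c, hc, h.trans h'⟩
      directed := by
        rintro s t ⟨c, hc, h⟩ ⟨c', hc', h'⟩
        obtain ⟨z, hz, h1, h2⟩ := C.directed c c' hc hc'
        exact ⟨_, ⟨z, hz, natLE_refl _⟩, ((natLE_refl b).mul (mono h1)).trans h,
          ((natLE_refl b).mul (mono h2)).trans h'⟩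
      zero_notMem := by
        rintro ⟨c, hc, h⟩
        have h1 := mul_mem_of_dom hC (sinv_mul_mem_dom hc)
        rw [mul_assoc, natLE_zero h, mul_zero] at h1
        exact C.zero_notMem h1 }
  let A : ProperFilter S :=
    { carrier := {s | ∃ c ∈ C.carrier, NatLE (c * sinv b) s}
      nonempty := ⟨_, _, hC, natLE_refl _⟩
      upward := by
        rintro s t ⟨c, hc, h⟩ h'
        exact ⟨c, hc, h.trans h'⟩
      directed := by
        rintro s t ⟨c, hc, h⟩ ⟨c', hc', h'⟩
        obtain ⟨z, hz, h1, h2⟩ := C.directed c c' hc hc'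
        exact ⟨_, ⟨z, hz, natLE_refl _⟩, (h1.mul (natLE_refl _)).trans h,
          (h2.mul (natLE_refl _)).trans h'⟩
      zero_notMem := by
        rintro ⟨c, hc, h⟩
        obtain ⟨z, hz, h1, h2⟩ := low c hc
        have h3 : NatLE (z * (sinv z * z)) (c * (sinv b * b)) := h1.mul h2
        rw [mul_sinv_mul, ← mul_assoc, natLE_zero h, zero_mul] at h3
        rw [natLE_zero h3] at hz
        exact C.zero_notMem hz }
  have hdom : ∀ s, s ∈ A.dom ↔ ∃ c ∈ C.carrier, NatLE (b * (sinv c * c) * sinv b) s := by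
    have e : ∀ c : S, sinv (c * sinv b) * (c * sinv b) = b * (sinv c * c) * sinv b := by
      intro c
      rw [sinv_mul, sinv_sinv]; simp only [mul_assoc]
    intro s
    rw [mem_dom]
    constructor
    · rintro ⟨x, ⟨c, hc, h⟩, hs⟩
      exact ⟨c, hc, e c ▸ (mono h).trans hs⟩
    · rintro ⟨c, hc, hs⟩
      exact ⟨c * sinv b, ⟨c, hc, natLE_refl _⟩, (e c).symm ▸ hs⟩
  have hran : ∀ s, s ∈ B.ran ↔ ∃ c ∈ C.carrier, NatLE (b * (sinv c * c) * sinv b) s := by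
    have e : ∀ c : S, b * (sinv c * c) * sinv (b * (sinv c * c)) = b * (sinv c * c) * sinv b := by
      intro c
      rw [sinv_mul, sinv_idem (idem_sinv_mul c)]
      calc b * (sinv c * c) * (sinv c * c * sinv b)
          = b * ((sinv c * c) * (sinv c * c)) * sinv b := by simp only [mul_assoc]
        _ = _ := by rw [(idem_sinv_mul c).eq]
    intro s
    rw [mem_ran]
    constructor
    · rintro ⟨x, ⟨c, hc, h⟩, hs⟩
      exact ⟨c, hc, e c ▸ (h.mul h.sinv).trans hs⟩
    · rintro ⟨c, hc, hs⟩
      exact ⟨b * (sinv c * c), ⟨c, hc, natLE_refl _⟩, (e c).symm ▸ hs⟩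
  refine ⟨A, B, ⟨a * b, hC, ?_⟩, ⟨a * b, hC, natLE_mul_idem b (idem_sinv_mul _)⟩, ?_, ?_⟩
  · rw [mul_assoc]
    exact natLE_mul_idem a (idem_mul_sinv b)
  · ext s
    rw [hdom, hran]
  · ext s
    constructor
    · intro hs
      refine ⟨s * sinv b, ⟨s, hs, natLE_refl _⟩, b * (sinv s * s), ⟨s, hs, natLE_refl _⟩, ?_⟩
      refine ⟨sinv b * b * (sinv s * s), idem_mul (idem_sinv_mul b) (idem_sinv_mul s), ?_⟩
      simp only [mul_assoc]
    · rintro ⟨x, ⟨c, hc, h⟩, y, ⟨c', hc', h'⟩, hs⟩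
      obtain ⟨z, hz, h1, h2⟩ := low c hc
      have h3 : sinv b * b ∈ C.dom := mem_dom.2 ⟨z, hz, h2⟩
      have h4 := mul_mem_of_dom (mul_mem_of_dom hc h3) (sinv_mul_mem_dom hc')
      refine C.upward _ _ h4 (NatLE.trans ?_ hs)
      have h5 := h.mul h'
      rwa [show c * sinv b * (b * (sinv c' * c')) = c * (sinv b * b) * (sinv c' * c') by
        simp only [mul_assoc]] at h5

theorem setMul_basic (a b : S) (L M : Set S) :
    setMul (basic a L) (basic b M) =
      basic (a * b) ((fun f => f * b) '' L ∪ (fun g => a * g) '' M) := by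
  ext C
  constructor
  · rintro ⟨A, ⟨hA, hL⟩, B, ⟨hB, hM⟩, h, hC⟩
    refine ⟨by rw [hC]; exact ⟨a, hA, b, hB, natLE_refl _⟩, ?_⟩
    rintro _ (⟨f, hf, rfl⟩ | ⟨g, hg, rfl⟩) hmem
    · rw [hC] at hmem
      exact hL f hf (mem_left_of_mul_mem h hB hmem)
    · rw [hC] at hmem
      exact hM g hg (mem_right_of_mul_mem h hA hmem)
  · rintro ⟨hC, hLM⟩
    obtain ⟨A, B, hA, hB, h, hAB⟩ := exists_isProd hC
    refine ⟨A, ⟨hA, fun f hf hfA => ?_⟩, B, ⟨hB, fun g hg hgB => ?_⟩, h, hAB⟩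
    · refine hLM (f * b) (Or.inl ⟨f, hf, rfl⟩) ?_
      rw [hAB]
      exact ⟨f, hfA, b, hB, natLE_refl _⟩
    · refine hLM (a * g) (Or.inr ⟨g, hg, rfl⟩) ?_
      rw [hAB]
      exact ⟨a, hA, g, hgB, natLE_refl _⟩

theorem IsBasic.setMul {U V : Set (ProperFilter S)} (hU : IsBasic U) (hV : IsBasic V) :
    IsBasic (setMul U V) := by
  obtain ⟨a, L, hL, hLa, rfl⟩ := hU
  obtain ⟨b, M, hM, hMb, rfl⟩ := hV
  refine ⟨_, _, (hL.image _).union (hM.image _), ?_, setMul_basic a b L M⟩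
  rintro _ (⟨f, hf, rfl⟩ | ⟨g, hg, rfl⟩)
  · exact (hLa f hf).mul (natLE_refl b)
  · exact (natLE_refl a).mul (hMb g hg)

theorem IsBooleanElement.setMul {X Y : Set (ProperFilter S)} (hX : IsBooleanElement X)
    (hY : IsBooleanElement Y) : IsBooleanElement (setMul X Y) := by
  obtain ⟨pX, F, hF, bF, rfl⟩ := hX
  obtain ⟨pY, G, hG, bG, rfl⟩ := hY
  refine ⟨pX.setMul pY, Set.image2 InvSemigroup.setMul F G, hF.image2 _ hG, ?_, ?_⟩
  · rintro _ ⟨U, hU, V, hV, rfl⟩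
    exact (bF U hU).setMul (bG V hV)
  · ext C
    constructor
    · rintro ⟨A, ⟨U, hU, hA⟩, B, ⟨V, hV, hB⟩, h⟩
      exact ⟨_, ⟨U, hU, V, hV, rfl⟩, A, hA, B, hB, h⟩
    · rintro ⟨_, ⟨U, hU, V, hV, rfl⟩, A, hA, B, hB, h⟩
      exact ⟨A, ⟨U, hU, hA⟩, B, ⟨V, hV, hB⟩, h⟩

theorem isBooleanElement_empty {S : Type u} [SemigroupWithZero S] :
    IsBooleanElement (∅ : Set (ProperFilter S)) :=
  ⟨⟨Set.injOn_empty _, Set.injOn_empty _⟩, ∅, Set.finite_empty, by simp, by simp⟩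

theorem isBooleanElement_basic (a : S) : IsBooleanElement (basic a (∅ : Set S)) :=
  ⟨isPartialBisection_basic a ∅, {basic a ∅}, Set.finite_singleton _,
    by rintro _ rfl; exact ⟨a, ∅, Set.finite_empty, by simp, rfl⟩, by simp⟩

/-- `B(S)` is a semigroup with zero `∅` under multiplication of subsets of the groupoid of proper
filters. -/
instance : SemigroupWithZero (Booleanization S) where
  mul X Y := ⟨setMul X.1 Y.1, X.2.setMul Y.2⟩
  mul_assoc X Y Z := Subtype.ext (setMul_assoc X.1 Y.1 Z.1)
  zero := ⟨∅, isBooleanElement_empty⟩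
  zero_mul X := Subtype.ext (by
    ext C
    constructor
    · rintro ⟨A, hA, -⟩
      exact hA.elim
    · intro h
      exact h.elim)
  mul_zero X := Subtype.ext (by
    ext C
    constructor
    · rintro ⟨A, -, B, hB, -⟩
      exact hB.elim
    · intro h
      exact h.elim)

variable (S) in
/-- The canonical map `S → B(S)`, `a ↦ U_a`. -/
def toBooleanization : S →ₙ* Booleanization S where
  toFun a := ⟨basic a ∅, isBooleanElement_basic a⟩
  map_mul' a b := Subtype.ext (by
    show basic (a * b) ∅ = setMul (basic a ∅) (basic b ∅)
    rw [setMul_basic]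
    simp)

end Filters

/-! ### The Booleanization inside a ring -/

section Ring

theorem isInverseSemigroup_of_comm {M : Type u} [Semigroup M]
    (h1 : ∀ s : M, ∃ t, IsInverseOf s t)
    (h2 : ∀ e f : M, IsIdempotentElem e → IsIdempotentElem f → e * f = f * e) :
    IsInverseSemigroup M where
  existsUnique_inverse s := by
    obtain ⟨t, ht⟩ := h1 s
    refine ⟨t, ht, fun u hu => ?_⟩
    exact inverse_unique_of_comm hu ht (h2 _ _ hu.idem_left ht.idem_left)
      (h2 _ _ hu.idem_right ht.idem_right)

/-- The image of an inverse semigroup under a homomorphism is an inverse semigroup. -/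
instance isInverseSemigroup_srange {S : Type u} {R : Type v} [Semigroup S] [IsInverseSemigroup S]
    [Semigroup R] (θ : S →ₙ* R) : IsInverseSemigroup θ.srange := by
  have lift : ∀ x : θ.srange, IsIdempotentElem x →
      ∃ e : S, IsIdempotentElem e ∧ θ e = (x : R) := by
    rintro ⟨_, s, rfl⟩ hx
    have hx' : θ s * θ s = θ s := congrArg Subtype.val hx
    obtain ⟨h1, h2⟩ := isInverseOf_sinv (s * s)
    generalize sinv (s * s) = t at h1 h2
    refine ⟨s * t * s, ?_, ?_⟩
    · show s * t * s * (s * t * s) = s * t * s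
      calc s * t * s * (s * t * s) = s * (t * (s * s) * t) * s := by simp only [mul_assoc]
        _ = s * t * s := by rw [h2]
    · have h3 := congrArg θ h1
      simp only [map_mul] at h3 ⊢
      rw [hx'] at h3
      exact h3
  refine isInverseSemigroup_of_comm ?_ ?_
  · rintro ⟨_, s, rfl⟩
    obtain ⟨h1, h2⟩ := isInverseOf_sinv s
    refine ⟨⟨θ (sinv s), sinv s, rfl⟩, Subtype.ext ?_, Subtype.ext ?_⟩
    · show θ s * θ (sinv s) * θ s = θ s
      rw [← map_mul, ← map_mul, h1]
    · show θ (sinv s) * θ s * θ (sinv s) = θ (sinv s)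
      rw [← map_mul, ← map_mul, h2]
  · intro x y hx hy
    obtain ⟨e, he, hex⟩ := lift x hx
    obtain ⟨f, hf, hfy⟩ := lift y hy
    refine Subtype.ext ?_
    show (x : R) * y = y * x
    rw [← hex, ← hfy, ← map_mul, ← map_mul, idem_comm he hf]

variable {R : Type v} [NonUnitalRing R]

/-- The set `E'` of all elements `e (1 - e₁) ⋯ (1 - eₙ)` of the ring `R`, where `n ≥ 0` and
`e, e₁, …, eₙ` are idempotents of `S₀`; here `x (1 - f)` means `x - x * f`, so that `R` need not
have an identity. -/
inductive IsCutIdem (S₀ : Set R) : R → Prop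
  | base (e : R) : e ∈ S₀ → IsIdempotentElem e → IsCutIdem S₀ e
  | cut (x f : R) : IsCutIdem S₀ x → f ∈ S₀ → IsIdempotentElem f → IsCutIdem S₀ (x - x * f)

/-- The set `S' = S₀ E'`. -/
def cutSet (S₀ : Set R) : Set R := {x | ∃ s ∈ S₀, ∃ e, IsCutIdem S₀ e ∧ x = s * e}

/-- The orthogonality relation `a ⊥ b`, that is `a⁻¹ b = 0 = a b⁻¹`, in an inverse
subsemigroup `M` of the multiplicative semigroup of `R`. -/
def OrthIn (M : Set R) (a b : R) : Prop :=
  ∃ a' ∈ M, ∃ b' ∈ M, IsInverseOf a a' ∧ IsInverseOf b b' ∧ a' * b = 0 ∧ a * b' = 0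

/-- The set of all finite sums of pairwise orthogonal elements of `M`. -/
def orthSums (M : Set R) : Set R :=
  {x | ∃ (n : ℕ) (a : Fin n → R), (∀ i, a i ∈ M) ∧ (∀ i j, i ≠ j → OrthIn M (a i) (a j)) ∧
    x = ∑ i, a i}

/-- Inverse subsemigroups of `R`, described through commuting idempotents. -/
structure InvClosed (M : Set R) : Prop where
  mul_mem : ∀ {a b : R}, a ∈ M → b ∈ M → a * b ∈ M
  exists_inv : ∀ a ∈ M, ∃ a' ∈ M, IsInverseOf a a'
  comm : ∀ e ∈ M, ∀ f ∈ M, IsIdempotentElem e → IsIdempotentElem f → e * f = f * e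

theorem invClosed_coe (S₀ : Subsemigroup R) [IsInverseSemigroup S₀] : InvClosed (S₀ : Set R) where
  mul_mem := S₀.mul_mem
  exists_inv a ha := by
    obtain ⟨h1, h2⟩ := isInverseOf_sinv (⟨a, ha⟩ : S₀)
    exact ⟨_, (sinv (⟨a, ha⟩ : S₀)).2, congrArg Subtype.val h1, congrArg Subtype.val h2⟩
  comm e he f hf h1 h2 :=
    congrArg Subtype.val (idem_comm (S := S₀) (e := ⟨e, he⟩) (f := ⟨f, hf⟩)
      (Subtype.ext h1) (Subtype.ext h2))

section Cut

variable {S₀ : Set R}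

theorem IsCutIdem.comm_idem (hS : InvClosed S₀) {x f : R} (hx : IsCutIdem S₀ x) (hf : f ∈ S₀)
    (hff : IsIdempotentElem f) : x * f = f * x := by
  induction hx with
  | base e he hee => exact hS.comm e he f hf hee hff
  | cut x g hx hg hgg ih =>
    rw [sub_mul, mul_sub, mul_assoc, hS.comm g hg f hf hgg hff, ← mul_assoc, ih, mul_assoc]

theorem IsCutIdem.comm (hS : InvClosed S₀) {x y : R} (hx : IsCutIdem S₀ x) (hy : IsCutIdem S₀ y) :
    x * y = y * x := by
  induction hy with
  | base e he hee => exact hx.comm_idem hS he hee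
  | cut y g hy hg hgg ih =>
    rw [sub_mul, mul_sub, ← mul_assoc, ih, mul_assoc, hx.comm_idem hS hg hgg, ← mul_assoc]

theorem IsCutIdem.idem (hS : InvClosed S₀) {x : R} (hx : IsCutIdem S₀ x) : IsIdempotentElem x := by
  induction hx with
  | base e he hee => exact hee
  | cut x g hx hg hgg ih =>
    show (x - x * g) * (x - x * g) = x - x * g
    have h1 : x * g * x = x * g := by
      rw [mul_assoc, ← hx.comm_idem hS hg hgg, ← mul_assoc, ih.eq]
    have h2 : x * g * (x * g) = x * g := by
      rw [← mul_assoc, h1, mul_assoc, hgg.eq]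
    have h3 : x * (x * g) = x * g := by rw [← mul_assoc, ih.eq]
    rw [mul_sub, sub_mul, sub_mul, h1, h2, h3, ih.eq]
    abel

theorem IsCutIdem.mul (hS : InvClosed S₀) {x y : R} (hx : IsCutIdem S₀ x) (hy : IsCutIdem S₀ y) :
    IsCutIdem S₀ (x * y) := by
  induction hy with
  | base e he hee =>
    induction hx with
    | base d hd hdd =>
      refine .base _ (hS.mul_mem hd he) ?_
      show d * e * (d * e) = d * e
      have := hS.comm e he d hd hee hdd
      calc d * e * (d * e) = d * (e * d) * e := by simp only [mul_assoc]
        _ = (d * d) * (e * e) := by rw [this]; simp only [mul_assoc]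
        _ = d * e := by rw [hdd.eq, hee.eq]
    | cut x g hx hg hgg ih =>
      have h1 : (x - x * g) * e = x * e - x * e * g := by
        rw [sub_mul, mul_assoc, mul_assoc, hS.comm g hg e he hgg hee]
      rw [h1]
      exact .cut _ _ ih hg hgg
  | cut y g hy hg hgg ih =>
    rw [mul_sub, ← mul_assoc]
    exact .cut _ _ ih hg hgg

theorem InvClosed.conj_idem (hS : InvClosed S₀) {s s' e : R} (hs : s ∈ S₀) (hs' : s' ∈ S₀) (h : IsInverseOf s s')
    (he : e ∈ S₀) (hee : IsIdempotentElem e) :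
    s' * e * s ∈ S₀ ∧ IsIdempotentElem (s' * e * s) := by
  refine ⟨hS.mul_mem (hS.mul_mem hs' he) hs, ?_⟩
  have h1 := hS.comm e he (s * s') (hS.mul_mem hs hs') hee h.idem_right
  show s' * e * s * (s' * e * s) = s' * e * s
  calc s' * e * s * (s' * e * s) = s' * (e * (s * s')) * e * s := by simp only [mul_assoc]
    _ = (s' * s * s') * (e * e) * s := by rw [h1]; simp only [mul_assoc]
    _ = s' * e * s := by rw [h.2, hee.eq]

theorem IsCutIdem.mul_eq (hS : InvClosed S₀) {x s s' : R} (hx : IsCutIdem S₀ x) (hs : s ∈ S₀) (hs' : s' ∈ S₀)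
    (h : IsInverseOf s s') : x * s = s * (s' * x * s) := by
  have h1 := hx.comm_idem hS (hS.mul_mem hs hs') h.idem_right
  calc x * s = x * (s * s') * s := by rw [mul_assoc, h.1]
    _ = _ := by rw [h1]; simp only [mul_assoc]

theorem IsCutIdem.conj (hS : InvClosed S₀) {x s s' : R} (hx : IsCutIdem S₀ x) (hs : s ∈ S₀) (hs' : s' ∈ S₀)
    (h : IsInverseOf s s') : IsCutIdem S₀ (s' * x * s) := by
  induction hx with
  | base e he hee =>
    obtain ⟨h1, h2⟩ := hS.conj_idem hs hs' h he hee
    exact .base _ h1 h2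
  | cut x g hx hg hgg ih =>
    obtain ⟨h1, h2⟩ := hS.conj_idem hs hs' h hg hgg
    have h3 : s' * (x - x * g) * s = s' * x * s - s' * x * s * (s' * g * s) := by
      have h4 := (IsCutIdem.base g hg hgg).mul_eq hS hs hs' h
      rw [mul_sub, sub_mul]
      congr 1
      calc s' * (x * g) * s = s' * x * (g * s) := by simp only [mul_assoc]
        _ = _ := by rw [h4]; simp only [mul_assoc]
    rw [h3]
    exact .cut _ _ ih h1 h2

/-- Every element of `S'` can be written as `s * x` with `s⁻¹ s x = x`. -/
theorem exists_of_mem_cutSet (hS : InvClosed S₀) {a : R} (ha : a ∈ cutSet S₀) :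
    ∃ s ∈ S₀, ∃ s' ∈ S₀, ∃ x, IsInverseOf s s' ∧ IsCutIdem S₀ x ∧ s' * s * x = x ∧ a = s * x := by
  obtain ⟨s, hs, x, hx, rfl⟩ := ha
  obtain ⟨s', hs', h⟩ := hS.exists_inv s hs
  refine ⟨s, hs, s', hs', s' * s * x, h,
    (IsCutIdem.base _ (hS.mul_mem hs' hs) h.idem_left).mul hS hx, ?_, ?_⟩
  · rw [← mul_assoc, h.idem_left.eq]
  · rw [← mul_assoc, ← mul_assoc, h.1]

theorem isCutIdem_of_idem (hS : InvClosed S₀) {a : R} (ha : a ∈ cutSet S₀) (haa : IsIdempotentElem a) :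
    IsCutIdem S₀ a := by
  obtain ⟨s, hs, s', hs', x, h, hx, hsx, rfl⟩ := exists_of_mem_cutSet hS ha
  have xx : x * x = x := (hx.idem hS).eq
  have haa : s * x * (s * x) = s * x := haa
  have h1 : x * (s * x) = x := by
    have := congrArg (fun y => s' * y) haa
    simp only [← mul_assoc] at this
    rw [hsx] at this
    simpa only [mul_assoc] using this
  have hz : IsCutIdem S₀ (s' * x * s) := hx.conj hS hs hs' h
  have hg : IsCutIdem S₀ (s * x * s') := hx.conj hS hs' hs h.symm
  have hxs := hx.mul_eq hS hs hs' h
  have zx : s' * x * s * x = s' * x := by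
    calc s' * x * s * x = s' * (x * (s * x)) := by simp only [mul_assoc]
      _ = s' * x := by rw [h1]
  have ssx : s * (s' * x) = x := by
    calc s * (s' * x) = s * (s' * x * s * x) := by rw [zx]
      _ = s * (s' * x * s) * x := by simp only [mul_assoc]
      _ = x * s * x := by rw [← hxs]
      _ = x := by rw [mul_assoc, h1]
  have xz : x * (s' * x) = s' * x := by
    calc x * (s' * x) = x * (s' * x * s * x) := by rw [zx]
      _ = x * (s' * x * s) * x := by simp only [mul_assoc]
      _ = s' * x * s * x * x := by rw [hx.comm hS hz]
      _ = s' * x * s * (x * x) := by simp only [mul_assoc]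
      _ = s' * x := by rw [xx, zx]
  have gx : s * x * s' * x = x := by
    calc s * x * s' * x = s * (x * (s' * x)) := by simp only [mul_assoc]
      _ = x := by rw [xz, ssx]
  have xs' : x * s' = x := by
    calc x * s' = x * (s * x) * s' := by rw [h1]
      _ = x * (s * x * s') := by simp only [mul_assoc]
      _ = s * x * s' * x := hx.comm hS hg
      _ = x := gx
  have e1 : s' * x = x := by
    rw [← xz, ← mul_assoc, xs', xx]
  have e2 : s * x = x := by
    conv_lhs => rw [← e1]
    exact ssx
  rw [e2]
  exact hx

theorem invClosed_cutSet (hS : InvClosed S₀) : InvClosed (cutSet S₀) where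
  mul_mem := by
    rintro _ _ ⟨s, hs, x, hx, rfl⟩ ⟨t, ht, y, hy, rfl⟩
    obtain ⟨t', ht', h⟩ := hS.exists_inv t ht
    refine ⟨s * t, hS.mul_mem hs ht, _, (hx.conj hS ht ht' h).mul hS hy, ?_⟩
    calc s * x * (t * y) = s * (x * t) * y := by simp only [mul_assoc]
      _ = s * (t * (t' * x * t)) * y := by rw [← hx.mul_eq hS ht ht' h]
      _ = _ := by simp only [mul_assoc]
  exists_inv a ha := by
    obtain ⟨s, hs, s', hs', x, h, hx, hsx, rfl⟩ := exists_of_mem_cutSet hS ha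
    have xx : x * x = x := (hx.idem hS).eq
    have h1 := hx.comm_idem hS (hS.mul_mem hs' hs) h.idem_left
    refine ⟨x * s', ⟨s', hs', s * x * s', hx.conj hS hs' hs h.symm,
      hx.mul_eq hS hs' hs h.symm⟩, ?_, ?_⟩
    · calc s * x * (x * s') * (s * x) = s * (x * x) * (s' * s * x) := by simp only [mul_assoc]
        _ = s * x := by rw [hsx, xx, mul_assoc, xx]
    · calc x * s' * (s * x) * (x * s') = x * (s' * s * x) * (x * s') := by simp only [mul_assoc]
        _ = x * s' := by rw [hsx, xx, ← mul_assoc, xx]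
  comm e he f hf hee hff :=
    (isCutIdem_of_idem hS he hee).comm hS (isCutIdem_of_idem hS hf hff)

end Cut

section OrthSums

variable {M : Set R}

theorem InvClosed.mul_inverse (hM : InvClosed M) {a a' b b' : R} (ha : a ∈ M) (ha' : a' ∈ M) (hb : b ∈ M)
    (hb' : b' ∈ M) (h1 : IsInverseOf a a') (h2 : IsInverseOf b b') :
    IsInverseOf (a * b) (b' * a') := by
  have h := hM.comm (a' * a) (hM.mul_mem ha' ha) (b * b') (hM.mul_mem hb hb')
    h1.idem_left h2.idem_right
  constructor
  · calc a * b * (b' * a') * (a * b) = a * ((b * b') * (a' * a)) * b := by simp only [mul_assoc]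
      _ = (a * a' * a) * (b * b' * b) := by rw [← h]; simp only [mul_assoc]
      _ = a * b := by rw [h1.1, h2.1]
  · calc b' * a' * (a * b) * (b' * a') = b' * ((a' * a) * (b * b')) * a' := by
          simp only [mul_assoc]
      _ = (b' * b * b') * (a' * a * a') := by rw [h]; simp only [mul_assoc]
      _ = b' * a' := by rw [h1.2, h2.2]

/-- If `a * c' = 0`, then `a * e * c' = 0` for any idempotent `e` of `M`. -/
theorem InvClosed.mul_idem_mul_eq_zero (hM : InvClosed M) {a a' c' e : R} (ha : a ∈ M)
    (ha' : a' ∈ M) (h1 : IsInverseOf a a') (he : e ∈ M) (hee : IsIdempotentElem e)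
    (h : a * c' = 0) : a * e * c' = 0 := by
  have k1 := hM.comm _ (hM.mul_mem ha' ha) e he h1.idem_left hee
  calc a * e * c' = (a * a' * a) * e * c' := by rw [h1.1]
    _ = a * ((a' * a) * e) * c' := by simp only [mul_assoc]
    _ = a * e * a' * (a * c') := by rw [k1]; simp only [mul_assoc]
    _ = 0 := by rw [h, mul_zero]

theorem orthIn_mul (hM : InvClosed M) {a b c d : R} (ha : a ∈ M) (hb : b ∈ M) (hc : c ∈ M) (hd : d ∈ M)
    (h : (OrthIn M a c ∧ (b = d ∨ OrthIn M b d)) ∨ (a = c ∧ OrthIn M b d)) :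
    OrthIn M (a * b) (c * d) := by
  rcases h with ⟨⟨a', ha', c', hc', h1, h2, h3, h4⟩, h⟩ | ⟨rfl, b', hb', d', hd', h1, h2, h3, h4⟩
  · rcases h with rfl | ⟨b', hb', d', hd', k1, k2, k3, k4⟩
    · obtain ⟨b', hb', k⟩ := hM.exists_inv b hb
      refine ⟨_, hM.mul_mem hb' ha', _, hM.mul_mem hb' hc', hM.mul_inverse ha ha' hb hb' h1 k,
        hM.mul_inverse hc hc' hb hb' h2 k, ?_, ?_⟩
      · calc b' * a' * (c * b) = b' * (a' * c) * b := by simp only [mul_assoc]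
          _ = 0 := by rw [h3, mul_zero, zero_mul]
      · have := hM.mul_idem_mul_eq_zero ha ha' h1 (hM.mul_mem hb hb') k.idem_right h4
        calc a * b * (b' * c') = a * (b * b') * c' := by simp only [mul_assoc]
          _ = 0 := this
    · refine ⟨_, hM.mul_mem hb' ha', _, hM.mul_mem hd' hc', hM.mul_inverse ha ha' hb hb' h1 k1,
        hM.mul_inverse hc hc' hd hd' h2 k2, ?_, ?_⟩
      · calc b' * a' * (c * d) = b' * (a' * c) * d := by simp only [mul_assoc]
          _ = 0 := by rw [h3, mul_zero, zero_mul]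
      · calc a * b * (d' * c') = a * (b * d') * c' := by simp only [mul_assoc]
          _ = 0 := by rw [k4, mul_zero, zero_mul]
  · obtain ⟨a', ha', k⟩ := hM.exists_inv a ha
    refine ⟨_, hM.mul_mem hb' ha', _, hM.mul_mem hd' ha', hM.mul_inverse ha ha' hb hb' k h1,
      hM.mul_inverse ha ha' hd hd' k h2, ?_, ?_⟩
    · have := hM.mul_idem_mul_eq_zero hb' hb h1.symm (hM.mul_mem ha' ha)
        k.idem_left h3
      calc b' * a' * (a * d) = b' * (a' * a) * d := by simp only [mul_assoc]
        _ = 0 := this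
    · calc a * b * (d' * a') = a * (b * d') * a' := by simp only [mul_assoc]
        _ = 0 := by rw [h4, mul_zero, zero_mul]

theorem orthSums_mul (hM : InvClosed M) {x y : R} (hx : x ∈ orthSums M) (hy : y ∈ orthSums M) :
    x * y ∈ orthSums M := by
  obtain ⟨m, a, ha, oa, rfl⟩ := hx
  obtain ⟨n, b, hb, ob, rfl⟩ := hy
  have key : ∀ p q : Fin m × Fin n, p ≠ q → OrthIn M (a p.1 * b p.2) (a q.1 * b q.2) := by
    rintro ⟨i, j⟩ ⟨i', j'⟩ hne
    refine orthIn_mul hM (ha _) (hb _) (ha _) (hb _) ?_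
    by_cases hi : i = i'
    · subst hi
      exact Or.inr ⟨rfl, ob _ _ fun h => hne (by rw [show j = j' from h])⟩
    · refine Or.inl ⟨oa _ _ hi, ?_⟩
      by_cases hj : j = j'
      · exact Or.inl (by rw [hj])
      · exact Or.inr (ob _ _ hj)
  refine ⟨m * n, fun k => a (finProdFinEquiv.symm k).1 * b (finProdFinEquiv.symm k).2,
    fun k => hM.mul_mem (ha _) (hb _), ?_, ?_⟩
  · intro k l hkl
    exact key _ _ fun h => hkl (finProdFinEquiv.symm.injective h)
  · rw [Finset.sum_mul_sum, ← Finset.sum_product', Finset.univ_product_univ]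
    exact (Equiv.sum_comp finProdFinEquiv.symm (fun p : Fin m × Fin n => a p.1 * b p.2)).symm

end OrthSums

/-- The Booleanization `S'' = B_R(S₀)` of `S₀` in `R`: the set of all finite sums of pairwise
orthogonal elements of `S' = S₀ E'`. -/
def booleanizationIn (S₀ : Subsemigroup R) [IsInverseSemigroup S₀] : Subsemigroup R where
  carrier := orthSums (cutSet (S₀ : Set R))
  mul_mem' := orthSums_mul (invClosed_cutSet (invClosed_coe S₀))

instance (S₀ : Subsemigroup R) [IsInverseSemigroup S₀] :
    SemigroupWithZero (booleanizationIn S₀) where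
  zero := ⟨0, 0, Fin.elim0, fun i => i.elim0, fun i => i.elim0, by simp⟩
  zero_mul x := Subtype.ext (zero_mul (x : R))
  mul_zero x := Subtype.ext (mul_zero (x : R))

end Ring

/-! ### The contracted semigroup algebra -/

section Contracted

variable (S : Type u) [SemigroupWithZero S]

/-- The contracted semigroup algebra `ℂ₀S`: the quotient of the semigroup algebra `ℂS` by the ideal
generated by the zero of `S`. -/
abbrev ContractedAlgebra : Type u :=
  (TwoSidedIdeal.span {MonoidAlgebra.single (0 : S) (1 : ℂ)}).ringCon.Quotient

/-- The canonical map `S → ℂ₀S`. -/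
noncomputable def toContracted : S →ₙ* ContractedAlgebra S where
  toFun s := ((MonoidAlgebra.single s (1 : ℂ) : MonoidAlgebra ℂ S) :
    (TwoSidedIdeal.span {MonoidAlgebra.single (0 : S) (1 : ℂ)}).ringCon.Quotient)
  map_mul' s t := by
    rw [← RingCon.coe_mul, MonoidAlgebra.single_mul_single, one_mul]

end Contracted

end InvSemigroup

/-! Everything happens in the groupoid of proper filters of `S`. In `B(S)` the idempotents are the
sets of identities, the order is inclusion, compatibility means that the union is a partial
bisection, and the join is then the union (`isIdempotentElem_iff`, `natLE_iff`, `compat_iff`).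
Distributivity is immediate for unions. Complements are set differences; these are again finite
unions of basic sets because membership in a Boolean element is decided, inside a given bisection,
by finitely many questions "is the idempotent `e` in the domain?" (`exists_finite_type`,
`exists_disjoint_basic`). Principal filters make `a ↦ U_a` injective.

For the universal property, elements of a Boolean inverse semigroup `T` are separated by prime
filters (`exists_prime`). The extension of `θ : S → T` sends `X` to the element of `T` that lies in
exactly those prime filters `P` under which some member of `X` lies (`IsLift`). Such an element is
unique by separation. It exists for basic sets by taking relative complements in `T`, and for
general `X` by joins. It is multiplicative because filters containing a product factor in the
groupoid, and factors of prime filters are prime (`IsLift.mul`). Uniqueness of the morphism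
(`morphism_ext`) holds because `B(S)` is generated from the image of `S` by relative complements of
idempotents, products and compatible joins.

For the ring, partial bisections act on the complex functions on the groupoid by partial translation
(`setOp`). The action is faithful, multiplicative, and additive on disjoint unions inside a
bisection. It extends to a faithful representation of the contracted algebra, since the operators of
the nonzero elements of `S` are linearly independent (`coeff_eq_zero_of_liftMagma`). Under it `x - x
* f` becomes a set difference and an orthogonal sum a disjoint union, so `B(S)` and the
Booleanization in the algebra are identified with the same semigroup of operators
(`exists_mulEquiv`). That the latter is a Boolean inverse semigroup follows by transport. -/

namespace InvSemigroup

/-! ### The natural partial order and homomorphisms. -/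

section Order

variable {S : Type u} [Semigroup S]

theorem IsJoin.symm {a b c : S} (h : IsJoin a b c) : IsJoin b a c :=
  ⟨h.2.1, h.1, fun d h1 h2 => h.2.2 d h2 h1⟩

theorem isIdempotentElem_map {T : Type v} [Semigroup T] (θ : S →ₙ* T) {e : S}
    (he : IsIdempotentElem e) : IsIdempotentElem (θ e) := by
  show θ e * θ e = θ e
  rw [← map_mul, he.eq]

theorem NatLE.map {T : Type v} [Semigroup T] (θ : S →ₙ* T) {s t : S} (h : NatLE s t) :
    NatLE (θ s) (θ t) := by
  obtain ⟨e, he, rfl⟩ := h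
  exact ⟨θ e, isIdempotentElem_map θ he, map_mul θ t e⟩

variable [IsInverseSemigroup S]

theorem NatLE.antisymm {a b : S} (h1 : NatLE a b) (h2 : NatLE b a) : a = b := by
  obtain ⟨e, he, rfl⟩ := h1
  obtain ⟨f, hf, h⟩ := h2
  calc b * e = b * e * f * e := by rw [← h]
    _ = b * e * e * f := by rw [mul_assoc _ f, ← idem_comm he hf, ← mul_assoc]
    _ = b := by rw [mul_assoc b, he.eq, ← h]

theorem IsJoin.unique {a b c d : S} (h1 : IsJoin a b c) (h2 : IsJoin a b d) : c = d :=
  (h1.2.2 d h2.1 h2.2.1).antisymm (h2.2.2 c h1.1 h1.2.1)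

theorem NatLE.domain {a b : S} (h : NatLE a b) :
    NatLE (InvSemigroup.sinv a * a) (InvSemigroup.sinv b * b) :=
  h.sinv.mul h

theorem NatLE.idem {a e : S} (h : NatLE a e) (he : IsIdempotentElem e) : IsIdempotentElem a := by
  obtain ⟨f, hf, rfl⟩ := h
  exact idem_mul he hf

theorem map_sinv {T : Type v} [Semigroup T] [IsInverseSemigroup T] (θ : S →ₙ* T) (s : S) :
    θ (sinv s) = sinv (θ s) := by
  refine (sinv_eq ⟨?_, ?_⟩).symm
  · rw [← map_mul, ← map_mul, (isInverseOf_sinv s).1]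
  · rw [← map_mul, ← map_mul, (isInverseOf_sinv s).2]

end Order

/-! ### The groupoid of proper filters and its partial bisections. -/

section Filters

variable {S : Type u} [SemigroupWithZero S] [IsInverseSemigroup S]

namespace ProperFilter

/-- The principal filter of a nonzero element. -/
def principal (a : S) (ha : a ≠ 0) : ProperFilter S where
  carrier := {s | NatLE a s}
  nonempty := ⟨a, natLE_refl a⟩
  upward _ _ h1 h2 := NatLE.trans h1 h2
  directed _ _ h1 h2 := ⟨a, natLE_refl a, h1, h2⟩
  zero_notMem h := ha (natLE_zero h)

theorem eq_of_mem_of_dom_eq {A B : ProperFilter S} {a : S} (hA : a ∈ A.carrier)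
    (hB : a ∈ B.carrier) (h : A.dom = B.dom) : A = B :=
  (isPartialBisection_basic a ∅).1 ⟨hA, by simp⟩ ⟨hB, by simp⟩ h

theorem dom_upward {A : ProperFilter S} {e f : S} (he : e ∈ A.dom) (h : NatLE e f) : f ∈ A.dom := by
  obtain ⟨c, hc, h1⟩ := mem_dom.1 he
  exact mem_dom.2 ⟨c, hc, h1.trans h⟩

theorem mul_mem_dom {A : ProperFilter S} {e f : S} (he : e ∈ A.dom) (hf : f ∈ A.dom) :
    e * f ∈ A.dom := by
  obtain ⟨c, hc, h1⟩ := mem_dom.1 he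
  obtain ⟨c', hc', h2⟩ := mem_dom.1 hf
  obtain ⟨d, hd, h3, h4⟩ := A.directed c c' hc hc'
  refine mem_dom.2 ⟨d, hd, ?_⟩
  have := (h3.domain.trans h1).mul (h4.domain.trans h2)
  rwa [(idem_sinv_mul d).eq] at this

theorem zero_notMem_dom (A : ProperFilter S) : (0 : S) ∉ A.dom := by
  intro h
  obtain ⟨x, hx⟩ := A.nonempty
  have := mul_mem_of_dom hx h
  rw [mul_zero] at this
  exact A.zero_notMem this

theorem exists_idem_of_mem_dom {A : ProperFilter S} {s : S} (h : s ∈ A.dom) :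
    ∃ e ∈ A.dom, IsIdempotentElem e ∧ NatLE e s := by
  obtain ⟨c, hc, h1⟩ := mem_dom.1 h
  exact ⟨_, sinv_mul_mem_dom hc, idem_sinv_mul c, h1⟩

theorem mul_idem_mem_iff {A : ProperFilter S} {a e : S} (he : IsIdempotentElem e) :
    a * e ∈ A.carrier ↔ a ∈ A.carrier ∧ e ∈ A.dom := by
  refine ⟨fun h => ⟨A.upward _ _ h (natLE_mul_idem a he), mem_dom.2 ⟨_, h, ?_⟩⟩,
    fun h => mul_mem_of_dom h.1 h.2⟩
  rw [sinv_mul, sinv_idem he, show e * sinv a * (a * e) = e * ((sinv a * a) * e) by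
    simp only [mul_assoc], idem_comm (idem_sinv_mul a) he, ← mul_assoc, he.eq]
  exact natLE_mul_idem e (idem_sinv_mul a)

/-- Since `b = a * (b⁻¹ * b)`, membership of elements below `a` becomes a question about idempotents
in the domain. All finiteness arguments below rest on this reduction. -/
theorem mem_iff_of_natLE {A : ProperFilter S} {a b : S} (ha : a ∈ A.carrier) (h : NatLE b a) :
    b ∈ A.carrier ↔ sinv b * b ∈ A.dom := by
  conv_lhs => rw [← h.eq_mul]
  rw [mul_idem_mem_iff (idem_sinv_mul b)]
  exact and_iff_right ha

/-- The filter that contains `a` and has the domain of `A`. -/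
theorem exists_mem_dom_eq {A : ProperFilter S} {a : S} (h : sinv a * a ∈ A.dom) :
    ∃ B : ProperFilter S, a ∈ B.carrier ∧ B.dom = A.dom := by
  refine ⟨{ carrier := {s | ∃ e, IsIdempotentElem e ∧ e ∈ A.dom ∧ NatLE (a * e) s}
            nonempty := ⟨_, _, idem_sinv_mul a, h, natLE_refl _⟩
            upward := ?_, directed := ?_, zero_notMem := ?_ }, ?_, ?_⟩
  · rintro s t ⟨e, he, h1, h2⟩ h3
    exact ⟨e, he, h1, h2.trans h3⟩
  · rintro s t ⟨e, he, h1, h2⟩ ⟨f, hf, h3, h4⟩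
    refine ⟨a * (e * f), ⟨_, idem_mul he hf, mul_mem_dom h1 h3, natLE_refl _⟩, ?_, ?_⟩
    · exact ((natLE_refl a).mul (natLE_mul_idem e hf)).trans h2
    · exact ((natLE_refl a).mul (natLE_idem_mul f he)).trans h4
  · rintro ⟨e, he, h1, h2⟩
    have h3 := mul_mem_dom h h1
    rw [mul_assoc, natLE_zero h2, mul_zero] at h3
    exact A.zero_notMem_dom h3
  · exact ⟨_, idem_sinv_mul a, h, by rw [mul_sinv_mul]; exact natLE_refl a⟩
  · ext s
    rw [mem_dom]
    have key : ∀ e, IsIdempotentElem e → sinv (a * e) * (a * e) = sinv a * a * e := by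
      intro e he
      rw [sinv_mul, sinv_idem he, show e * sinv a * (a * e) = e * ((sinv a * a) * e) by
        simp only [mul_assoc], idem_comm (idem_sinv_mul a) he, ← mul_assoc, he.eq]
    constructor
    · rintro ⟨c, ⟨e, he, h1, h2⟩, h3⟩
      have h4 := h2.domain.trans h3
      rw [key e he] at h4
      exact dom_upward (mul_mem_dom h h1) h4
    · intro hs
      obtain ⟨e, he, hee, h1⟩ := exists_idem_of_mem_dom hs
      refine ⟨a * e, ⟨e, hee, he, natLE_refl _⟩, ?_⟩
      rw [key e hee]
      exact (natLE_idem_mul e (idem_sinv_mul a)).trans h1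

/-- The inverse of a proper filter. -/
def inv (A : ProperFilter S) : ProperFilter S where
  carrier := {s | sinv s ∈ A.carrier}
  nonempty := by
    obtain ⟨x, hx⟩ := A.nonempty
    exact ⟨sinv x, by rwa [Set.mem_ofPred_eq, sinv_sinv]⟩
  upward _ _ h1 h2 := A.upward _ _ h1 h2.sinv
  directed a b h1 h2 := by
    obtain ⟨c, hc, h3, h4⟩ := A.directed _ _ h1 h2
    refine ⟨sinv c, by rwa [Set.mem_ofPred_eq, sinv_sinv], ?_, ?_⟩
    · simpa only [sinv_sinv] using h3.sinv
    · simpa only [sinv_sinv] using h4.sinv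
  zero_notMem h := A.zero_notMem (by
    have h0 : sinv (0 : S) = 0 := sinv_idem (mul_zero 0)
    rwa [Set.mem_ofPred_eq, h0] at h)

theorem mem_inv {A : ProperFilter S} {s : S} : s ∈ A.inv.carrier ↔ sinv s ∈ A.carrier := Iff.rfl

theorem inv_inv_eq (A : ProperFilter S) : A.inv.inv = A := by
  ext s
  rw [mem_inv, mem_inv, sinv_sinv]

theorem dom_inv (A : ProperFilter S) : A.inv.dom = A.ran := by
  ext s
  rw [mem_dom, mem_ran]
  constructor
  · rintro ⟨c, hc, h⟩
    exact ⟨sinv c, hc, by rwa [sinv_sinv]⟩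
  · rintro ⟨c, hc, h⟩
    exact ⟨sinv c, by rwa [mem_inv, sinv_sinv], by rwa [sinv_sinv]⟩

theorem ran_inv (A : ProperFilter S) : A.inv.ran = A.dom := by
  rw [← dom_inv, inv_inv_eq]

/-- The identity of the groupoid of proper filters at the domain of `A`. -/
def unit (A : ProperFilter S) : ProperFilter S where
  carrier := A.dom
  nonempty := by
    obtain ⟨x, hx⟩ := A.nonempty
    exact ⟨_, sinv_mul_mem_dom hx⟩
  upward _ _ := dom_upward
  directed a b h1 h2 := by
    obtain ⟨c, hc, h3⟩ := mem_dom.1 h1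
    obtain ⟨d, hd, h4⟩ := mem_dom.1 h2
    obtain ⟨z, hz, h5, h6⟩ := A.directed _ _ hc hd
    exact ⟨_, sinv_mul_mem_dom hz, h5.domain.trans h3, h6.domain.trans h4⟩
  zero_notMem := A.zero_notMem_dom

/-- The identities of the groupoid of proper filters. -/
def IsUnit (A : ProperFilter S) : Prop := A.carrier = A.dom

theorem IsUnit.exists_idem {A : ProperFilter S} (h : A.IsUnit) :
    ∃ e ∈ A.carrier, IsIdempotentElem e := by
  obtain ⟨x, hx⟩ := A.nonempty
  refine ⟨_, ?_, idem_sinv_mul x⟩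
  rw [h]
  exact sinv_mul_mem_dom hx

/-- Every element below an idempotent is idempotent, hence equal to its own domain; so one
idempotent in the filter suffices. -/
theorem isUnit_of_idem {A : ProperFilter S} {e : S} (he : e ∈ A.carrier)
    (hee : IsIdempotentElem e) : A.IsUnit := by
  ext s
  constructor
  · intro hs
    obtain ⟨c, hc, h1, h2⟩ := A.directed s e hs he
    have h3 := h2.idem hee
    refine mem_dom.2 ⟨c, hc, ?_⟩
    rwa [sinv_idem h3, h3.eq]
  · intro hs
    obtain ⟨f, hf, hff, h⟩ := exists_idem_of_mem_dom hs
    exact A.upward _ _ (mul_mem_of_dom he hf) ((natLE_idem_mul f hee).trans h)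

theorem IsUnit.ran {A : ProperFilter S} (h : A.IsUnit) : A.ran = A.dom := by
  obtain ⟨e, he, hee⟩ := h.exists_idem
  ext s
  rw [mem_ran, mem_dom]
  constructor
  · rintro ⟨c, hc, h1⟩
    obtain ⟨d, hd, h2, h3⟩ := A.directed c e hc he
    have h4 := h3.idem hee
    refine ⟨d, hd, ?_⟩
    have := h2.mul h2.sinv
    rw [sinv_idem h4] at this ⊢
    exact this.trans h1
  · rintro ⟨c, hc, h1⟩
    obtain ⟨d, hd, h2, h3⟩ := A.directed c e hc he
    have h4 := h3.idem hee
    refine ⟨d, hd, ?_⟩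
    have := h2.domain
    rw [sinv_idem h4] at this ⊢
    exact this.trans h1

theorem isUnit_unit (A : ProperFilter S) : A.unit.IsUnit := by
  obtain ⟨x, hx⟩ := A.nonempty
  exact isUnit_of_idem (sinv_mul_mem_dom hx) (idem_sinv_mul x)

theorem dom_unit (A : ProperFilter S) : A.unit.dom = A.dom := A.isUnit_unit.symm

theorem ran_unit (A : ProperFilter S) : A.unit.ran = A.dom := A.isUnit_unit.ran.trans A.dom_unit

theorem IsUnit.eq_of_dom {S : Type u} [SemigroupWithZero S] {A B : ProperFilter S}
    (hA : A.IsUnit) (hB : B.IsUnit)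
    (h : A.dom = B.dom) : A = B :=
  ProperFilter.ext (hA.trans (h.trans hB.symm))

theorem IsUnit.unit_eq {A : ProperFilter S} (hA : A.IsUnit) : A.unit = A :=
  A.isUnit_unit.eq_of_dom hA A.dom_unit

theorem IsProd.unique {S : Type u} [SemigroupWithZero S] {A B C C' : ProperFilter S}
    (h : IsProd A B C) (h' : IsProd A B C') :
    C = C' := ProperFilter.ext (h.2.trans h'.2.symm)

theorem isProd_of_isUnit {A B : ProperFilter S} (hB : B.IsUnit) (h : A.dom = B.ran) :
    IsProd A B A := by
  refine ⟨h, ?_⟩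
  rw [hB.ran] at h
  ext s
  constructor
  · intro hs
    refine ⟨s, hs, sinv s * s, ?_, ?_⟩
    · rw [hB, ← h]
      exact sinv_mul_mem_dom hs
    · rw [mul_sinv_mul]
      exact natLE_refl s
  · rintro ⟨x, hx, y, hy, h1⟩
    rw [hB, ← h] at hy
    exact A.upward _ _ (mul_mem_of_dom hx hy) h1

theorem isProd_unit (A : ProperFilter S) : IsProd A A.unit A :=
  isProd_of_isUnit A.isUnit_unit A.ran_unit.symm

theorem isProd_inv_self (A : ProperFilter S) : IsProd A.inv A A.unit := by
  have h := isProd_gmul A.inv A A.dom_inv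
  have h1 : (gmul A.inv A A.dom_inv).IsUnit := by
    obtain ⟨x, hx⟩ := A.nonempty
    refine isUnit_of_idem ?_ (idem_sinv_mul x)
    exact ⟨sinv x, by rwa [mem_inv, sinv_sinv], x, hx, natLE_refl _⟩
  rwa [h1.eq_of_dom A.isUnit_unit (h.dom_eq.trans A.dom_unit.symm)] at h

/-- Cancelling `a` from `a * (a⁻¹ * a)`, an element of the product, puts an idempotent into `A`. -/
theorem isUnit_of_isProd {A : ProperFilter S} (h : IsProd A A A) : A.IsUnit := by
  obtain ⟨a, ha⟩ := A.nonempty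
  refine isUnit_of_idem (e := sinv a * a) ?_ (idem_sinv_mul a)
  refine mem_right_of_mul_mem h.1 ha ?_
  rw [← h.2, mul_sinv_mul]
  exact ha

/-- Associativity for single arrows is read off from `setMul_assoc` applied to singletons. -/
theorem IsProd.assoc_left {A B C D E : ProperFilter S} (h1 : IsProd A B C) (h2 : IsProd D C E) :
    ∃ F, IsProd D A F ∧ IsProd F B E := by
  have h : E ∈ setMul (setMul {D} {A}) {B} := by
    rw [setMul_assoc]
    exact ⟨D, rfl, C, ⟨A, rfl, B, rfl, h1⟩, h2⟩
  obtain ⟨F, ⟨_, rfl, _, rfl, h3⟩, _, rfl, h4⟩ := h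
  exact ⟨F, h3, h4⟩

theorem IsProd.assoc_right {A B C D E : ProperFilter S} (h1 : IsProd A B C) (h2 : IsProd C D E) :
    ∃ F, IsProd B D F ∧ IsProd A F E := by
  have h : E ∈ setMul {A} (setMul {B} {D}) := by
    rw [← setMul_assoc]
    exact ⟨C, ⟨A, rfl, B, rfl, h1⟩, D, rfl, h2⟩
  obtain ⟨_, rfl, F, ⟨_, rfl, _, rfl, h3⟩, h4⟩ := h
  exact ⟨F, h3, h4⟩

/-- Left cancellation in the groupoid: the first factor and the product determine the second factor.
-/
theorem IsProd.inv_mul {A B C : ProperFilter S} (h : IsProd A B C) : IsProd A.inv C B := by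
  have h0 : A.inv.dom = C.ran := A.dom_inv.trans h.ran_eq.symm
  have h1 := isProd_gmul A.inv C h0
  obtain ⟨F, h2, h3⟩ := h.assoc_left h1
  rw [h2.unique A.isProd_inv_self] at h3
  have hc : gmul A.inv C h0 = B := by
    obtain ⟨b, hb⟩ := B.nonempty
    refine eq_of_mem_of_dom_eq (a := b) ?_ hb h3.dom_eq
    rw [h3.2]
    have h4 := mul_sinv_mem_ran hb
    rw [← h.1] at h4
    exact ⟨_, h4, b, hb, by rw [mul_assoc, mul_sinv_mul]; exact natLE_refl b⟩
  rwa [hc] at h1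

end ProperFilter

open ProperFilter

/-! ### Partial bisections -/

/-- The inverse of a set of proper filters. -/
def setInv (X : Set (ProperFilter S)) : Set (ProperFilter S) := {A | A.inv ∈ X}

theorem mem_setInv {X : Set (ProperFilter S)} {A : ProperFilter S} :
    A ∈ setInv X ↔ A.inv ∈ X := Iff.rfl

theorem IsPartialBisection.mono {S : Type u} [SemigroupWithZero S] {X Y : Set (ProperFilter S)}
    (hY : IsPartialBisection Y) (h : X ⊆ Y) : IsPartialBisection X := ⟨hY.1.mono h, hY.2.mono h⟩

theorem IsPartialBisection.setInv {X : Set (ProperFilter S)} (hX : IsPartialBisection X) :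
    IsPartialBisection (setInv X) := by
  constructor
  · intro A hA B hB h
    have := hX.2 hA hB (by rw [ran_inv, ran_inv, h])
    rw [← inv_inv_eq A, this, inv_inv_eq]
  · intro A hA B hB h
    have := hX.1 hA hB (by rw [dom_inv, dom_inv, h])
    rw [← inv_inv_eq A, this, inv_inv_eq]

theorem IsBasic.setInv {U : Set (ProperFilter S)} (hU : IsBasic U) : IsBasic (setInv U) := by
  obtain ⟨a, L, hL, hLa, rfl⟩ := hU
  refine ⟨sinv a, sinv '' L, hL.image _, ?_, ?_⟩
  · rintro _ ⟨b, hb, rfl⟩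
    exact (hLa b hb).sinv
  · ext A
    constructor
    · rintro ⟨h1, h2⟩
      refine ⟨h1, ?_⟩
      rintro _ ⟨b, hb, rfl⟩ h
      exact h2 b hb h
    · rintro ⟨h1, h2⟩
      exact ⟨h1, fun b hb h => h2 _ ⟨b, hb, rfl⟩ h⟩

theorem IsBooleanElement.setInv {X : Set (ProperFilter S)} (hX : IsBooleanElement X) :
    IsBooleanElement (setInv X) := by
  obtain ⟨pX, F, hF, bF, rfl⟩ := hX
  refine ⟨pX.setInv, InvSemigroup.setInv '' F, hF.image _, ?_, ?_⟩
  · rintro _ ⟨U, hU, rfl⟩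
    exact (bF U hU).setInv
  · ext A
    constructor
    · rintro ⟨U, hU, hA⟩
      exact ⟨_, ⟨U, hU, rfl⟩, hA⟩
    · rintro ⟨_, ⟨U, hU, rfl⟩, hA⟩
      exact ⟨U, hU, hA⟩

/-- If `A = B · C` inside `X`, injectivity of `r` and `d` forces `B = A = C`, so `A` is an
idempotent arrow. -/
theorem isUnit_of_setMul_self {X : Set (ProperFilter S)} (hX : IsPartialBisection X)
    (h : setMul X X = X) {A : ProperFilter S} (hA : A ∈ X) : A.IsUnit := by
  have hA' := hA
  rw [← h] at hA'
  obtain ⟨B, hB, C, hC, hp⟩ := hA'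
  rw [hX.2 hB hA hp.ran_eq.symm, hX.1 hC hA hp.dom_eq.symm] at hp
  exact isUnit_of_isProd hp

/-- Multiplication by a set of identities restricts. -/
theorem mem_setMul_of_isUnit {X F : Set (ProperFilter S)} (hF : ∀ A ∈ F, A.IsUnit)
    {C : ProperFilter S} : C ∈ setMul X F ↔ C ∈ X ∧ C.unit ∈ F := by
  constructor
  · rintro ⟨A, hA, B, hB, h⟩
    have h1 : C = A := h.unique (isProd_of_isUnit (hF B hB) h.1)
    rw [h1]
    refine ⟨hA, ?_⟩
    have h2 : A.dom = B.dom := h.1.trans (hF B hB).ran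
    rwa [A.isUnit_unit.eq_of_dom (hF B hB) (A.dom_unit.trans h2)]
  · rintro ⟨h1, h2⟩
    exact ⟨C, h1, _, h2, C.isProd_unit⟩

theorem setMul_self_of_isUnit {X : Set (ProperFilter S)} (hX : ∀ A ∈ X, A.IsUnit) :
    setMul X X = X := by
  ext C
  rw [mem_setMul_of_isUnit hX]
  constructor
  · exact fun h => h.1
  · exact fun h => ⟨h, by rwa [(hX C h).unit_eq]⟩

/-- Injectivity of `r` leaves only the composable pairs `A⁻¹, A`, so `X⁻¹X` consists of the domain
identities of `X`. -/
theorem mem_setInv_mul_self {X : Set (ProperFilter S)} (hX : IsPartialBisection X)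
    {C : ProperFilter S} : C ∈ setMul (setInv X) X ↔ ∃ A ∈ X, C = A.unit := by
  constructor
  · rintro ⟨A, hA, B, hB, h⟩
    have h1 : A.inv = B := hX.2 hA hB (by rw [ran_inv, h.1])
    refine ⟨B, hB, ?_⟩
    rw [← inv_inv_eq A, h1] at h
    exact h.unique B.isProd_inv_self
  · rintro ⟨A, hA, rfl⟩
    exact ⟨A.inv, by rwa [mem_setInv, inv_inv_eq], A, hA, A.isProd_inv_self⟩

theorem mem_mul_setInv_self {X : Set (ProperFilter S)} (hX : IsPartialBisection X)
    {C : ProperFilter S} (hC : C ∈ setMul X (setInv X)) : C.IsUnit := by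
  have h := (mem_setInv_mul_self hX.setInv (C := C)).1 (by
    have e : setInv (setInv X) = X := by
      ext A
      rw [mem_setInv, mem_setInv, inv_inv_eq]
    rwa [e])
  obtain ⟨A, -, rfl⟩ := h
  exact A.isUnit_unit

theorem setMul_setInv_mul {X : Set (ProperFilter S)} (hX : IsPartialBisection X) :
    setMul X (setMul (setInv X) X) = X := by
  have hF : ∀ A ∈ setMul (setInv X) X, A.IsUnit := by
    intro A hA
    obtain ⟨B, -, rfl⟩ := (mem_setInv_mul_self hX).1 hA
    exact B.isUnit_unit
  ext C
  rw [mem_setMul_of_isUnit hF, mem_setInv_mul_self hX]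
  exact ⟨fun h => h.1, fun h => ⟨h, C, h, rfl⟩⟩

/-- The witness is the product of `q` with the elements of `τ`; `q` supplies the empty product,
which need not exist in `S`. -/
theorem exists_idem_lower_bound {τ : Set S} (hτ : τ.Finite) (hi : ∀ e ∈ τ, IsIdempotentElem e)
    {q : S} (hq : IsIdempotentElem q) :
    ∃ p, IsIdempotentElem p ∧ (∀ e ∈ τ, NatLE p e) ∧
      ∀ A : ProperFilter S, q ∈ A.dom → τ ⊆ A.dom → p ∈ A.dom := by
  induction τ, hτ using Set.Finite.induction_on with
  | empty => exact ⟨q, hq, by simp, fun A h _ => h⟩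
  | @insert e τ he hτ ih =>
    obtain ⟨p, hpp, h, hA⟩ := ih fun f hf => hi f (Set.mem_insert_of_mem _ hf)
    have hee := hi e (Set.mem_insert e τ)
    refine ⟨p * e, idem_mul hpp hee, ?_, fun A h1 h2 => ?_⟩
    · rintro f (rfl | hf)
      · exact natLE_idem_mul f hpp
      · exact (natLE_mul_idem p hee).trans (h f hf)
    · exact mul_mem_dom (hA A h1 fun f hf => h2 (Set.mem_insert_of_mem _ hf))
        (h2 (Set.mem_insert e τ))

/-- In a subset of a finite union of basic sets that is cut out by finitely many conditions on
domains, one finds finitely many disjoint basic sets that cover it. -/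
theorem exists_disjoint_basic {X Z : Set (ProperFilter S)} (hX : IsBooleanElement X) (hZ : Z ⊆ X)
    (E : Set S) (hE : E.Finite) (hEi : ∀ e ∈ E, IsIdempotentElem e)
    (hEZ : ∀ A ∈ Z, ∀ B ∈ X, (∀ e ∈ E, e ∈ A.dom ↔ e ∈ B.dom) → B ∈ Z) :
    ∃ G : Set (Set (ProperFilter S)), G.Finite ∧ (∀ U ∈ G, IsBasic U) ∧ G.PairwiseDisjoint id ∧
      Z = ⋃₀ G := by
  classical
  obtain ⟨pX, F, hF, bF, rfl⟩ := hX
  choose! a L hL hLa hU using bF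
  -- Adding the domains of all elements that define the basic sets of `F` makes the type of a filter
  -- of `X` decide which members of `F` contain it.
  set E' : Set S := E ∪ ((fun s => sinv s * s) '' (a '' F ∪ ⋃ U ∈ F, L U)) with hE'
  have hE'f : E'.Finite := hE.union (((hF.image _).union (hF.biUnion hL)).image _)
  have hE'i : ∀ e ∈ E', IsIdempotentElem e := by
    rintro e (he | ⟨s, -, rfl⟩)
    · exact hEi e he
    · exact idem_sinv_mul s
  have hfin : (Set.univ : Set (Set E')).Finite :=
    haveI := hE'f.to_subtype
    Set.finite_univ
  let type : ProperFilter S → Set S := fun A => {e ∈ E' | e ∈ A.dom}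
  have htype : ∀ A B, type A = type B ↔ ∀ e ∈ E', e ∈ A.dom ↔ e ∈ B.dom := by
    intro A B
    constructor
    · intro h e he
      have := Set.ext_iff.1 h e
      exact ⟨fun h1 => (this.1 ⟨he, h1⟩).2, fun h1 => (this.2 ⟨he, h1⟩).2⟩
    · intro h
      ext e
      exact ⟨fun h1 => ⟨h1.1, (h e h1.1).1 h1.2⟩, fun h1 => ⟨h1.1, (h e h1.1).2 h1.2⟩⟩
  -- The cells are disjoint by construction; the work is to show that each nonempty cell is basic.
  let cell : Set S → Set (ProperFilter S) := fun τ => {A ∈ Z | type A = τ}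
  refine ⟨cell '' (type '' Z), ?_, ?_, ?_, ?_⟩
  · refine Set.Finite.image _ (hE'f.finite_subsets.subset ?_)
    rintro _ ⟨A, -, rfl⟩
    exact fun e he => he.1
  · rintro _ ⟨_, ⟨A, hA, rfl⟩, rfl⟩
    obtain ⟨U, hUF, hAU⟩ := hZ hA
    rw [hU U hUF] at hAU
    have hfinA : (type A).Finite := hE'f.subset fun e he => he.1
    obtain ⟨p, hpp, hpe, hpC⟩ := exists_idem_lower_bound hfinA (fun e he => hE'i e he.1)
      (idem_sinv_mul (a U))
    have hp : p ∈ A.dom := hpC A (sinv_mul_mem_dom hAU.1) fun e he => he.2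
    -- Containing `a U * p` forces the idempotents of the type into the domain, and omitting the
    -- elements `a U * p * e` keeps the others out.
    refine ⟨a U * p, (fun e => a U * p * e) '' (E' \ type A),
      (hE'f.subset Set.sdiff_subset).image _, ?_, ?_⟩
    · rintro _ ⟨e, he, rfl⟩
      exact natLE_mul_idem _ (hE'i e he.1)
    have ha' : sinv (a U) * a U ∈ E' := Or.inr ⟨_, Or.inl ⟨U, hUF, rfl⟩, rfl⟩
    have hmemU : ∀ B : ProperFilter S, type B = type A → a U ∈ B.carrier → B ∈ U := by
      intro B hB ha
      rw [hU U hUF]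
      refine ⟨ha, fun b hb hbB => hAU.2 b hb ?_⟩
      rw [mem_iff_of_natLE hAU.1 (hLa U hUF b hb)]
      refine ((htype _ _).1 hB _ ?_).1 (sinv_mul_mem_dom hbB)
      exact Or.inr ⟨b, Or.inr (Set.mem_biUnion hUF hb), rfl⟩
    ext B
    constructor
    · rintro ⟨hBZ, hB⟩
      have h1 : sinv (a U) * a U ∈ B.dom :=
        ((htype _ _).1 hB _ ha').2 (sinv_mul_mem_dom hAU.1)
      obtain ⟨B', hB', hd⟩ := exists_mem_dom_eq h1
      have hB'A : type B' = type A := by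
        rw [← hB, htype]
        intro e _
        rw [hd]
      -- `B` may come from another basic set than `U`, but `U` has a member with the same domain,
      -- and `d` is injective on the whole of `X`.
      have h2 : B' = B := pX.1 ⟨U, hUF, hmemU B' hB'A hB'⟩ (hZ hBZ) hd
      rw [h2] at hB'
      refine ⟨mul_mem_of_dom hB' ?_, ?_⟩
      · exact hpC B h1 fun e he => by
          rw [← hB] at he
          exact he.2
      · rintro _ ⟨e, he, rfl⟩ h
        rw [mul_idem_mem_iff (hE'i e he.1)] at h
        refine he.2 ?_
        rw [← hB]
        exact ⟨he.1, h.2⟩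
    · rintro ⟨hB, hBe⟩
      have hB' := (mul_idem_mem_iff hpp).1 hB
      have h1 : type B = type A := by
        ext e
        constructor
        · rintro ⟨he, h⟩
          by_contra hn
          exact hBe _ ⟨e, ⟨he, hn⟩, rfl⟩ ((mul_idem_mem_iff (hE'i e he)).2 ⟨hB, h⟩)
        · exact fun h => ⟨h.1, dom_upward hB'.2 (hpe e h)⟩
      refine ⟨hEZ A hA B ⟨U, hUF, hmemU B h1 hB'.1⟩ fun e he => ?_, h1⟩
      exact (htype _ _).1 h1.symm e (Or.inl he)
  · rintro _ ⟨τ, -, rfl⟩ _ ⟨τ', -, rfl⟩ hne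
    refine Set.disjoint_left.2 ?_
    rintro A ⟨-, h1⟩ ⟨-, h2⟩
    exact hne (by rw [← h1, ← h2])
  · ext A
    constructor
    · exact fun h => ⟨_, ⟨_, ⟨A, h, rfl⟩, rfl⟩, h, rfl⟩
    · rintro ⟨_, ⟨_, -, rfl⟩, h, -⟩
      exact h

end Filters

open ProperFilter

/-! ### `B(S)` is a Boolean inverse semigroup that contains `S`. -/

namespace Booleanization

variable {S : Type u} [SemigroupWithZero S] [IsInverseSemigroup S]

theorem val_mul (X Y : Booleanization S) : (X * Y).1 = setMul X.1 Y.1 := rfl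

theorem val_zero : (0 : Booleanization S).1 = ∅ := rfl

/-- The inverse of an element of `B(S)`. -/
def inv (X : Booleanization S) : Booleanization S := ⟨setInv X.1, X.2.setInv⟩

theorem val_inv (X : Booleanization S) : X.inv.1 = setInv X.1 := rfl

theorem inv_inv_eq (X : Booleanization S) : X.inv.inv = X :=
  Subtype.ext (by ext A; rw [val_inv, val_inv, mem_setInv, mem_setInv, ProperFilter.inv_inv_eq])

theorem isIdempotentElem_iff {X : Booleanization S} :
    IsIdempotentElem X ↔ ∀ A ∈ X.1, A.IsUnit :=
  ⟨fun h _ hA => isUnit_of_setMul_self X.2.1 (congrArg Subtype.val h) hA,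
    fun h => Subtype.ext (setMul_self_of_isUnit h)⟩

theorem isInverseOf_inv (X : Booleanization S) : IsInverseOf X X.inv := by
  have h : ∀ X : Booleanization S, X * X.inv * X = X := fun X => by
    rw [mul_assoc]
    exact Subtype.ext (setMul_setInv_mul X.2.1)
  refine ⟨h X, ?_⟩
  have := h X.inv
  rwa [inv_inv_eq] at this

instance isInverseSemigroup : IsInverseSemigroup (Booleanization S) := by
  refine isInverseSemigroup_of_comm (fun X => ⟨_, isInverseOf_inv X⟩) fun X Y hX hY => ?_
  rw [isIdempotentElem_iff] at hX hY
  refine Subtype.ext ?_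
  rw [val_mul, val_mul]
  ext C
  rw [mem_setMul_of_isUnit hX, mem_setMul_of_isUnit hY]
  constructor
  · rintro ⟨h1, h2⟩
    have h3 := (hX C h1).unit_eq
    rw [h3] at h2 ⊢
    exact ⟨h2, h1⟩
  · rintro ⟨h1, h2⟩
    have h3 := (hY C h1).unit_eq
    rw [h3] at h2 ⊢
    exact ⟨h2, h1⟩

theorem sinv_eq_inv (X : Booleanization S) : sinv X = X.inv := sinv_eq (isInverseOf_inv X)

/-- For `X ⊆ Y` the idempotent is `X⁻¹X`: as `d` is injective on `Y`, restricting `Y` to the domains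
of `X` leaves `X`. -/
theorem natLE_iff {X Y : Booleanization S} : NatLE X Y ↔ X.1 ⊆ Y.1 := by
  constructor
  · rintro ⟨E, hE, rfl⟩ A hA
    rw [isIdempotentElem_iff] at hE
    exact ((mem_setMul_of_isUnit hE).1 hA).1
  · intro h
    have hE := (isInverseOf_inv X).idem_left
    refine ⟨_, hE, Subtype.ext ?_⟩
    rw [isIdempotentElem_iff] at hE
    ext C
    rw [val_mul, mem_setMul_of_isUnit hE, val_mul, val_inv, mem_setInv_mul_self X.2.1]
    constructor
    · exact fun hC => ⟨h hC, C, hC, rfl⟩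
    · rintro ⟨hC, A, hA, hCA⟩
      have : C = A := Y.2.1.1 hC (h hA) (by rw [← C.dom_unit, hCA, A.dom_unit])
      rwa [this]

/-- The arrow `A⁻¹ · B` lies in `X⁻¹Y`, so it is an identity, and `B = A · (A⁻¹ · B) = A`. -/
theorem eq_of_idem_left {X Y : Booleanization S} (h : IsIdempotentElem (X.inv * Y))
    {A B : ProperFilter S} (hA : A ∈ X.1) (hB : B ∈ Y.1) (hr : A.ran = B.ran) : A = B := by
  rw [isIdempotentElem_iff] at h
  have h1 := isProd_gmul A.inv B (A.dom_inv.trans hr)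
  have h2 := h _ ⟨A.inv, by rwa [val_inv, mem_setInv, ProperFilter.inv_inv_eq], B, hB, h1⟩
  have h3 := h1.inv_mul
  rw [ProperFilter.inv_inv_eq] at h3
  exact (h3.unique (isProd_of_isUnit h2 h3.1)).symm

/-- Idempotency of `X⁻¹Y` gives injectivity of `r` across the two sets, and that of `XY⁻¹` gives
injectivity of `d`. Conversely, with `Z` the union, both products sit inside `Z⁻¹Z` and `ZZ⁻¹`,
which consist of identities. -/
theorem compat_iff {X Y : Booleanization S} : Compat X Y ↔ IsPartialBisection (X.1 ∪ Y.1) := by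
  constructor
  · rintro ⟨h1, h2⟩
    rw [sinv_eq_inv] at h1 h2
    have h2' : IsIdempotentElem (X.inv.inv * Y.inv) := by rwa [inv_inv_eq]
    have hd : ∀ {A B : ProperFilter S}, A ∈ X.1 → B ∈ Y.1 → A.dom = B.dom → A = B := by
      intro A B hA hB h
      have h3 := eq_of_idem_left h2' (A := A.inv) (B := B.inv)
        (by rwa [val_inv, mem_setInv, ProperFilter.inv_inv_eq])
        (by rwa [val_inv, mem_setInv, ProperFilter.inv_inv_eq]) (by rw [ran_inv, ran_inv, h])
      rw [← ProperFilter.inv_inv_eq A, h3, ProperFilter.inv_inv_eq]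
    constructor
    · rintro A (hA | hA) B (hB | hB) h
      · exact X.2.1.1 hA hB h
      · exact hd hA hB h
      · exact (hd hB hA h.symm).symm
      · exact Y.2.1.1 hA hB h
    · rintro A (hA | hA) B (hB | hB) h
      · exact X.2.1.2 hA hB h
      · exact eq_of_idem_left h1 hA hB h
      · exact (eq_of_idem_left h1 hB hA h.symm).symm
      · exact Y.2.1.2 hA hB h
  · intro h
    have key : IsPartialBisection (setInv (X.1 ∪ Y.1)) := h.setInv
    rw [Compat, sinv_eq_inv, sinv_eq_inv, isIdempotentElem_iff, isIdempotentElem_iff]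
    constructor
    · rintro C ⟨A, hA, B, hB, hC⟩
      have h1 : C ∈ setMul (setInv (X.1 ∪ Y.1)) (X.1 ∪ Y.1) := ⟨A, Or.inl hA, B, Or.inr hB, hC⟩
      obtain ⟨D, -, rfl⟩ := (mem_setInv_mul_self h).1 h1
      exact D.isUnit_unit
    · rintro C ⟨A, hA, B, hB, hC⟩
      exact mem_mul_setInv_self h ⟨A, Or.inl hA, B, Or.inr hB, hC⟩

theorem isJoin_of_eq_union {X Y Z : Booleanization S} (h : Z.1 = X.1 ∪ Y.1) : IsJoin X Y Z := by
  refine ⟨natLE_iff.2 ?_, natLE_iff.2 ?_, fun W h1 h2 => natLE_iff.2 ?_⟩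
  · rw [h]
    exact Set.subset_union_left
  · rw [h]
    exact Set.subset_union_right
  · rw [h]
    exact Set.union_subset (natLE_iff.1 h1) (natLE_iff.1 h2)

theorem _root_.InvSemigroup.IsBooleanElement.union {S : Type u} [SemigroupWithZero S]
    {X Y : Set (ProperFilter S)} (hX : IsBooleanElement X) (hY : IsBooleanElement Y)
    (h : IsPartialBisection (X ∪ Y)) : IsBooleanElement (X ∪ Y) := by
  obtain ⟨-, F, hF, bF, rfl⟩ := hX
  obtain ⟨-, G, hG, bG, rfl⟩ := hY
  refine ⟨h, F ∪ G, hF.union hG, ?_, (Set.sUnion_union F G).symm⟩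
  rintro U (hU | hU)
  · exact bF U hU
  · exact bG U hU

theorem eq_union_of_isJoin {X Y Z : Booleanization S} (hc : Compat X Y) (h : IsJoin X Y Z) :
    Z.1 = X.1 ∪ Y.1 := by
  have hb := X.2.union Y.2 (compat_iff.1 hc)
  have h1 : IsJoin X Y ⟨X.1 ∪ Y.1, hb⟩ := isJoin_of_eq_union rfl
  rw [h.unique h1]

theorem isBooleanElement_of_finite {X Z : Set (ProperFilter S)} (hX : IsBooleanElement X)
    (hZ : Z ⊆ X) (E : Set S) (hE : E.Finite) (hEi : ∀ e ∈ E, IsIdempotentElem e)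
    (hEZ : ∀ A ∈ Z, ∀ B ∈ X, (∀ e ∈ E, e ∈ A.dom ↔ e ∈ B.dom) → B ∈ Z) :
    IsBooleanElement Z := by
  obtain ⟨G, hG, bG, -, h⟩ := exists_disjoint_basic hX hZ E hE hEi hEZ
  exact ⟨hX.1.mono hZ, G, hG, bG, h⟩

/-- Membership in an element of `B(S)` is decided by finitely many conditions on domains. -/
theorem exists_finite_type {X Y : Set (ProperFilter S)} (hX : IsPartialBisection X)
    (hY : IsBooleanElement Y) (h : Y ⊆ X) :
    ∃ E : Set S, E.Finite ∧ (∀ e ∈ E, IsIdempotentElem e) ∧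
      ∀ A ∈ Y, ∀ B ∈ X, (∀ e ∈ E, e ∈ A.dom ↔ e ∈ B.dom) → B ∈ Y := by
  obtain ⟨pY, F, hF, bF, rfl⟩ := hY
  choose! a L hL hLa hU using bF
  -- The domains of all elements occurring in a description of `Y` by basic sets.
  refine ⟨(fun s => sinv s * s) '' (a '' F ∪ ⋃ U ∈ F, L U),
    ((hF.image _).union (hF.biUnion hL)).image _, ?_, ?_⟩
  · rintro _ ⟨s, -, rfl⟩
    exact idem_sinv_mul s
  · rintro A ⟨U, hUF, hAU⟩ B hB hAB
    rw [hU U hUF] at hAU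
    obtain ⟨B', hB', hd⟩ := exists_mem_dom_eq
      ((hAB _ ⟨_, Or.inl ⟨U, hUF, rfl⟩, rfl⟩).1 (sinv_mul_mem_dom hAU.1))
    have h1 : B' ∈ ⋃₀ F := by
      refine ⟨U, hUF, ?_⟩
      rw [hU U hUF]
      refine ⟨hB', fun b hb hbB => hAU.2 b hb ?_⟩
      rw [mem_iff_of_natLE hAU.1 (hLa U hUF b hb), hAB _ ⟨b, Or.inr (Set.mem_biUnion hUF hb), rfl⟩,
        ← hd]
      exact sinv_mul_mem_dom hbB
    rwa [hX.1 hB (h h1) hd.symm]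

/-- The finitely many domain conditions that decide membership in `Y` inside `X` decide the
complement as well. -/
theorem _root_.InvSemigroup.IsBooleanElement.diff {X Y : Set (ProperFilter S)}
    (hX : IsBooleanElement X) (hY : IsBooleanElement Y) (h : Y ⊆ X) : IsBooleanElement (X \ Y) := by
  obtain ⟨E, hE, hEi, hEY⟩ := exists_finite_type hX.1 hY h
  refine isBooleanElement_of_finite hX Set.sdiff_subset E hE hEi fun A hA B hB hAB => ⟨hB, ?_⟩
  exact fun hBY => hA.2 (hEY B hBY A hA.1 fun e he => (hAB e he).symm)

/-- This decomposition becomes the orthogonal sum in the ring. -/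
theorem exists_disjoint (X : Booleanization S) :
    ∃ G : Set (Set (ProperFilter S)), G.Finite ∧ (∀ U ∈ G, IsBasic U) ∧ G.PairwiseDisjoint id ∧
      X.1 = ⋃₀ G :=
  exists_disjoint_basic X.2 subset_rfl ∅ Set.finite_empty (by simp) fun _ _ _ hB _ => hB

/-- The element of `B(S)` given by a set of proper filters. -/
def ofSet (X : Set (ProperFilter S)) (hX : IsBooleanElement X) : Booleanization S := ⟨X, hX⟩

theorem val_ofSet {S : Type u} [SemigroupWithZero S] {X : Set (ProperFilter S)}
    (hX : IsBooleanElement X) : (ofSet X hX).1 = X := rfl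

theorem _root_.InvSemigroup.IsBasic.isBooleanElement {U : Set (ProperFilter S)} (hU : IsBasic U) :
    IsBooleanElement U := by
  obtain ⟨a, L, hL, hLa, rfl⟩ := hU
  exact ⟨isPartialBisection_basic a L, {basic a L}, Set.finite_singleton _,
    by rintro _ rfl; exact ⟨a, L, hL, hLa, rfl⟩, by simp⟩

/-- Every subunion of a partial bisection is a partial bisection, so a finite union can be built by
compatible joins with one basic set at a time. -/
theorem induction {motive : Booleanization S → Prop} (zero : motive 0)
    (union : ∀ U Y Z : Booleanization S, IsBasic U.1 → Compat U Y → Z.1 = U.1 ∪ Y.1 →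
      motive Y → motive Z) (X : Booleanization S) : motive X := by
  obtain ⟨X, hX⟩ := X
  have key : ∀ F : Set (Set (ProperFilter S)), F.Finite → (∀ U ∈ F, IsBasic U) →
      ∀ Z : Booleanization S, Z.1 = ⋃₀ F → motive Z := by
    intro F hF
    induction F, hF using Set.Finite.induction_on with
    | empty =>
      intro _ Z hZ
      rw [show Z = 0 from Subtype.ext (hZ.trans Set.sUnion_empty)]
      exact zero
    | @insert U F _ hF ih =>
      intro bF Z hZ
      rw [Set.sUnion_insert] at hZ
      have bF' : ∀ V ∈ F, IsBasic V := fun V hV => bF V (Set.mem_insert_of_mem _ hV)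
      have hU := bF U (Set.mem_insert U F)
      have pZ : IsPartialBisection (U ∪ ⋃₀ F) := hZ ▸ Z.2.1
      have hY : IsBooleanElement (⋃₀ F) := ⟨pZ.mono Set.subset_union_right, F, hF, bF', rfl⟩
      exact union (ofSet U hU.isBooleanElement) (ofSet _ hY) Z hU (compat_iff.2 pZ) hZ
        (ih bF' _ rfl)
  obtain ⟨pX, F, hF, bF, rfl⟩ := hX
  exact key F hF bF _ rfl

theorem mul_eq_zero_of_disjoint {X Y : Booleanization S} (hX : ∀ A ∈ X.1, A.IsUnit)
    (hY : ∀ A ∈ Y.1, A.IsUnit) (h : Disjoint X.1 Y.1) : X * Y = 0 := by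
  refine Subtype.ext ?_
  rw [val_mul, val_zero, Set.eq_empty_iff_forall_notMem]
  intro C hC
  obtain ⟨h1, h2⟩ := (mem_setMul_of_isUnit hY).1 hC
  rw [(hX C h1).unit_eq] at h2
  exact Set.disjoint_left.1 h h1 h2

variable (S) in
theorem isBooleanInverse : IsBooleanInverse (Booleanization S) where
  isInverse := isInverseSemigroup
  exists_join X Y h :=
    ⟨⟨X.1 ∪ Y.1, X.2.union Y.2 (compat_iff.1 h)⟩, isJoin_of_eq_union rfl⟩
  mul_join X Y Z W hc h := by
    refine isJoin_of_eq_union ?_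
    rw [val_mul, val_mul, val_mul, eq_union_of_isJoin hc h]
    ext C
    constructor
    · rintro ⟨A, hA, B, hB | hB, hC⟩
      · exact Or.inl ⟨A, hA, B, hB, hC⟩
      · exact Or.inr ⟨A, hA, B, hB, hC⟩
    · rintro (⟨A, hA, B, hB, hC⟩ | ⟨A, hA, B, hB, hC⟩)
      · exact ⟨A, hA, B, Or.inl hB, hC⟩
      · exact ⟨A, hA, B, Or.inr hB, hC⟩
  join_mul X Y Z W hc h := by
    refine isJoin_of_eq_union ?_
    rw [val_mul, val_mul, val_mul, eq_union_of_isJoin hc h]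
    ext C
    constructor
    · rintro ⟨A, hA | hA, B, hB, hC⟩
      · exact Or.inl ⟨A, hA, B, hB, hC⟩
      · exact Or.inr ⟨A, hA, B, hB, hC⟩
    · rintro (⟨A, hA, B, hB, hC⟩ | ⟨A, hA, B, hB, hC⟩)
      · exact ⟨A, Or.inl hA, B, hB, hC⟩
      · exact ⟨A, Or.inr hA, B, hB, hC⟩
  exists_compl X Y hX hY h := by
    rw [natLE_iff] at h
    have hX' := isIdempotentElem_iff.1 hX
    have hY' := isIdempotentElem_iff.1 hY
    refine ⟨⟨X.1 \ Y.1, X.2.diff Y.2 h⟩, isIdempotentElem_iff.2 fun A hA => hX' A hA.1, ?_,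
      isJoin_of_eq_union (Set.union_sdiff_cancel h).symm⟩
    exact mul_eq_zero_of_disjoint hY' (fun A hA => hX' A hA.1) Set.disjoint_sdiff_right

/-- The principal filter of `b` belongs to `U_a` exactly when `b ≤ a`. Zero has no principal filter
and is treated apart. -/
theorem injective_toBooleanization : Function.Injective (toBooleanization S) := by
  have key : ∀ a b : S, toBooleanization S a = toBooleanization S b → NatLE b a := by
    intro a b h
    have h' : basic a (∅ : Set S) = basic b ∅ := congrArg Subtype.val h
    by_cases hb : b = 0
    · rw [hb]
      exact ⟨0, mul_zero 0, (mul_zero a).symm⟩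
    · have h1 : principal b hb ∈ basic b (∅ : Set S) := ⟨natLE_refl b, by simp⟩
      rw [← h'] at h1
      exact h1.1
  exact fun a b h => (key b a h.symm).antisymm (key a b h)

theorem toBooleanization_zero : toBooleanization S 0 = 0 := by
  refine Subtype.ext ?_
  rw [val_zero, Set.eq_empty_iff_forall_notMem]
  exact fun A hA => A.zero_notMem hA.1

end Booleanization

/-! ### Prime filters of distributive and Boolean inverse semigroups. -/

section Prime

variable {T : Type v} [SemigroupWithZero T]

/-- A proper filter is prime if it contains one of two compatible elements as soon as it contains
their join. -/
def ProperFilter.IsPrime (P : ProperFilter T) : Prop :=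
  ∀ a b c : T, Compat a b → IsJoin a b c → c ∈ P.carrier → a ∈ P.carrier ∨ b ∈ P.carrier

variable [IsInverseSemigroup T]

/-- A filter that contains `a`, omits `b` and is maximal for that. -/
theorem exists_maximal_filter {a b : T} (h : ¬ NatLE a b) :
    ∃ P : ProperFilter T, a ∈ P.carrier ∧ b ∉ P.carrier ∧
      ∀ Q : ProperFilter T, P.carrier ⊆ Q.carrier → b ∉ Q.carrier → Q.carrier ⊆ P.carrier := by
  have h0 : ∀ x : T, NatLE 0 x := fun x => ⟨0, mul_zero 0, (mul_zero x).symm⟩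
  have ha : a ≠ 0 := by
    rintro rfl
    exact h (h0 b)
  let F : Set (Set T) := {C | ∃ P : ProperFilter T, P.carrier = C ∧ b ∉ C}
  obtain ⟨C, hC, hmax⟩ := zorn_subset_nonempty F (by
    rintro c hc hchain ⟨C₀, hC₀⟩
    have hb : b ∉ ⋃₀ c := by
      rintro ⟨C, hC, hbC⟩
      exact (hc hC).choose_spec.2 hbC
    refine ⟨⋃₀ c, ⟨⟨⋃₀ c, ?_, ?_, ?_, ?_⟩, rfl, hb⟩, fun s hs => Set.subset_sUnion_of_mem hs⟩
    · obtain ⟨P, rfl, -⟩ := hc hC₀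
      obtain ⟨x, hx⟩ := P.nonempty
      exact ⟨x, _, hC₀, hx⟩
    · rintro x y ⟨C, hC, hx⟩ hxy
      obtain ⟨P, rfl, -⟩ := hc hC
      exact ⟨_, hC, P.upward _ _ hx hxy⟩
    · rintro x y ⟨C, hC, hx⟩ ⟨D, hD, hy⟩
      have hdir : ∃ E ∈ c, x ∈ E ∧ y ∈ E := by
        rcases hchain.total hC hD with h | h
        · exact ⟨D, hD, h hx, hy⟩
        · exact ⟨C, hC, hx, h hy⟩
      obtain ⟨E, hE, hx, hy⟩ := hdir
      obtain ⟨P, rfl, -⟩ := hc hE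
      obtain ⟨z, hz, h1, h2⟩ := P.directed _ _ hx hy
      exact ⟨z, ⟨_, hE, hz⟩, h1, h2⟩
    · rintro ⟨C, hC, h⟩
      obtain ⟨P, rfl, -⟩ := hc hC
      exact P.zero_notMem h) (principal a ha).carrier ⟨_, rfl, h⟩
  obtain ⟨⟨P, rfl, hb⟩, hm⟩ := hmax
  refine ⟨P, hC (natLE_refl a), hb, fun Q h1 h2 => hm ⟨Q, rfl, h2⟩ h1⟩

/-- Prime filters separate the elements of a distributive inverse semigroup. -/
theorem exists_prime (hT : IsDistributiveInverse T) {a b : T} (h : ¬ NatLE a b) :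
    ∃ P : ProperFilter T, P.IsPrime ∧ a ∈ P.carrier ∧ b ∉ P.carrier := by
  have h0 : ∀ x : T, NatLE 0 x := fun x => ⟨0, mul_zero 0, (mul_zero x).symm⟩
  obtain ⟨P, ha, hb, hmax⟩ := exists_maximal_filter h
  -- otherwise `b` belongs to the filter generated by `P` and `x`
  have key : ∀ x c : T, NatLE x c → c ∈ P.carrier → x ∉ P.carrier →
      ∃ p ∈ P.carrier, NatLE (x * (sinv p * p)) b := by
    intro x c hxc hc hx
    by_contra! hcon
    refine hx (hmax ⟨{y | ∃ p ∈ P.carrier, NatLE (x * (sinv p * p)) y}, ⟨x, c, hc, ?_⟩, ?_, ?_, ?_⟩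
      ?_ ?_ ⟨c, hc, ?_⟩)
    · exact natLE_mul_idem x (idem_sinv_mul c)
    · rintro y z ⟨p, hp, h1⟩ h2
      exact ⟨p, hp, h1.trans h2⟩
    · rintro y z ⟨p, hp, h1⟩ ⟨q, hq, h2⟩
      obtain ⟨r, hr, h3, h4⟩ := P.directed p q hp hq
      exact ⟨_, ⟨r, hr, natLE_refl _⟩, ((natLE_refl x).mul h3.domain).trans h1,
        ((natLE_refl x).mul h4.domain).trans h2⟩
    · rintro ⟨p, hp, h1⟩
      exact hcon p hp (h1.trans (h0 b))
    -- The new filter contains `P` because `x ≤ c`: for `r ≤ p, c` in `P`, `x * (r⁻¹ * r) ≤ c * (r⁻¹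
    -- * r) = r ≤ p`.
    · intro p hp
      obtain ⟨r, hr, h1, h2⟩ := P.directed p c hp hc
      refine ⟨r, hr, (hxc.mul (natLE_refl _)).trans ?_⟩
      rw [h2.eq_mul]
      exact h1
    · rintro ⟨p, hp, h1⟩
      exact hcon p hp h1
    · exact natLE_mul_idem x (idem_sinv_mul c)
  refine ⟨P, fun x y c hxy hc hcP => ?_, ha, hb⟩
  by_contra! hcon
  obtain ⟨p, hp, h1⟩ := key x c hc.1 hcP hcon.1
  obtain ⟨q, hq, h2⟩ := key y c hc.2.1 hcP hcon.2
  obtain ⟨r, hr, h3, h4⟩ := P.directed p q hp hq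
  obtain ⟨s, hs, h5, h6⟩ := P.directed r c hr hcP
  -- Restricted to the domain of `s`, both `x` and `y` are below `b`, hence so is their join, which
  -- is `c * (s⁻¹ * s) = s`. This puts `b` into `P`.
  have h7 := (hT.join_mul x y c (sinv s * s) hxy hc).2.2 b
    (((natLE_refl x).mul (h5.trans h3).domain).trans h1)
    (((natLE_refl y).mul (h5.trans h4).domain).trans h2)
  rw [h6.eq_mul] at h7
  exact hb (P.upward _ _ hs h7)

theorem natLE_of_prime (hT : IsDistributiveInverse T) {a b : T}
    (h : ∀ P : ProperFilter T, P.IsPrime → a ∈ P.carrier → b ∈ P.carrier) : NatLE a b := by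
  by_contra hn
  obtain ⟨P, hP, ha, hb⟩ := exists_prime hT hn
  exact hb (h P hP ha)

theorem eq_of_prime (hT : IsDistributiveInverse T) {a b : T}
    (h : ∀ P : ProperFilter T, P.IsPrime → (a ∈ P.carrier ↔ b ∈ P.carrier)) : a = b :=
  (natLE_of_prime hT fun P hP => (h P hP).1).antisymm (natLE_of_prime hT fun P hP => (h P hP).2)

namespace ProperFilter

/-- Multiplying by some `x` in `Q` moves a join from `R` to `P`, by distributivity; primeness
selects a summand there, and `x` is cancelled again. -/
theorem IsPrime.right (hT : IsDistributiveInverse T) {P Q R : ProperFilter T} (hP : P.IsPrime)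
    (h : IsProd Q R P) : R.IsPrime := by
  intro a b c hab hc hcR
  obtain ⟨x, hx⟩ := Q.nonempty
  have h1 : x * c ∈ P.carrier := by
    rw [h.2]
    exact ⟨x, hx, c, hcR, natLE_refl _⟩
  have hab' : Compat (x * a) (x * b) := by
    have e : ∀ a b : T, IsIdempotentElem (sinv a * b) →
        IsIdempotentElem (sinv (x * a) * (x * b)) := by
      intro a b h
      refine NatLE.idem (e := sinv a * b) ?_ h
      rw [sinv_mul, show sinv a * sinv x * (x * b) = sinv a * ((sinv x * x) * b) by
        simp only [mul_assoc]]
      exact (natLE_refl _).mul (natLE_idem_mul b (idem_sinv_mul x))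
    refine ⟨e a b hab.1, ?_⟩
    have h2 := idem_conj hab.2 (sinv x)
    rw [sinv_sinv] at h2
    rw [sinv_mul]
    simpa only [mul_assoc] using h2
  rcases hP _ _ _ hab' (hT.mul_join a b c x hab hc) h1 with h2 | h2
  · rw [h.2] at h2
    exact Or.inl (mem_right_of_mul_mem h.1 hx h2)
  · rw [h.2] at h2
    exact Or.inr (mem_right_of_mul_mem h.1 hx h2)

theorem IsPrime.left (hT : IsDistributiveInverse T) {P Q R : ProperFilter T} (hP : P.IsPrime)
    (h : IsProd Q R P) : Q.IsPrime := by
  intro a b c hab hc hcQ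
  obtain ⟨x, hx⟩ := R.nonempty
  have h1 : c * x ∈ P.carrier := by
    rw [h.2]
    exact ⟨c, hcQ, x, hx, natLE_refl _⟩
  have hab' : Compat (a * x) (b * x) := by
    refine ⟨?_, ?_⟩
    · have h2 := idem_conj hab.1 x
      rw [sinv_mul]
      simpa only [mul_assoc] using h2
    · refine NatLE.idem (e := a * sinv b) ?_ hab.2
      rw [sinv_mul, show a * x * (sinv x * sinv b) = a * ((x * sinv x) * sinv b) by
        simp only [mul_assoc]]
      exact (natLE_refl _).mul (natLE_idem_mul _ (idem_mul_sinv x))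
  rcases hP _ _ _ hab' (hT.join_mul a b c x hab hc) h1 with h2 | h2
  · rw [h.2] at h2
    exact Or.inl (mem_left_of_mul_mem h.1 hx h2)
  · rw [h.2] at h2
    exact Or.inr (mem_left_of_mul_mem h.1 hx h2)

end ProperFilter

theorem compat_of_idem {e f : T} (he : IsIdempotentElem e) (hf : IsIdempotentElem f) :
    Compat e f := by
  rw [Compat, sinv_idem he, sinv_idem hf]
  exact ⟨idem_mul he hf, idem_mul he hf⟩

/-- Relative complements in a Boolean inverse semigroup. -/
theorem exists_cut (hT : IsBooleanInverse T) (t : T) {f : T} (hf : IsIdempotentElem f) :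
    ∃ t' : T, ∀ P : ProperFilter T, P.IsPrime →
      (t' ∈ P.carrier ↔ t ∈ P.carrier ∧ f ∉ P.dom) := by
  have he := idem_sinv_mul t
  have hef := idem_mul he hf
  obtain ⟨g, hg, hfg, hj⟩ := hT.exists_compl (sinv t * t) (sinv t * t * f) he hef
    (natLE_mul_idem _ hf)
  refine ⟨t * g, fun P hP => ?_⟩
  rw [mul_idem_mem_iff hg]
  refine and_congr_right fun ht => ?_
  constructor
  · intro h1 h2
    have h3 := mul_mem_dom (mul_mem_dom (sinv_mul_mem_dom ht) h2) h1
    rw [hfg] at h3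
    exact P.zero_notMem_dom h3
  · intro h1
    -- The domain of `P`, seen as a filter, is a right factor of `P`, so it is prime and can be
    -- tested on the complemented join.
    have h3 : P.unit.IsPrime := hP.right hT.toIsDistributiveInverse P.isProd_unit
    rcases h3 _ _ _ (compat_of_idem hef hg) hj (sinv_mul_mem_dom ht) with h4 | h4
    · exact absurd (dom_upward h4 (natLE_idem_mul f he)) h1
    · exact h4

end Prime

/-! ### The universal property. -/

section Lift

variable {S : Type u} [SemigroupWithZero S] [IsInverseSemigroup S]
  {T : Type v} [SemigroupWithZero T] [IsInverseSemigroup T]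

/-- The proper filter `A` of `S` lies under the filter `P` of `T` if `θ` maps `A` to `P`, and any
idempotent that `θ` maps to the domain of `P` is in the domain of `A`. -/
def LiesUnder (θ : S →ₙ* T) (A : ProperFilter S) (P : ProperFilter T) : Prop :=
  (∀ a ∈ A.carrier, θ a ∈ P.carrier) ∧ ∀ e, IsIdempotentElem e → θ e ∈ P.dom → e ∈ A.dom

variable {θ : S →ₙ* T}

theorem LiesUnder.map_dom {A : ProperFilter S} {P : ProperFilter T} (h : LiesUnder θ A P) {s : S}
    (hs : s ∈ A.dom) : θ s ∈ P.dom := by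
  obtain ⟨c, hc, h1⟩ := mem_dom.1 hs
  refine mem_dom.2 ⟨_, h.1 c hc, ?_⟩
  rw [← map_sinv, ← map_mul]
  exact h1.map θ

theorem LiesUnder.map_ran {A : ProperFilter S} {P : ProperFilter T} (h : LiesUnder θ A P) {s : S}
    (hs : s ∈ A.ran) : θ s ∈ P.ran := by
  obtain ⟨c, hc, h1⟩ := mem_ran.1 hs
  refine mem_ran.2 ⟨_, h.1 c hc, ?_⟩
  rw [← map_sinv, ← map_mul]
  exact h1.map θ

theorem LiesUnder.mem_of_natLE {A : ProperFilter S} {P : ProperFilter T} (h : LiesUnder θ A P)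
    {a b : S} (ha : a ∈ A.carrier) (hb : NatLE b a) (h1 : θ b ∈ P.carrier) : b ∈ A.carrier := by
  rw [mem_iff_of_natLE ha hb]
  refine h.2 _ (idem_sinv_mul b) ?_
  rw [map_mul, map_sinv]
  exact sinv_mul_mem_dom h1

/-- The condition imposed on domains passes to ranges, because `e * a ≤ a` and elements below `a`
are controlled by domains. -/
theorem LiesUnder.mem_ran {A : ProperFilter S} {P : ProperFilter T} (h : LiesUnder θ A P) {e : S}
    (he : IsIdempotentElem e) (h1 : θ e ∈ P.ran) : e ∈ A.ran := by
  obtain ⟨a, ha⟩ := A.nonempty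
  have h2 : e * a ∈ A.carrier := by
    refine h.mem_of_natLE ha (natLE_idem_mul a he) ?_
    rw [map_mul]
    exact mul_mem_of_ran (h.1 a ha) h1
  refine ProperFilter.mem_ran.2 ⟨_, h2, ?_⟩
  rw [sinv_mul, sinv_idem he, show e * a * (sinv a * e) = e * ((a * sinv a) * e) by
    simp only [mul_assoc]]
  exact natLE_mul_idem e (idem_mul (idem_mul_sinv a) he)

/-- The filter is generated by the elements `a * e` with `θ e` in the domain of `P`; it is proper
because `θ (a * e)` is in `P`. -/
theorem exists_liesUnder (hθ : θ 0 = 0) {P : ProperFilter T} {a : S} (ha : θ a ∈ P.carrier) :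
    ∃ A : ProperFilter S, a ∈ A.carrier ∧ LiesUnder θ A P := by
  have haa : θ (sinv a * a) ∈ P.dom := by
    rw [map_mul, map_sinv]
    exact sinv_mul_mem_dom ha
  refine ⟨{ carrier := {s | ∃ e, IsIdempotentElem e ∧ θ e ∈ P.dom ∧ NatLE (a * e) s}
            nonempty := ⟨_, _, idem_sinv_mul a, haa, natLE_refl _⟩
            upward := ?_, directed := ?_, zero_notMem := ?_ }, ?_, ?_, ?_⟩
  · rintro s t ⟨e, he, h1, h2⟩ h3
    exact ⟨e, he, h1, h2.trans h3⟩
  · rintro s t ⟨e, he, h1, h2⟩ ⟨f, hf, h3, h4⟩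
    refine ⟨a * (e * f), ⟨_, idem_mul he hf, ?_, natLE_refl _⟩, ?_, ?_⟩
    · rw [map_mul]
      exact mul_mem_dom h1 h3
    · exact ((natLE_refl a).mul (natLE_mul_idem e hf)).trans h2
    · exact ((natLE_refl a).mul (natLE_idem_mul f he)).trans h4
  · rintro ⟨e, he, h1, h2⟩
    have h3 := mul_mem_of_dom ha h1
    rw [← map_mul, natLE_zero h2, hθ] at h3
    exact P.zero_notMem h3
  · exact ⟨_, idem_sinv_mul a, haa, by rw [mul_sinv_mul]; exact natLE_refl a⟩
  · rintro s ⟨e, he, h1, h2⟩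
    have h3 := mul_mem_of_dom ha h1
    rw [← map_mul] at h3
    exact P.upward _ _ h3 (h2.map θ)
  · intro e he h1
    refine mem_dom.2 ⟨a * e, ⟨e, he, h1, natLE_refl _⟩, ?_⟩
    rw [sinv_mul, sinv_idem he, show e * sinv a * (a * e) = e * ((sinv a * a) * e) by
      simp only [mul_assoc]]
    exact natLE_mul_idem e (idem_mul (idem_sinv_mul a) he)

/-- `t` is the value at `X` of the extension of `θ` to `B(S)`. -/
def IsLift (θ : S →ₙ* T) (X : Set (ProperFilter S)) (t : T) : Prop :=
  ∀ P : ProperFilter T, P.IsPrime → (t ∈ P.carrier ↔ ∃ A ∈ X, LiesUnder θ A P)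

theorem IsLift.unique {S : Type u} [SemigroupWithZero S] {θ : S →ₙ* T}
    (hT : IsDistributiveInverse T) {X : Set (ProperFilter S)} {t t' : T}
    (h : IsLift θ X t) (h' : IsLift θ X t') : t = t' :=
  eq_of_prime hT fun P hP => (h P hP).trans (h' P hP).symm

theorem isLift_basic (hθ : θ 0 = 0) (a : S) : IsLift θ (basic a ∅) (θ a) := by
  intro P _
  constructor
  · intro h
    obtain ⟨A, h1, h2⟩ := exists_liesUnder hθ h
    exact ⟨A, ⟨h1, by simp⟩, h2⟩
  · rintro ⟨A, hA, h⟩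
    exact h.1 a hA.1

/-- For `A` under `P` with `a ∈ A`, omitting `b ≤ a` means that `θ (b⁻¹ * b)` is not in the domain
of `P`, so each omission is a relative complement in `T`. -/
theorem exists_isLift_basic (hT : IsBooleanInverse T) (hθ : θ 0 = 0) (a : S) {L : Set S}
    (hL : L.Finite) (hLa : ∀ b ∈ L, NatLE b a) : ∃ t, IsLift θ (basic a L) t := by
  induction L, hL using Set.Finite.induction_on with
  | empty => exact ⟨_, isLift_basic hθ a⟩
  | @insert b L _ _ ih =>
    obtain ⟨t, ht⟩ := ih fun c hc => hLa c (Set.mem_insert_of_mem _ hc)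
    obtain ⟨t', ht'⟩ := exists_cut hT t (isIdempotentElem_map θ (idem_sinv_mul b))
    refine ⟨t', fun P hP => ?_⟩
    rw [ht' P hP, ht P hP]
    have hb := hLa b (Set.mem_insert b L)
    constructor
    · rintro ⟨⟨A, ⟨hA, hAL⟩, h⟩, h1⟩
      refine ⟨A, ⟨hA, ?_⟩, h⟩
      rintro c (rfl | hc) hcA
      · exact h1 (h.map_dom (sinv_mul_mem_dom hcA))
      · exact hAL c hc hcA
    · rintro ⟨A, ⟨hA, hAL⟩, h⟩
      refine ⟨⟨A, ⟨hA, fun c hc => hAL c (Set.mem_insert_of_mem _ hc)⟩, h⟩, fun h1 => ?_⟩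
      refine hAL b (Set.mem_insert b L) ?_
      rw [mem_iff_of_natLE hA hb]
      exact h.2 _ (idem_sinv_mul b) h1

/-- The domain and the range of a filter under `P` are determined by the idempotents that `θ` sends
to those of `P`, so composability descends from `T` to `S`. -/
theorem LiesUnder.dom_eq_ran {A B : ProperFilter S} {P Q : ProperFilter T} (hA : LiesUnder θ A P)
    (hB : LiesUnder θ B Q) (h : P.dom = Q.ran) : A.dom = B.ran := by
  ext s
  constructor
  · intro hs
    obtain ⟨c, hc, h1⟩ := mem_dom.1 hs
    have h2 := hB.mem_ran (idem_sinv_mul c) (h ▸ hA.map_dom (sinv_mul_mem_dom hc))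
    obtain ⟨d, hd, h3⟩ := ProperFilter.mem_ran.1 h2
    exact ProperFilter.mem_ran.2 ⟨d, hd, h3.trans h1⟩
  · intro hs
    obtain ⟨c, hc, h1⟩ := ProperFilter.mem_ran.1 hs
    have h2 := hA.2 _ (idem_mul_sinv c) (h.symm ▸ hB.map_ran (mul_sinv_mem_ran hc))
    exact dom_upward h2 h1

theorem LiesUnder.mul {A B C : ProperFilter S} {P Q R : ProperFilter T} (hA : LiesUnder θ A P)
    (hB : LiesUnder θ B Q) (hC : IsProd A B C) (hR : IsProd P Q R) : LiesUnder θ C R := by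
  constructor
  · intro c hc
    rw [hC.2] at hc
    obtain ⟨x, hx, y, hy, h⟩ := hc
    rw [hR.2]
    refine ⟨_, hA.1 x hx, _, hB.1 y hy, ?_⟩
    rw [← map_mul]
    exact h.map θ
  · intro e he h
    rw [hC.dom_eq]
    rw [hR.dom_eq] at h
    exact hB.2 e he h

theorem LiesUnder.inv {A : ProperFilter S} {P : ProperFilter T} (h : LiesUnder θ A P) :
    LiesUnder θ A.inv P.inv := by
  constructor
  · intro a ha
    rw [mem_inv, ← map_sinv]
    exact h.1 _ ha
  · intro e he h1
    rw [dom_inv] at h1 ⊢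
    exact h.mem_ran he h1

/-- A prime filter containing `t * t'` factors into primes, and the filters under the factors
multiply to one under `P`. Conversely, the factors of a filter under `P` must be shown to lie under
factors of `P`. -/
theorem IsLift.mul (hT : IsDistributiveInverse T) (hθ : θ 0 = 0) {X Y : Set (ProperFilter S)}
    {t t' : T} (h : IsLift θ X t) (h' : IsLift θ Y t') : IsLift θ (setMul X Y) (t * t') := by
  intro P hP
  constructor
  · intro ht
    obtain ⟨Q, R, hQ, hR, hQR⟩ := exists_isProd ht
    obtain ⟨A, hA, hAQ⟩ := (h Q (hP.left hT hQR)).1 hQ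
    obtain ⟨B, hB, hBR⟩ := (h' R (hP.right hT hQR)).1 hR
    have h1 := isProd_gmul A B (hAQ.dom_eq_ran hBR hQR.1)
    exact ⟨_, ⟨A, hA, B, hB, h1⟩, hAQ.mul hBR h1 hQR⟩
  · rintro ⟨C, ⟨A, hA, B, hB, hC⟩, hCP⟩
    obtain ⟨a, ha⟩ := A.nonempty
    obtain ⟨b, hb⟩ := B.nonempty
    have hab : θ a * θ b ∈ P.carrier := by
      rw [← map_mul]
      refine hCP.1 _ ?_
      rw [hC.2]
      exact ⟨a, ha, b, hb, natLE_refl _⟩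
    obtain ⟨Q, R, hQ, hR, hQR⟩ := exists_isProd hab
    obtain ⟨A', haA', hA'⟩ := exists_liesUnder hθ hQ
    obtain ⟨B', hbB', hB'⟩ := exists_liesUnder hθ hR
    have hC' := isProd_gmul A' B' (hA'.dom_eq_ran hB' hQR.1)
    have hC'P := hA'.mul hB' hC' hQR
    -- Both filters contain `a * b`, and both lie under `P`, which fixes their domains. The factors
    -- then agree too, since they share `a` and `b`.
    have hCC : C = gmul A' B' (hA'.dom_eq_ran hB' hQR.1) := by
      have hm : a * b ∈ C.carrier := by
        rw [hC.2]
        exact ⟨a, ha, b, hb, natLE_refl _⟩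
      refine eq_of_mem_of_dom_eq hm ⟨a, haA', b, hbB', natLE_refl _⟩ ?_
      ext s
      constructor
      · intro h1
        obtain ⟨e, he, hee, h2⟩ := exists_idem_of_mem_dom h1
        exact dom_upward (hC'P.2 e hee (hCP.map_dom he)) h2
      · intro h1
        obtain ⟨e, he, hee, h2⟩ := exists_idem_of_mem_dom h1
        exact dom_upward (hCP.2 e hee (hC'P.map_dom he)) h2
    rw [← hCC] at hC'
    have hBB : B = B' := eq_of_mem_of_dom_eq hb hbB' (hC.dom_eq.symm.trans hC'.dom_eq)
    have hAA : A = A' := eq_of_mem_of_dom_eq ha haA' (by rw [hC.1, hC'.1, hBB])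
    rw [hQR.2]
    exact ⟨t, (h Q (hP.left hT hQR)).2 ⟨A, hA, hAA ▸ hA'⟩, t',
      (h' R (hP.right hT hQR)).2 ⟨B, hB, hBB ▸ hB'⟩, natLE_refl _⟩

theorem ProperFilter.IsPrime.inv (hT : IsDistributiveInverse T) {P : ProperFilter T}
    (hP : P.IsPrime) : P.inv.IsPrime := by
  have h1 : P.unit.IsPrime := hP.right hT P.isProd_unit
  exact h1.left hT P.isProd_inv_self

theorem IsLift.sinv (hT : IsDistributiveInverse T) {X : Set (ProperFilter S)} {t : T}
    (h : IsLift θ X t) : IsLift θ (setInv X) (sinv t) := by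
  intro P hP
  have h1 : InvSemigroup.sinv t ∈ P.carrier ↔ t ∈ P.inv.carrier := by
    rw [mem_inv]
  rw [h1, h P.inv (hP.inv hT)]
  constructor
  · rintro ⟨A, hA, hAP⟩
    have h2 := hAP.inv
    rw [inv_inv_eq] at h2
    exact ⟨A.inv, by rwa [mem_setInv, inv_inv_eq], h2⟩
  · rintro ⟨A, hA, hAP⟩
    exact ⟨A.inv, hA, hAP.inv⟩

theorem IsLift.isIdempotentElem (hT : IsDistributiveInverse T) (hθ : θ 0 = 0)
    {X : Set (ProperFilter S)} (hX : setMul X X = X) {t : T} (h : IsLift θ X t) :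
    IsIdempotentElem t := by
  have h1 := h.mul hT hθ h
  rw [hX] at h1
  exact h1.unique hT h

theorem IsLift.isJoin {S : Type u} [SemigroupWithZero S] {θ : S →ₙ* T}
    (hT : IsDistributiveInverse T) {X Y : Set (ProperFilter S)} {t t' t'' : T}
    (h : IsLift θ X t) (h' : IsLift θ Y t') (h'' : IsLift θ (X ∪ Y) t'') : IsJoin t t' t'' := by
  refine ⟨natLE_of_prime hT fun P hP ht => ?_, natLE_of_prime hT fun P hP ht => ?_,
    fun d h1 h2 => natLE_of_prime hT fun P hP ht => ?_⟩
  · obtain ⟨A, hA, hAP⟩ := (h P hP).1 ht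
    exact (h'' P hP).2 ⟨A, Or.inl hA, hAP⟩
  · obtain ⟨A, hA, hAP⟩ := (h' P hP).1 ht
    exact (h'' P hP).2 ⟨A, Or.inr hA, hAP⟩
  · obtain ⟨A, hA | hA, hAP⟩ := (h'' P hP).1 ht
    · exact P.upward _ _ ((h P hP).2 ⟨A, hA, hAP⟩) h1
    · exact P.upward _ _ ((h' P hP).2 ⟨A, hA, hAP⟩) h2

theorem exists_isLift (hT : IsBooleanInverse T) (hθ : θ 0 = 0) (X : Booleanization S) :
    ∃ t, IsLift θ X.1 t := by
  have hD := hT.toIsDistributiveInverse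
  induction X using Booleanization.induction with
  | zero =>
    refine ⟨0, fun P _ => ⟨fun h => absurd h P.zero_notMem, ?_⟩⟩
    rintro ⟨A, hA, -⟩
    exact hA.elim
  | union U Y Z hU hc hZ ih =>
    obtain ⟨t', ht'⟩ := ih
    obtain ⟨t, ht⟩ : ∃ t, IsLift θ U.1 t := by
      obtain ⟨a, L, hL, hLa, hUa⟩ := hU
      rw [hUa]
      exact exists_isLift_basic hT hθ a hL hLa
    -- The products deciding compatibility in `T` are lifts of the corresponding idempotents of
    -- `B(S)`, and a lift of an idempotent is idempotent by uniqueness.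
    have hc' : Compat t t' := by
      rw [Compat, Booleanization.sinv_eq_inv, Booleanization.sinv_eq_inv] at hc
      exact ⟨((ht.sinv hD).mul hD hθ ht').isIdempotentElem hD hθ (congrArg Subtype.val hc.1),
        (ht.mul hD hθ (ht'.sinv hD)).isIdempotentElem hD hθ (congrArg Subtype.val hc.2)⟩
    obtain ⟨t'', h⟩ := hT.exists_join t t' hc'
    refine ⟨t'', fun P hP => ?_⟩
    rw [hZ]
    constructor
    · intro h1
      rcases hP _ _ _ hc' h h1 with h2 | h2
      · obtain ⟨A, hA, hAP⟩ := (ht P hP).1 h2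
        exact ⟨A, Or.inl hA, hAP⟩
      · obtain ⟨A, hA, hAP⟩ := (ht' P hP).1 h2
        exact ⟨A, Or.inr hA, hAP⟩
    · rintro ⟨A, hA | hA, hAP⟩
      · exact P.upward _ _ ((ht P hP).2 ⟨A, hA, hAP⟩) h.1
      · exact P.upward _ _ ((ht' P hP).2 ⟨A, hA, hAP⟩) h.2.1

theorem exists_morphism (hT : IsBooleanInverse T) (hθ : θ 0 = 0) :
    ∃ γ : Booleanization S →ₙ* T, IsMorphism γ ∧ ∀ s, γ (toBooleanization S s) = θ s := by
  have hD := hT.toIsDistributiveInverse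
  choose γ hγ using fun X : Booleanization S => exists_isLift hT hθ X
  refine ⟨⟨γ, fun X Y => (hγ (X * Y)).unique hD ((hγ X).mul hD hθ (hγ Y))⟩, ⟨?_, ?_⟩, fun s => ?_⟩
  · refine (hγ 0).unique hD fun P _ => ⟨fun h => absurd h P.zero_notMem, ?_⟩
    rintro ⟨A, hA, -⟩
    exact hA.elim
  · intro X Y Z hc hj
    have h := hγ Z
    rw [Booleanization.eq_union_of_isJoin hc hj] at h
    exact (hγ X).isJoin hD (hγ Y) h
  · exact (hγ _).unique hD (isLift_basic hθ s)

/-- A prime filter containing `g` contains the join of `f` and `g'`; it cannot contain `f`, as `f *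
g = 0`, so it contains `g'`. -/
theorem complement_unique (hT : IsDistributiveInverse T) {e f g g' : T} (hf : IsIdempotentElem f)
    (hg : IsIdempotentElem g) (hg' : IsIdempotentElem g') (h : f * g = 0) (h' : f * g' = 0)
    (hj : IsJoin f g e) (hj' : IsJoin f g' e) : g = g' := by
  have key : ∀ g g' : T, IsIdempotentElem g → IsIdempotentElem g' → f * g = 0 → IsJoin f g e →
      IsJoin f g' e → NatLE g g' := by
    intro g g' hg hg' h hj hj'
    refine natLE_of_prime hT fun P hP hgP => ?_
    rcases hP _ _ _ (compat_of_idem hf hg') hj' (P.upward _ _ hgP hj.2.1) with h1 | h1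
    · obtain ⟨c, hc, h2, h3⟩ := P.directed _ _ h1 hgP
      have h4 := h2.mul h3
      rw [h, (h2.idem hf).eq] at h4
      rw [natLE_zero h4] at hc
      exact absurd hc P.zero_notMem
    · exact h1
  exact (key g g' hg hg' h hj hj').antisymm (key g' g hg' hg h' hj' hj)

/-- Two morphisms on `B(S)` that agree on `S` are equal. -/
theorem morphism_ext (hT : IsDistributiveInverse T) {γ γ' : Booleanization S →ₙ* T}
    (h : IsMorphism γ) (h' : IsMorphism γ')
    (hS : ∀ s, γ (toBooleanization S s) = γ' (toBooleanization S s)) : γ = γ' := by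
  -- Morphisms carry complements of idempotents to complements, and these are unique in `T`.
  have hcompl : ∀ X Y : Booleanization S, IsIdempotentElem X → IsIdempotentElem Y →
      ∀ Z : Booleanization S, Y.1 ⊆ X.1 → Z.1 = X.1 \ Y.1 → γ X = γ' X → γ Y = γ' Y →
      γ Z = γ' Z := by
    intro X Y hX hY Z hYX hZ h1 h2
    have hXu := Booleanization.isIdempotentElem_iff.1 hX
    have hYu := Booleanization.isIdempotentElem_iff.1 hY
    have hZu : ∀ A ∈ Z.1, A.IsUnit := fun A hA => hXu A (by rw [hZ] at hA; exact hA.1)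
    have hZi := Booleanization.isIdempotentElem_iff.2 hZu
    have hYZ : Y * Z = 0 := Booleanization.mul_eq_zero_of_disjoint hYu hZu (by
      rw [hZ]
      exact Set.disjoint_sdiff_right)
    have hj : IsJoin Y Z X := Booleanization.isJoin_of_eq_union (by
      rw [hZ, Set.union_sdiff_cancel hYX])
    have hc := compat_of_idem hY hZi
    have j1 := h.2 _ _ _ hc hj
    have j2 := h'.2 _ _ _ hc hj
    rw [← h1, ← h2] at j2
    refine complement_unique hT (isIdempotentElem_map γ hY) (isIdempotentElem_map γ hZi)
      (isIdempotentElem_map γ' hZi) ?_ ?_ j1 j2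
    · rw [← map_mul, hYZ, h.1]
    · rw [h2, ← map_mul, hYZ, h'.1]
  have hbasic : ∀ (a : S) (L : Set S), L.Finite → (∀ b ∈ L, NatLE b a) →
      ∀ X : Booleanization S, X.1 = basic a L → γ X = γ' X := by
    intro a L hL
    induction L, hL using Set.Finite.induction_on with
    | empty =>
      intro _ X hX
      rw [show X = toBooleanization S a from Subtype.ext hX]
      exact hS a
    | @insert b L _ hL ih =>
      intro hLa X hX
      have hLa' : ∀ c ∈ L, NatLE c a := fun c hc => hLa c (Set.mem_insert_of_mem _ hc)
      have hb := hLa b (Set.mem_insert b L)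
      let Y : Booleanization S := Booleanization.ofSet (basic a L)
        (IsBasic.isBooleanElement ⟨a, L, hL, hLa', rfl⟩)
      have hY : γ Y = γ' Y := ih hLa' Y rfl
      have hi : ∀ s : S, IsIdempotentElem (toBooleanization S (sinv s * s)) := fun s =>
        isIdempotentElem_map _ (idem_sinv_mul s)
      -- `Z` is the complement of `U_{b⁻¹b}` in `U_{a⁻¹a}`; multiplying `Y` by it on the right cuts
      -- out the filters that contain `b`.
      let Z : Booleanization S := Booleanization.ofSet (basic (sinv a * a) {sinv b * b})
        (IsBasic.isBooleanElement ⟨_, _, Set.finite_singleton _, by rintro _ rfl; exact hb.domain,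
          rfl⟩)
      have hZ : γ Z = γ' Z := by
        refine hcompl _ _ (hi a) (hi b) Z ?_ ?_ (hS _) (hS _)
        · exact Booleanization.natLE_iff.1 (hb.domain.map (toBooleanization S))
        · ext A
          constructor
          · rintro ⟨h1, h2⟩
            exact ⟨⟨h1, by simp⟩, fun h3 => h2 _ rfl h3.1⟩
          · rintro ⟨h1, h2⟩
            refine ⟨h1.1, ?_⟩
            rintro _ rfl h3
            exact h2 ⟨h3, by simp⟩
      have hXYZ : X = Y * Z := by
        refine Subtype.ext ?_
        rw [hX, Booleanization.val_mul, Booleanization.val_ofSet,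
          Booleanization.val_ofSet, setMul_basic,
          mul_sinv_mul, Set.image_singleton, hb.eq_mul]
        -- The product formula replaces `L` by its translate by `a⁻¹ * a`, which is `L` itself since
        -- its elements lie below `a`.
        congr 1
        rw [Set.insert_eq, Set.union_comm]
        congr 1
        ext c
        constructor
        · intro hc
          refine ⟨c, hc, ?_⟩
          obtain ⟨e, he, rfl⟩ := hLa' c hc
          show a * e * (sinv a * a) = a * e
          rw [mul_assoc, idem_comm he (idem_sinv_mul a), ← mul_assoc, mul_sinv_mul]
        · rintro ⟨d, hd, rfl⟩
          obtain ⟨e, he, h1⟩ := hLa' d hd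
          have : d * (sinv a * a) = d := by
            rw [h1, mul_assoc, idem_comm he (idem_sinv_mul a), ← mul_assoc, mul_sinv_mul]
          show d * (sinv a * a) ∈ L
          rwa [this]
      rw [hXYZ, map_mul, map_mul, hY, hZ]
  ext X
  induction X using Booleanization.induction with
  | zero => rw [h.1, h'.1]
  | union U Y Z hU hc hZ ih =>
    have h2 : γ U = γ' U := by
      obtain ⟨a, L, hL, hLa, hUa⟩ := hU
      exact hbasic a L hL hLa U hUa
    have hj : IsJoin U Y Z := Booleanization.isJoin_of_eq_union hZ
    have j2 := h'.2 _ _ _ hc hj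
    rw [← h2, ← ih] at j2
    exact (h.2 _ _ _ hc hj).unique j2

end Lift

theorem isBooleanization_toBooleanization (S : Type u) [SemigroupWithZero S]
    [IsInverseSemigroup S] : IsBooleanization.{u, u, v} (toBooleanization S) where
  isBoolean := Booleanization.isBooleanInverse S
  map_zero := Booleanization.toBooleanization_zero
  injective := Booleanization.injective_toBooleanization
  existsUnique_lift T _ hT θ hθ := by
    have := hT.isInverse
    obtain ⟨γ, h1, h2⟩ := exists_morphism hT hθ
    refine ⟨γ, ⟨h1, h2⟩, fun γ' h' => ?_⟩
    exact morphism_ext hT.toIsDistributiveInverse h'.1 h1 fun s => by rw [h'.2, h2]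

/-! ### The faithful representation of the contracted algebra. -/

section Representation

variable {S : Type u} [SemigroupWithZero S] [IsInverseSemigroup S]

/-- The range of `C` determines the factor in `X`, and cancellation determines the other. Hence the
choice made in `setOp` is immaterial for partial bisections. -/
theorem ProperFilter.IsProd.eq_of_ran {X : Set (ProperFilter S)} (hX : IsPartialBisection X)
    {A B A' B' C : ProperFilter S} (hA : A ∈ X) (hA' : A' ∈ X) (h : IsProd A B C)
    (h' : IsProd A' B' C) : A = A' ∧ B = B' := by
  have h1 : A = A' := hX.2 hA hA' (h.ran_eq.symm.trans h'.ran_eq)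
  subst h1
  exact ⟨rfl, h.inv_mul.unique h'.inv_mul⟩

open Classical in
/-- The operator by which a set of proper filters acts on the functions on the groupoid of proper
filters. -/
noncomputable def setOp (X : Set (ProperFilter S)) : Module.End ℂ (ProperFilter S → ℂ) where
  toFun f C := if h : ∃ B, ∃ A ∈ X, IsProd A B C then f h.choose else 0
  map_add' f g := by
    ext C
    by_cases h : ∃ B, ∃ A ∈ X, IsProd A B C <;> simp [h]
  map_smul' c f := by
    ext C
    by_cases h : ∃ B, ∃ A ∈ X, IsProd A B C <;> simp [h]

theorem setOp_apply {X : Set (ProperFilter S)} (hX : IsPartialBisection X) {A B C : ProperFilter S}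
    (hA : A ∈ X) (h : IsProd A B C) (f : ProperFilter S → ℂ) : setOp X f C = f B := by
  have hex : ∃ B, ∃ A ∈ X, IsProd A B C := ⟨B, A, hA, h⟩
  have h1 : setOp X f C = f hex.choose := dif_pos hex
  rw [h1]
  obtain ⟨A', hA', h'⟩ := hex.choose_spec
  rw [(h'.eq_of_ran hX hA' hA h).2]

theorem setOp_apply_of_not {S : Type u} [SemigroupWithZero S] {X : Set (ProperFilter S)}
    {C : ProperFilter S} (h : ¬ ∃ B, ∃ A ∈ X, IsProd A B C) (f : ProperFilter S → ℂ) : setOp X f C = 0 :=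
  dif_neg h

theorem setOp_empty {S : Type u} [SemigroupWithZero S] : setOp (∅ : Set (ProperFilter S)) = 0 := by
  ext1 f
  ext1 C
  rw [setOp_apply_of_not]
  · rfl
  · rintro ⟨B, A, hA, -⟩
    exact hA

theorem setOp_mul {X Y : Set (ProperFilter S)} (hX : IsPartialBisection X)
    (hY : IsPartialBisection Y) : setOp (setMul X Y) = setOp X * setOp Y := by
  ext1 f
  ext1 C
  rw [Module.End.mul_apply]
  by_cases h : ∃ B, ∃ A ∈ X, IsProd A B C
  · obtain ⟨B, A, hA, hC⟩ := h
    rw [setOp_apply hX hA hC]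
    by_cases h' : ∃ D, ∃ A' ∈ Y, IsProd A' D B
    · obtain ⟨D, A', hA', hB⟩ := h'
      rw [setOp_apply hY hA' hB]
      obtain ⟨F, hF, hFD⟩ := hB.assoc_left hC
      exact setOp_apply (hX.setMul hY) ⟨A, hA, A', hA', hF⟩ hFD f
    · rw [setOp_apply_of_not h', setOp_apply_of_not]
      rintro ⟨D, F, ⟨A₁, hA₁, A', hA', hF⟩, hFD⟩
      obtain ⟨B₁, h1, h2⟩ := hF.assoc_right hFD
      obtain ⟨-, rfl⟩ := h2.eq_of_ran hX hA₁ hA hC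
      exact h' ⟨D, A', hA', h1⟩
  · rw [setOp_apply_of_not h, setOp_apply_of_not]
    rintro ⟨D, F, ⟨A₁, hA₁, A', hA', hF⟩, hFD⟩
    obtain ⟨B₁, h1, h2⟩ := hF.assoc_right hFD
    exact h ⟨B₁, A₁, hA₁, h2⟩

/-- No arrow can factor through both sets: the two left factors would coincide, against
disjointness. So at each arrow at most one summand is nonzero. -/
theorem setOp_union {X Y : Set (ProperFilter S)} (h : IsPartialBisection (X ∪ Y))
    (hd : Disjoint X Y) : setOp (X ∪ Y) = setOp X + setOp Y := by
  have hX := h.mono (Set.subset_union_left (s := X) (t := Y))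
  have hY := h.mono (Set.subset_union_right (s := X) (t := Y))
  ext1 f
  ext1 C
  show setOp (X ∪ Y) f C = setOp X f C + setOp Y f C
  by_cases h1 : ∃ B, ∃ A ∈ X, IsProd A B C
  · obtain ⟨B, A, hA, hC⟩ := h1
    rw [setOp_apply h (Or.inl hA) hC, setOp_apply hX hA hC, setOp_apply_of_not, add_zero]
    rintro ⟨B', A', hA', hC'⟩
    obtain ⟨rfl, -⟩ := hC.eq_of_ran h (Or.inl hA) (Or.inr hA') hC'
    exact Set.disjoint_left.1 hd hA hA'
  · rw [setOp_apply_of_not h1, zero_add]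
    by_cases h2 : ∃ B, ∃ A ∈ Y, IsProd A B C
    · obtain ⟨B, A, hA, hC⟩ := h2
      rw [setOp_apply h (Or.inr hA) hC, setOp_apply hY hA hC]
    · rw [setOp_apply_of_not h2, setOp_apply_of_not]
      rintro ⟨B, A, hA | hA, hC⟩
      · exact h1 ⟨B, A, hA, hC⟩
      · exact h2 ⟨B, A, hA, hC⟩

theorem setOp_iUnion {ι : Type} (s : Finset ι) (X : ι → Set (ProperFilter S))
    (h : IsPartialBisection (⋃ i ∈ s, X i)) (hd : ∀ i j, i ≠ j → Disjoint (X i) (X j)) :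
    setOp (⋃ i ∈ s, X i) = ∑ i ∈ s, setOp (X i) := by
  classical
  induction s using Finset.induction_on with
  | empty => simpa using setOp_empty
  | insert i s hi ih =>
    rw [Finset.set_biUnion_insert] at h ⊢
    rw [setOp_union h, Finset.sum_insert hi, ih (h.mono Set.subset_union_right)]
    rw [Set.disjoint_iUnion₂_right]
    intro j hj
    exact hd i j (by rintro rfl; exact hi hj)

open Classical in
-- The operator recovers the indicator function of `X`; both faithfulness and linear independence
-- come from this evaluation.
theorem setOp_single {X : Set (ProperFilter S)} (hX : IsPartialBisection X) (A : ProperFilter S) :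
    setOp X (Pi.single A.unit 1) A = if A ∈ X then 1 else 0 := by
  by_cases h : ∃ B, ∃ A' ∈ X, IsProd A' B A
  · obtain ⟨B, A', hA', hA⟩ := h
    rw [setOp_apply hX hA' hA]
    by_cases hB : B = A.unit
    · subst hB
      rw [hA.unique (isProd_of_isUnit A.isUnit_unit hA.1), Pi.single_eq_same, if_pos hA']
    · rw [Pi.single_eq_of_ne hB, if_neg]
      exact fun h => hB (hA.eq_of_ran hX hA' h A.isProd_unit).2
  · rw [setOp_apply_of_not h, if_neg]
    exact fun h1 => h ⟨_, A, h1, A.isProd_unit⟩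

theorem setOp_injective {X Y : Set (ProperFilter S)} (hX : IsPartialBisection X)
    (hY : IsPartialBisection Y) (h : setOp X = setOp Y) : X = Y := by
  classical
  ext A
  have h1 := setOp_single hX A
  rw [h, setOp_single hY A] at h1
  by_cases hA : A ∈ X <;> by_cases hB : A ∈ Y <;> simp_all

variable (S) in
/-- The action of `S` on the functions on the groupoid of proper filters. -/
noncomputable def opHom : S →ₙ* Module.End ℂ (ProperFilter S → ℂ) where
  toFun s := setOp (basic s ∅)
  map_mul' s t := by
    rw [← setOp_mul (isPartialBisection_basic s ∅) (isPartialBisection_basic t ∅), setMul_basic]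
    simp

theorem liftMagma_opHom_apply (f : MonoidAlgebra ℂ S) :
    MonoidAlgebra.liftMagma ℂ (opHom S) f = f.coeff.sum fun s c => c • setOp (basic s ∅) := rfl

theorem liftMagma_opHom_single (s : S) :
    MonoidAlgebra.liftMagma ℂ (opHom S) (MonoidAlgebra.single s 1) = setOp (basic s ∅) :=
  (Finsupp.sum_single_index (h := fun s c => c • setOp (basic s ∅)) (zero_smul _ _)).trans
    (one_smul _ _)

/-- For `m` maximal among the nonzero elements of the support, the principal filter of `m` contains
no other element of the support. Evaluating there isolates the coefficient of `m`. -/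
theorem coeff_eq_zero_of_liftMagma (f : MonoidAlgebra ℂ S)
    (hf : MonoidAlgebra.liftMagma ℂ (opHom S) f = 0) {s : S} (hs : s ≠ 0) : f.coeff s = 0 := by
  classical
  by_contra hne
  let _ : PartialOrder S :=
    { le := NatLE
      le_refl := natLE_refl
      le_trans := fun _ _ _ => NatLE.trans
      le_antisymm := fun _ _ => NatLE.antisymm }
  have hmem : s ∈ f.coeff.support.filter (· ≠ 0) := by simp [hs, hne]
  obtain ⟨m, hm⟩ := (f.coeff.support.filter (· ≠ 0)).exists_maximal ⟨s, hmem⟩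
  have hm1 := Finset.mem_filter.1 hm.prop
  have h1 := congrFun (LinearMap.congr_fun hf (Pi.single (principal m hm1.2).unit 1))
    (principal m hm1.2)
  have h2 : ∀ t ∈ f.coeff.support, t ≠ m → f.coeff t *
      (setOp (basic t ∅) (Pi.single (principal m hm1.2).unit 1) (principal m hm1.2)) = 0 := by
    intro t ht htm
    rw [setOp_single (isPartialBisection_basic t ∅), if_neg, mul_zero]
    rintro ⟨h3, -⟩
    have h3 : NatLE m t := h3
    by_cases h0 : t = 0
    · rw [h0] at h3
      exact hm1.2 (natLE_zero h3)
    · exact htm (NatLE.antisymm (hm.le_of_ge (Finset.mem_filter.2 ⟨ht, h0⟩) h3) h3)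
  rw [liftMagma_opHom_apply, Finsupp.sum, LinearMap.sum_apply, Finset.sum_apply] at h1
  have h3 := (Finset.sum_eq_single m h2 (fun h => absurd hm1.1 h)).symm.trans h1
  rw [setOp_single (isPartialBisection_basic m ∅), if_pos ⟨natLE_refl m, by simp⟩, mul_one] at h3
  exact Finsupp.mem_support_iff.1 hm1.1 h3

/-- An element of the kernel is supported at the zero of `S`, hence is a multiple of the generator.
This makes the induced map on the quotient injective. -/
theorem mem_span_iff_liftMagma (f : MonoidAlgebra ℂ S) :
    f ∈ TwoSidedIdeal.span {MonoidAlgebra.single (0 : S) (1 : ℂ)} ↔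
      MonoidAlgebra.liftMagma ℂ (opHom S) f = 0 := by
  constructor
  · intro h
    have h1 : TwoSidedIdeal.span {MonoidAlgebra.single (0 : S) (1 : ℂ)} ≤
        TwoSidedIdeal.ker (MonoidAlgebra.liftMagma ℂ (opHom S)) := by
      rw [TwoSidedIdeal.span_le]
      rintro _ rfl
      rw [SetLike.mem_coe, TwoSidedIdeal.mem_ker, liftMagma_opHom_single,
        show basic (0 : S) ∅ = ∅ from
          congrArg Subtype.val (Booleanization.toBooleanization_zero (S := S)), setOp_empty]
    exact (TwoSidedIdeal.mem_ker _).1 (h1 h)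
  · intro h
    have h1 : f = MonoidAlgebra.single (0 : S) (f.coeff 0) * MonoidAlgebra.single (0 : S) 1 := by
      rw [MonoidAlgebra.single_mul_single, mul_one, mul_zero]
      refine MonoidAlgebra.coeff_injective (Finsupp.ext fun s => ?_)
      rw [MonoidAlgebra.coeff_single]
      by_cases hs : s = 0
      · rw [hs, Finsupp.single_eq_same]
      · rw [coeff_eq_zero_of_liftMagma f h hs, Finsupp.single_eq_of_ne hs]
    rw [h1]
    exact TwoSidedIdeal.mul_mem_left _ _ _ (TwoSidedIdeal.subset_span rfl)

variable (S) in
/-- The contracted semigroup algebra acts on the functions on the groupoid of proper filters. -/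
noncomputable def contractedRep :
    ContractedAlgebra S →ₙ+* Module.End ℂ (ProperFilter S → ℂ) where
  toFun := Quotient.lift (MonoidAlgebra.liftMagma ℂ (opHom S)) fun x y h => by
    have h1 := ((TwoSidedIdeal.span _).rel_iff x y).1 h
    rwa [mem_span_iff_liftMagma, map_sub, sub_eq_zero] at h1
  map_mul' := by
    rintro ⟨x⟩ ⟨y⟩
    exact map_mul (MonoidAlgebra.liftMagma ℂ (opHom S)) x y
  map_zero' := map_zero (MonoidAlgebra.liftMagma ℂ (opHom S))
  map_add' := by
    rintro ⟨x⟩ ⟨y⟩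
    exact map_add (MonoidAlgebra.liftMagma ℂ (opHom S)) x y

theorem contractedRep_injective : Function.Injective (contractedRep S) := by
  rintro ⟨x⟩ ⟨y⟩ h
  have h1 : MonoidAlgebra.liftMagma ℂ (opHom S) x = MonoidAlgebra.liftMagma ℂ (opHom S) y := h
  rw [← sub_eq_zero, ← map_sub, ← mem_span_iff_liftMagma] at h1
  exact Quotient.sound (((TwoSidedIdeal.span _).rel_iff x y).2 h1)

theorem contractedRep_toContracted (s : S) :
    contractedRep S (toContracted S s) = setOp (basic s ∅) :=
  liftMagma_opHom_single s

/-! ### Orthogonal sums and elements of `B(S)` -/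

/-- For `b ≤ a`, the set `U_{a;L}` is the disjoint union of `U_{a;b,L}` and its restriction to
`U_{b⁻¹b}`, so omitting `b` is the factor `1 - b⁻¹b` in the ring. -/
theorem exists_cutSet_of_isBasic {U : Set (ProperFilter S)} (hU : IsBasic U) :
    ∃ x ∈ cutSet ((toContracted S).srange : Set (ContractedAlgebra S)),
      contractedRep S x = setOp U := by
  obtain ⟨a, L, hL, hLa, rfl⟩ := hU
  have key : ∃ x, IsCutIdem ((toContracted S).srange : Set (ContractedAlgebra S)) x ∧
      contractedRep S (toContracted S a * x) = setOp (basic a L) := by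
    induction L, hL using Set.Finite.induction_on with
    | empty =>
      refine ⟨toContracted S (sinv a * a), .base _ ⟨_, rfl⟩
        (isIdempotentElem_map _ (idem_sinv_mul a)), ?_⟩
      rw [← map_mul, mul_sinv_mul, contractedRep_toContracted]
    | @insert b L _ hL ih =>
      have hLa' : ∀ c ∈ L, NatLE c a := fun c hc => hLa c (Set.mem_insert_of_mem _ hc)
      have hb := hLa b (Set.mem_insert b L)
      obtain ⟨x, hx, h⟩ := ih hLa'
      refine ⟨_, .cut x (toContracted S (sinv b * b)) hx ⟨_, rfl⟩
        (isIdempotentElem_map _ (idem_sinv_mul b)), ?_⟩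
      have hF : ∀ A ∈ basic (sinv b * b) (∅ : Set S), A.IsUnit :=
        fun A hA => isUnit_of_idem hA.1 (idem_sinv_mul b)
      have hu : basic a L = basic a (insert b L) ∪ setMul (basic a L) (basic (sinv b * b) ∅) := by
        ext A
        rw [Set.mem_union, mem_setMul_of_isUnit hF]
        constructor
        · intro hA
          by_cases hbA : b ∈ A.carrier
          · exact Or.inr ⟨hA, sinv_mul_mem_dom hbA, by simp⟩
          · refine Or.inl ⟨hA.1, ?_⟩
            rintro c (rfl | hc)
            · exact hbA
            · exact hA.2 c hc
        · rintro (hA | hA)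
          · exact ⟨hA.1, fun c hc => hA.2 c (Set.mem_insert_of_mem _ hc)⟩
          · exact hA.1
      have hd : Disjoint (basic a (insert b L)) (setMul (basic a L) (basic (sinv b * b) ∅)) := by
        refine Set.disjoint_left.2 fun A hA hA' => ?_
        rw [mem_setMul_of_isUnit hF] at hA'
        refine hA.2 b (Set.mem_insert b L) ?_
        rw [mem_iff_of_natLE hA.1 hb]
        exact hA'.2.1
      have h1 := isPartialBisection_basic a L
      rw [hu] at h1
      rw [mul_sub, ← mul_assoc, map_sub, map_mul _ (_ * _), h, contractedRep_toContracted,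
        ← setOp_mul (isPartialBisection_basic _ _) (isPartialBisection_basic _ _),
        sub_eq_iff_eq_add, ← setOp_union h1 hd, ← hu]
  obtain ⟨x, hx, h⟩ := key
  exact ⟨_, ⟨_, ⟨a, rfl⟩, x, hx, rfl⟩, h⟩

/-- Inside a partial bisection disjoint sets are orthogonal; this is one of the two required
products. -/
theorem setInv_mul_eq_empty {X Y : Set (ProperFilter S)} (h : IsPartialBisection (X ∪ Y))
    (hd : Disjoint X Y) : setMul (setInv X) Y = ∅ := by
  rw [Set.eq_empty_iff_forall_notMem]
  rintro C ⟨A, hA, B, hB, hC⟩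
  have h1 : A.inv = B := h.2 (Or.inl hA) (Or.inr hB) (by rw [ran_inv, hC.1])
  exact Set.disjoint_left.1 hd hA (h1 ▸ hB)

theorem mul_setInv_eq_empty {X Y : Set (ProperFilter S)} (h : IsPartialBisection (X ∪ Y))
    (hd : Disjoint X Y) : setMul X (setInv Y) = ∅ := by
  rw [Set.eq_empty_iff_forall_notMem]
  rintro C ⟨A, hA, B, hB, hC⟩
  have h1 : A = B.inv := h.1 (Or.inl hA) (Or.inr hB) (by rw [dom_inv, hC.1])
  exact Set.disjoint_left.1 hd hA (h1 ▸ hB)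

theorem isInverseOf_of_rep {X : Booleanization S} {x x' : ContractedAlgebra S}
    (h : contractedRep S x = setOp X.1) (h' : contractedRep S x' = setOp X.inv.1) :
    IsInverseOf x x' := by
  obtain ⟨h1, h2⟩ := Booleanization.isInverseOf_inv X
  refine ⟨contractedRep_injective ?_, contractedRep_injective ?_⟩
  · rw [map_mul, map_mul, h, h', ← setOp_mul X.2.1 X.inv.2.1,
      ← setOp_mul (X.2.1.setMul X.inv.2.1) X.2.1]
    exact congrArg (fun Z : Booleanization S => setOp Z.1) h1
  · rw [map_mul, map_mul, h, h', ← setOp_mul X.inv.2.1 X.2.1,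
      ← setOp_mul (X.inv.2.1.setMul X.2.1) X.inv.2.1]
    exact congrArg (fun Z : Booleanization S => setOp Z.1) h2

theorem exists_orthSums_of_booleanization (X : Booleanization S) :
    ∃ x ∈ booleanizationIn (toContracted S).srange, contractedRep S x = setOp X.1 := by
  obtain ⟨G, hG, bG, dG, hX⟩ := X.exists_disjoint
  have := hG.to_subtype
  obtain ⟨n, ⟨e⟩⟩ := Finite.exists_equiv_fin G
  choose x hx hrep using fun i : Fin n => exists_cutSet_of_isBasic (bG _ (e.symm i).2)
  choose y hy hrepy using fun i : Fin n => exists_cutSet_of_isBasic (bG _ (e.symm i).2).setInv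
  have hU : ⋃ i ∈ (Finset.univ : Finset (Fin n)), (e.symm i : G).1 = X.1 := by
    rw [hX]
    ext A
    simp only [Finset.mem_univ, Set.iUnion_true, Set.mem_iUnion]
    constructor
    · rintro ⟨i, hi⟩
      exact ⟨_, (e.symm i).2, hi⟩
    · rintro ⟨U, hU, hA⟩
      exact ⟨e ⟨U, hU⟩, by rwa [e.symm_apply_apply]⟩
  have hd : ∀ i j : Fin n, i ≠ j → Disjoint (e.symm i : G).1 (e.symm j : G).1 := fun i j hij =>
    dG (e.symm i).2 (e.symm j).2 fun h => hij (e.symm.injective (Subtype.ext h))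
  have hsub : ∀ i, (e.symm i : G).1 ⊆ X.1 := fun i => by
    rw [hX]
    exact Set.subset_sUnion_of_mem (e.symm i).2
  refine ⟨∑ i, x i, ⟨n, x, hx, fun i j hij => ?_, rfl⟩, ?_⟩
  · have hb : IsPartialBisection ((e.symm i : G).1 ∪ (e.symm j : G).1) :=
      X.2.1.mono (Set.union_subset (hsub i) (hsub j))
    have hi : ∀ i, IsInverseOf (x i) (y i) := fun i =>
      isInverseOf_of_rep (X := Booleanization.ofSet _ (bG _ (e.symm i).2).isBooleanElement)
        (hrep i) (hrepy i)
    refine ⟨y i, hy i, y j, hy j, hi i, hi j, contractedRep_injective ?_,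
      contractedRep_injective ?_⟩
    · rw [map_mul, hrep, hrepy, map_zero, ← setOp_mul (X.2.1.mono (hsub i)).setInv
        (X.2.1.mono (hsub j)), setInv_mul_eq_empty hb (hd i j hij), setOp_empty]
    · rw [map_mul, hrep, hrepy, map_zero, ← setOp_mul (X.2.1.mono (hsub i))
        (X.2.1.mono (hsub j)).setInv, mul_setInv_eq_empty hb (hd i j hij), setOp_empty]
  · rw [map_sum, Finset.sum_congr rfl fun i _ => hrep i, ← setOp_iUnion, hU]
    · rw [hU]
      exact X.2.1
    · exact hd

theorem exists_booleanization_of_isCutIdem {x : ContractedAlgebra S}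
    (hx : IsCutIdem ((toContracted S).srange : Set (ContractedAlgebra S)) x) :
    ∃ X : Booleanization S, contractedRep S x = setOp X.1 := by
  induction hx with
  | base e he _ =>
    obtain ⟨s, rfl⟩ := he
    exact ⟨toBooleanization S s, contractedRep_toContracted s⟩
  | cut x f _ hf hff ih =>
    obtain ⟨X, hX⟩ := ih
    obtain ⟨s, rfl⟩ := hf
    -- Only the image of `s` in the algebra is known to be idempotent; faithfulness of `setOp`
    -- carries this over to `B(S)`.
    have hi : IsIdempotentElem (toBooleanization S s) := by
      refine Subtype.ext (setOp_injective (toBooleanization S s * toBooleanization S s).2.1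
        (toBooleanization S s).2.1 ?_)
      rw [Booleanization.val_mul, setOp_mul (toBooleanization S s).2.1 (toBooleanization S s).2.1,
        show setOp (toBooleanization S s).1 = contractedRep S (toContracted S s) from
          (contractedRep_toContracted s).symm, ← map_mul, hff.eq]
    have hsub : (X * toBooleanization S s).1 ⊆ X.1 :=
      Booleanization.natLE_iff.1 (natLE_mul_idem X hi)
    refine ⟨Booleanization.ofSet _ (X.2.diff (X * toBooleanization S s).2 hsub), ?_⟩
    have h1 := setOp_union (X := X.1 \ (X * toBooleanization S s).1)
      (Y := (X * toBooleanization S s).1) (by rw [Set.sdiff_union_of_subset hsub]; exact X.2.1)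
      Set.disjoint_sdiff_left
    rw [Set.sdiff_union_of_subset hsub] at h1
    rw [map_sub, map_mul, hX, contractedRep_toContracted, Booleanization.val_ofSet,
      sub_eq_iff_eq_add]
    exact h1.trans (congrArg _ (setOp_mul X.2.1 (toBooleanization S s).2.1))

theorem exists_booleanization_of_cutSet {x : ContractedAlgebra S}
    (hx : x ∈ cutSet ((toContracted S).srange : Set (ContractedAlgebra S))) :
    ∃ X : Booleanization S, contractedRep S x = setOp X.1 := by
  obtain ⟨_, ⟨s, rfl⟩, e, he, rfl⟩ := hx
  obtain ⟨X, hX⟩ := exists_booleanization_of_isCutIdem he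
  refine ⟨toBooleanization S s * X, ?_⟩
  rw [map_mul, hX, contractedRep_toContracted, Booleanization.val_mul,
    setOp_mul (toBooleanization S s).2.1 X.2.1]
  rfl

theorem isBooleanElement_iUnion {S : Type u} [SemigroupWithZero S] {ι : Type} [Finite ι]
    {X : ι → Set (ProperFilter S)}
    (h : IsPartialBisection (⋃ i, X i)) (hX : ∀ i, IsBooleanElement (X i)) :
    IsBooleanElement (⋃ i, X i) := by
  choose _ F hF bF hXF using hX
  refine ⟨h, ⋃ i, F i, Set.finite_iUnion hF, ?_, ?_⟩
  · intro U hU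
    obtain ⟨i, hi⟩ := Set.mem_iUnion.1 hU
    exact bF i U hi
  · rw [Set.sUnion_iUnion]
    exact Set.iUnion_congr hXF

theorem eq_inv_of_rep {X X' : Booleanization S} {x x' : ContractedAlgebra S}
    (h : contractedRep S x = setOp X.1) (h' : contractedRep S x' = setOp X'.1)
    (hi : IsInverseOf x x') : X' = X.inv := by
  refine inverse_unique (s := X) ⟨Subtype.ext (setOp_injective (X * X' * X).2.1 X.2.1 ?_),
    Subtype.ext (setOp_injective (X' * X * X').2.1 X'.2.1 ?_)⟩ (Booleanization.isInverseOf_inv X)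
  · rw [Booleanization.val_mul, setOp_mul (X * X').2.1 X.2.1, Booleanization.val_mul,
      setOp_mul X.2.1 X'.2.1, ← h, ← h', ← map_mul, ← map_mul, hi.1]
  · rw [Booleanization.val_mul, setOp_mul (X' * X).2.1 X'.2.1, Booleanization.val_mul,
      setOp_mul X'.2.1 X.2.1, ← h, ← h', ← map_mul, ← map_mul, hi.2]

theorem mul_eq_zero_of_rep {X Y : Booleanization S} {x y : ContractedAlgebra S}
    (h : contractedRep S x = setOp X.1) (h' : contractedRep S y = setOp Y.1) (hxy : x * y = 0)
    {A B : ProperFilter S} (hA : A ∈ X.1) (hB : B ∈ Y.1) : A.dom ≠ B.ran := by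
  intro hAB
  have h1 : setMul X.1 Y.1 = ∅ := by
    refine setOp_injective (X * Y).2.1 (0 : Booleanization S).2.1 ?_
    rw [setOp_mul X.2.1 Y.2.1, ← h, ← h', ← map_mul, hxy, map_zero]
    exact setOp_empty.symm
  have h2 : gmul A B hAB ∈ setMul X.1 Y.1 := ⟨A, hA, B, hB, isProd_gmul A B hAB⟩
  rw [h1] at h2
  exact h2

theorem exists_booleanization_of_orthSums {x : ContractedAlgebra S}
    (hx : x ∈ booleanizationIn (toContracted S).srange) :
    ∃ X : Booleanization S, contractedRep S x = setOp X.1 := by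
  obtain ⟨n, a, ha, ho, rfl⟩ := hx
  choose X hX using fun i => exists_booleanization_of_cutSet (ha i)
  -- Orthogonality of two summands says that no pair in `XY⁻¹` or `X⁻¹Y` is composable, that is,
  -- that domains and ranges are disjoint. The union is therefore a partial bisection.
  have hdom : ∀ i j, i ≠ j → ∀ A ∈ (X i).1, ∀ B ∈ (X j).1, A.dom ≠ B.dom ∧ A.ran ≠ B.ran := by
    intro i j hij A hA B hB
    obtain ⟨a', ha', b', hb', h1, h2, h3, h4⟩ := ho i j hij
    obtain ⟨X', hX'⟩ := exists_booleanization_of_cutSet ha'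
    obtain ⟨Y', hY'⟩ := exists_booleanization_of_cutSet hb'
    have e1 := eq_inv_of_rep (hX i) hX' h1
    have e2 := eq_inv_of_rep (hX j) hY' h2
    constructor
    · rw [← ran_inv B]
      refine mul_eq_zero_of_rep (hX i) hY' h4 hA ?_
      rwa [e2, Booleanization.val_inv, mem_setInv, inv_inv_eq]
    · rw [← dom_inv A]
      refine mul_eq_zero_of_rep hX' (hX j) h3 ?_ hB
      rwa [e1, Booleanization.val_inv, mem_setInv, inv_inv_eq]
  have hb : IsPartialBisection (⋃ i, (X i).1) := by
    constructor
    · intro A hA B hB h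
      obtain ⟨i, hi⟩ := Set.mem_iUnion.1 hA
      obtain ⟨j, hj⟩ := Set.mem_iUnion.1 hB
      by_cases hij : i = j
      · subst hij
        exact (X i).2.1.1 hi hj h
      · exact absurd h (hdom i j hij A hi B hj).1
    · intro A hA B hB h
      obtain ⟨i, hi⟩ := Set.mem_iUnion.1 hA
      obtain ⟨j, hj⟩ := Set.mem_iUnion.1 hB
      by_cases hij : i = j
      · subst hij
        exact (X i).2.1.2 hi hj h
      · exact absurd h (hdom i j hij A hi B hj).2
  refine ⟨Booleanization.ofSet _ (isBooleanElement_iUnion hb fun i => (X i).2), ?_⟩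
  have hu : ⋃ i, (X i).1 = ⋃ i ∈ (Finset.univ : Finset (Fin n)), (X i).1 := by simp
  rw [map_sum, Finset.sum_congr rfl fun i _ => hX i, Booleanization.val_ofSet, hu, setOp_iUnion]
  · rwa [← hu]
  · exact fun i j hij => Set.disjoint_left.2 fun A hA hA' => (hdom i j hij A hA A hA').1 rfl

variable (S) in
-- Both semigroups embed in the operators and have the same image; `Φ` matches elements with equal
-- operators.
theorem exists_mulEquiv : ∃ Φ : Booleanization S ≃* booleanizationIn (toContracted S).srange,
    ∀ s : S, (Φ (toBooleanization S s) : ContractedAlgebra S) = toContracted S s := by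
  choose φ hφ hrep using exists_orthSums_of_booleanization (S := S)
  let Ψ : Booleanization S →ₙ* booleanizationIn (toContracted S).srange :=
    { toFun := fun X => ⟨φ X, hφ X⟩
      map_mul' := fun X Y => Subtype.ext (contractedRep_injective (by
        show contractedRep S (φ (X * Y)) = contractedRep S (φ X * φ Y)
        rw [map_mul, hrep, hrep, hrep, Booleanization.val_mul, setOp_mul X.2.1 Y.2.1])) }
  refine ⟨MulEquiv.ofBijective Ψ ⟨fun X Y h => ?_, fun x => ?_⟩, fun s => ?_⟩
  · have h1 : φ X = φ Y := congrArg Subtype.val h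
    refine Subtype.ext (setOp_injective X.2.1 Y.2.1 ?_)
    rw [← hrep, ← hrep, h1]
  · obtain ⟨X, hX⟩ := exists_booleanization_of_orthSums x.2
    exact ⟨X, Subtype.ext (contractedRep_injective ((hrep X).trans hX.symm))⟩
  · exact contractedRep_injective ((hrep _).trans (contractedRep_toContracted s).symm)

end Representation

/-! ### Transport along the isomorphism, and the conclusion. -/

section Transport

variable {A : Type u} {B : Type v} [SemigroupWithZero A] [SemigroupWithZero B]

theorem natLE_map_iff (Φ : A ≃* B) {a b : A} : NatLE (Φ a) (Φ b) ↔ NatLE a b := by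
  constructor
  · rintro ⟨e, he, h⟩
    refine ⟨Φ.symm e, isIdempotentElem_map (Φ.symm : B →ₙ* A) he, Φ.injective ?_⟩
    rw [map_mul, Φ.apply_symm_apply, h]
  · rintro ⟨e, he, rfl⟩
    exact ⟨Φ e, isIdempotentElem_map (Φ : A →ₙ* B) he, map_mul Φ b e⟩

theorem isJoin_map_iff (Φ : A ≃* B) {a b c : A} : IsJoin (Φ a) (Φ b) (Φ c) ↔ IsJoin a b c := by
  unfold IsJoin
  rw [natLE_map_iff, natLE_map_iff, Φ.surjective.forall]
  simp only [natLE_map_iff]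

theorem IsBooleanInverse.of_mulEquiv (hA : IsBooleanInverse A) (Φ : A ≃* B) :
    IsBooleanInverse B := by
  have := hA.isInverse
  have hidem : ∀ {a : A}, IsIdempotentElem (Φ a) → IsIdempotentElem a := fun {a} h =>
    Φ.injective ((map_mul Φ a a).trans h.eq)
  have hB : IsInverseSemigroup B := by
    refine isInverseSemigroup_of_comm ?_ ?_
    · rw [Φ.surjective.forall]
      intro a
      obtain ⟨h1, h2⟩ := isInverseOf_sinv a
      refine ⟨Φ (sinv a), ?_, ?_⟩
      · rw [← map_mul, ← map_mul, h1]
      · rw [← map_mul, ← map_mul, h2]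
    · rw [Φ.surjective.forall₂]
      intro e f he hf
      rw [← map_mul, ← map_mul, idem_comm (hidem he) (hidem hf)]
  have hs : ∀ a, Φ (sinv a) = sinv (Φ a) := fun a => by
    obtain ⟨h1, h2⟩ := isInverseOf_sinv a
    refine (sinv_eq ⟨?_, ?_⟩).symm
    · rw [← map_mul, ← map_mul, h1]
    · rw [← map_mul, ← map_mul, h2]
  have hc : ∀ {a b : A}, Compat (Φ a) (Φ b) → Compat a b := by
    rintro a b ⟨h1, h2⟩
    rw [← hs, ← map_mul] at h1 h2
    exact ⟨hidem h1, hidem h2⟩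
  -- `Φ` is only multiplicative; surjectivity makes `Φ 0` absorbing.
  have h0 : Φ 0 = 0 := by
    obtain ⟨z, hz⟩ := Φ.surjective 0
    rw [← mul_zero (Φ 0), ← hz, ← map_mul, zero_mul]
  refine ⟨⟨hB, ?_, ?_, ?_⟩, ?_⟩
  · rw [Φ.surjective.forall₂]
    intro a b h
    obtain ⟨c, hj⟩ := hA.exists_join a b (hc h)
    exact ⟨Φ c, (isJoin_map_iff Φ).2 hj⟩
  · rw [Φ.surjective.forall₂]
    intro a b
    rw [Φ.surjective.forall₂]
    intro c x h hj
    rw [← map_mul, ← map_mul, ← map_mul, isJoin_map_iff]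
    exact hA.mul_join a b c x (hc h) ((isJoin_map_iff Φ).1 hj)
  · rw [Φ.surjective.forall₂]
    intro a b
    rw [Φ.surjective.forall₂]
    intro c x h hj
    rw [← map_mul, ← map_mul, ← map_mul, isJoin_map_iff]
    exact hA.join_mul a b c x (hc h) ((isJoin_map_iff Φ).1 hj)
  · rw [Φ.surjective.forall₂]
    intro e f he hf h
    obtain ⟨g, hg, hfg, hj⟩ := hA.exists_compl e f (hidem he) (hidem hf) ((natLE_map_iff Φ).1 h)
    refine ⟨Φ g, isIdempotentElem_map (Φ : A →ₙ* B) hg, ?_, (isJoin_map_iff Φ).2 hj⟩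
    rw [← map_mul, hfg, h0]

end Transport

/-- On the left each summand begins with an element of `S`. On the right it ends with an element of
`E'`, which needs an induction over the cuts. -/
theorem toContracted_identity {S : Type u} [SemigroupWithZero S] [IsInverseSemigroup S] {e : S}
    (he : ∀ s : S, e * s = s ∧ s * e = s) {x : ContractedAlgebra S}
    (hx : x ∈ booleanizationIn (toContracted S).srange) :
    toContracted S e * x = x ∧ x * toContracted S e = x := by
  have hcut : ∀ y, IsCutIdem ((toContracted S).srange : Set (ContractedAlgebra S)) y →
      y * toContracted S e = y := by
    intro y hy
    induction hy with
    | base f hf _ =>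
      obtain ⟨s, rfl⟩ := hf
      rw [← map_mul, (he s).2]
    | cut y f _ hf _ ih =>
      obtain ⟨s, rfl⟩ := hf
      rw [sub_mul, ih, mul_assoc, ← map_mul, (he s).2]
  obtain ⟨n, a, ha, -, rfl⟩ := hx
  rw [Finset.mul_sum, Finset.sum_mul]
  constructor
  · refine Finset.sum_congr rfl fun i _ => ?_
    obtain ⟨_, ⟨s, rfl⟩, y, -, h⟩ := ha i
    rw [h, ← mul_assoc, ← map_mul, (he s).1]
  · refine Finset.sum_congr rfl fun i _ => ?_
    obtain ⟨_, ⟨s, rfl⟩, y, hy, h⟩ := ha i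
    rw [h, mul_assoc, hcut y hy]

end InvSemigroup

theorem mainTheorem6 (S : Type u) [SemigroupWithZero S] [InvSemigroup.IsInverseSemigroup S] :
    InvSemigroup.IsBooleanization.{u, u, v} (InvSemigroup.toBooleanization S) ∧
    InvSemigroup.IsBooleanInverse
      (InvSemigroup.booleanizationIn (InvSemigroup.toContracted S).srange) ∧
    (∀ e : S, (∀ s : S, e * s = s ∧ s * e = s) →
      ∀ x ∈ InvSemigroup.booleanizationIn (InvSemigroup.toContracted S).srange,
        InvSemigroup.toContracted S e * x = x ∧ x * InvSemigroup.toContracted S e = x) ∧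
    ∃ Φ : InvSemigroup.Booleanization S ≃*
        InvSemigroup.booleanizationIn (InvSemigroup.toContracted S).srange,
      ∀ s : S, (Φ (InvSemigroup.toBooleanization S s) : InvSemigroup.ContractedAlgebra S) =
        InvSemigroup.toContracted S s := by
  obtain ⟨Φ, hΦ⟩ := InvSemigroup.exists_mulEquiv S
  exact ⟨InvSemigroup.isBooleanization_toBooleanization S,
    (InvSemigroup.Booleanization.isBooleanInverse S).of_mulEquiv Φ,
    fun _ he _ hx => InvSemigroup.toContracted_identity he hx, Φ, hΦ⟩
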